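/- Let $d\ge 1$ be an integer and $0<s<d$. For measurable $\rho:\mathbb R^d\to[0,\infty)$ put $D(\rho,\rho)=\frac12\int_{\mathbb R^d}\int_{\mathbb R^d}\frac{\rho(x)\rho(y)}{|x-y|^s}\,dx\,dy$, and for a probability measure $P$ on $(\mathbb R^d)^n$ put $C(P)=\int\sum_{1\le j<k\le n}|x_j-x_k|^{-s}\,dP(x_1,\dots,x_n)$; let $\rho_P$ denote the sum of the $n$ one-particle marginals of $P$. If $\int\rho=N$ is an integer, the canonical indirect energy is $$E(\rho)=\inf\{C(P): P \text{ a probability measure on } (\mathbb R^d)^N,\ \rho_P=\rho\}-D(\rho,\rho).$$ For integrable $\rho$ the grand-canonical indirect energy is $$E_{\rm GC}(\rho)=\inf\Big\{\sum_{n\ge 0}\lambda_n C(P_n)\Big\}-D(\rho,\rho),$$ where the infimum runs over all coefficients $\lambda_n\ge0$ with $\sum_{n\ge0}\lambda_n=1$ and symmetric probability measures $P_n$ on $(\mathbb R^d)^n$ such that $\sum_{n\ge 0}\lambda_n\rho_{P_n}=\rho$. Write $E_{\rm GC}(\Omega)=E_{\rm GC}(\mathbf 1_\Omega)$. There is exactly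 one real number $e_{\rm UEG}=e_{\rm UEG}(d,s)$ with the following property: for all $\rho_0>0$, $t_0>0$, all continuous $\eta:[0,t_0)\to[0,\infty)$ with $\eta(0)=0$, and all sequences of bounded connected open sets $\Omega_N\subset\mathbb R^d$ such that $\rho_0|\Omega_N|$ is an integer, $|\Omega_N|\to\infty$ and $\big|\{x:{\rm d}(x,\partial\Omega_N)\le|\Omega_N|^{1/d}t\}\big|\le|\Omega_N|\,\eta(t)$ for all $N$ and all $0\le t<t_0$, one has $$\lim_{N\to\infty}\frac{E(\rho_0\mathbf 1_{\Omega_N})}{|\Omega_N|}=\rho_0^{1+s/d}\,e_{\rm UEG}.$$ Let $\Omega\subset\mathbb R^d$ be an open convex polyhedron (the non-empty interior of the convex hull of finitely many points) whose volume $|\Omega|$ is an integer, and which tiles $\mathbb R^d$: there is a set $\Gamma$ of Euclidean isometries such that $\mathbb R^d=\bigcup_{g\in\Gamma}g\,\overline\Omega$ and $g\,\Omega\cap g'\,\Omega=\emptyset$ for $g\ne g'$ in $\Gamma$. Then $$\frac{E_{\rm GC}(\Omega)}{|\Omega|}\ge e_{\rm UEG}.$$ -/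

import Mathlib

open MeasureTheory Filter Topology Set
open scoped ENNReal

noncomputable section

namespace UEG

/-- The Riesz interaction `1 / |x - y| ^ s`, with values in `[0, ∞]`; for `s > 0` it is `∞` on the
diagonal. -/
def riesz {d : ℕ} (s : ℝ) (x y : EuclideanSpace ℝ (Fin d)) : ℝ≥0∞ :=
  edist x y ^ (-s)

/-- The many-particle energy `C(P) = ∫ ∑_{j < k} |x_j - x_k| ^ (-s) dP(x_1, …, x_n)`. -/
def interactionEnergy {d n : ℕ} (s : ℝ) (P : Measure (Fin n → EuclideanSpace ℝ (Fin d))) : ℝ≥0∞ :=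
  ∫⁻ x, ∑ j, ∑ k ∈ Finset.Ioi j, riesz s (x j) (x k) ∂P

/-- The density of an `n`-particle probability, as a measure: the sum of its `n` one-particle
marginals. -/
def particleDensity {d n : ℕ} (P : Measure (Fin n → EuclideanSpace ℝ (Fin d))) :
    Measure (EuclideanSpace ℝ (Fin d)) :=
  ∑ i, P.map (fun x => x i)

/-- The direct term `D(ρ, ρ) = (1/2) ∫∫ ρ(x) ρ(y) |x - y| ^ (-s) dx dy`. -/
def directEnergy {d : ℕ} (s : ℝ) (ρ : EuclideanSpace ℝ (Fin d) → ℝ≥0∞) : ℝ≥0∞ :=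
  2⁻¹ * ∫⁻ x, ∫⁻ y, ρ x * ρ y * riesz s x y

/-- The canonical indirect energy `E(ρ)`: the infimum of `C(P)` over all `N`-particle probabilities
`P` (not necessarily symmetric) of density `ρ`, minus `D(ρ, ρ)`. The constraint on the density
forces `N = ∫ ρ`, so that the infimum over `N` only selects this integer. -/
def canonicalEnergy {d : ℕ} (s : ℝ) (ρ : EuclideanSpace ℝ (Fin d) → ℝ≥0∞) : EReal :=
  ((⨅ (N : ℕ) (P : Measure (Fin N → EuclideanSpace ℝ (Fin d))) (_ : IsProbabilityMeasure P)
      (_ : particleDensity P = volume.withDensity ρ), interactionEnergy s P : ℝ≥0∞) : EReal)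
    - (directEnergy s ρ : EReal)

/-- A grand-canonical probability `⊕ λ_n P_n`: a probability `λ` on the particle numbers and, for
each `n`, a symmetric probability measure on `(ℝ^d)^n`. -/
structure GrandCanonicalState (d : ℕ) where
  /-- the coefficients `λ_n ≥ 0`, which sum to one -/
  weight : PMF ℕ
  /-- the `n`-particle components `P_n` -/
  component : ∀ n : ℕ, Measure (Fin n → EuclideanSpace ℝ (Fin d))
  isProbability : ∀ n, IsProbabilityMeasure (component n)
  symmetric : ∀ (n : ℕ) (σ : Equiv.Perm (Fin n)),
    (component n).map (fun x => x ∘ σ) = component n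

/-- The density `∑ λ_n ρ_{P_n}` of a grand-canonical probability, as a measure. -/
def GrandCanonicalState.density {d : ℕ} (P : GrandCanonicalState d) :
    Measure (EuclideanSpace ℝ (Fin d)) :=
  Measure.sum fun n => P.weight n • particleDensity (P.component n)

/-- The interaction energy `∑ λ_n C(P_n)` (the terms `n = 0, 1` vanish). -/
def GrandCanonicalState.energy {d : ℕ} (s : ℝ) (P : GrandCanonicalState d) : ℝ≥0∞ :=
  ∑' n, P.weight n * interactionEnergy s (P.component n)

/-- The grand-canonical indirect energy `E_GC(ρ)`. -/
def grandCanonicalEnergy {d : ℕ} (s : ℝ) (ρ : EuclideanSpace ℝ (Fin d) → ℝ≥0∞) : EReal :=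
  ((⨅ (P : GrandCanonicalState d) (_ : P.density = volume.withDensity ρ), P.energy s : ℝ≥0∞) :
      EReal)
    - (directEnergy s ρ : EReal)

/-- Fisher regularity: the set of points at distance at most `|Ω| ^ (1/d) * t` from the boundary of
`Ω` has volume at most `|Ω| * η t`, for all `0 ≤ t < t₀`. -/
def HasRegularBoundary {d : ℕ} (t₀ : ℝ) (η : ℝ → ℝ) (Ω : Set (EuclideanSpace ℝ (Fin d))) : Prop :=
  ∀ t ∈ Ico 0 t₀,
    volume (Metric.cthickening ((volume Ω).toReal ^ (1 / (d : ℝ)) * t) (frontier Ω))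
      ≤ volume Ω * ENNReal.ofReal (η t)

/-- `e` is the energy of the uniform electron gas in dimension `d` with interaction `|x| ^ (-s)`:
`E(ρ₀ 1_{Ω_N}) / |Ω_N|` converges to `ρ₀ ^ (1 + s / d) * e` for every `ρ₀ > 0` and every sequence
of bounded domains `Ω_N` of volume tending to infinity, with `ρ₀ |Ω_N|` an integer and with
uniformly regular boundaries. -/
def IsUEGEnergy (d : ℕ) (s e : ℝ) : Prop :=
  ∀ (ρ₀ : ℝ) (t₀ : ℝ) (η : ℝ → ℝ) (Ω : ℕ → Set (EuclideanSpace ℝ (Fin d))),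
    0 < ρ₀ → 0 < t₀ →
    ContinuousOn η (Ico 0 t₀) → η 0 = 0 → (∀ t ∈ Ico 0 t₀, 0 ≤ η t) →
    (∀ N, IsOpen (Ω N) ∧ IsConnected (Ω N) ∧ Bornology.IsBounded (Ω N)) →
    (∀ N, ∃ m : ℕ, ENNReal.ofReal ρ₀ * volume (Ω N) = m) →
    Tendsto (fun N => volume (Ω N)) atTop (𝓝 ∞) →
    (∀ N, HasRegularBoundary t₀ η (Ω N)) →
    Tendsto (fun N => canonicalEnergy s ((Ω N).indicator fun _ => ENNReal.ofReal ρ₀)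
        / (volume (Ω N) : EReal))
      atTop (𝓝 ((ρ₀ ^ (1 + s / d) * e : ℝ) : EReal))

/-- A (nondegenerate, bounded, open) convex polyhedron: the nonempty interior of the convex hull of
finitely many points. -/
def IsConvexPolyhedron {d : ℕ} (Ω : Set (EuclideanSpace ℝ (Fin d))) : Prop :=
  Ω.Nonempty ∧
    ∃ F : Set (EuclideanSpace ℝ (Fin d)), F.Finite ∧ Ω = interior (convexHull ℝ F)

/-- The open set `Ω` tiles `ℝ^d`: there is a set `Γ` of Euclidean isometries such that the sets
`g (closure Ω)`, `g ∈ Γ`, cover the space, while the `g Ω`, `g ∈ Γ`, are pairwise disjoint. (This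
includes the case where `Γ` is a discrete group of translations and rotations.) -/
def TilesSpace {d : ℕ} (Ω : Set (EuclideanSpace ℝ (Fin d))) : Prop :=
  ∃ Γ : Set (EuclideanSpace ℝ (Fin d) ≃ᵃⁱ[ℝ] EuclideanSpace ℝ (Fin d)),
    (⋃ g ∈ Γ, g '' closure Ω) = univ ∧ Γ.PairwiseDisjoint fun g => g '' Ω

end UEG

end

open MeasureTheory Filter Topology Set
open scoped ENNReal Pointwise

namespace UEG

variable {d : ℕ}

local notation "ℝ^" d => EuclideanSpace ℝ (Fin d)

/-! Call gain of a measure the excess of its direct energy D over the least interaction energy of a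
many-particle probability with that density. When two states are superposed independently, the new
interaction term is exactly the cross term of D, so the gain is superadditive on measures of integer
mass (`gain_add_le`). It is honestly nonnegative there, because independent particles never cost
more than D. A Lieb-Oxford type bound (`gain_le`), obtained by writing the interaction as a
superposition of positive definite Gaussians, shows that the gain is at most a constant times the
mass when the density is at most one. Hence the supremum `kappa` of the gain per volume over cubes
of integer side is finite.

Superadditivity then yields the thermodynamic limit: cubes packed inside a regular domain bound its
gain from below, and cubes packed into the rest of a large cube of comparable volume bound it from
above. With scaling this gives e_UEG = -κ (`isUEGEnergy_neg_kappa`). Uniqueness holds because balls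
form an admissible sequence (`IsUEGEnergy.unique`).

For the inequality, take a grand-canonical state of density 1 on the tile and M = k + 1 disjoint
copies of the tile inside a large cube Q of side L. Give the component P_n to ⌊M λ_n⌋ of the tiles
for n < K, leave the others empty, and distribute the components over the tiles by a uniformly
random permutation (`HasState.permute`). The total particle number no longer fluctuates, so this is
a canonical state, and different tiles interact as if independent up to a factor 1 + 1/k. Its
density is at most one on Q and has integer mass, so its gain is at most κ L^d. If ρ is the average
density of a tile, comparison gives M D(ρ) ≤ ∑ C + κ L^d + D(Q)/k, where ∑ C is the sum of the
energies of the components used (`mul_selfEnergy_le_of_tiles`). Since D(Q) = o(L^{2d}), dividing by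
M and letting L tend to infinity, then removing the truncation K, gives D(1_Ω) ≤ ∑ λ_n C(P_n) + κ
|Ω| (`GrandCanonicalState.selfEnergy_le_energy`). -/

/-- The mutual interaction energy `∫∫ |x - y| ^ (-s) dμ(x) dν(y)`. -/
noncomputable def mutualEnergy (s : ℝ) (μ ν : Measure (ℝ^ d)) : ℝ≥0∞ :=
  ∫⁻ x, ∫⁻ y, riesz s x y ∂ν ∂μ

/-- The direct energy of a measure. -/
noncomputable def selfEnergy (s : ℝ) (μ : Measure (ℝ^ d)) : ℝ≥0∞ := 2⁻¹ * mutualEnergy s μ μ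

/-- There is an `n`-particle probability of density `μ` and interaction energy at most `c`. -/
def HasState (s : ℝ) (n : ℕ) (μ : Measure (ℝ^ d)) (c : ℝ≥0∞) : Prop :=
  ∃ P : Measure (Fin n → ℝ^ d), IsProbabilityMeasure P ∧ particleDensity P = μ ∧
    interactionEnergy s P ≤ c

/-- The smallest interaction energy of a many-particle probability of density `μ`. -/
noncomputable def minEnergy (s : ℝ) (μ : Measure (ℝ^ d)) : ℝ≥0∞ :=
  ⨅ (N : ℕ) (P : Measure (Fin N → ℝ^ d)) (_ : IsProbabilityMeasure P)
      (_ : particleDensity P = μ), interactionEnergy s P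

/-- Minus the indirect energy of a measure. -/
noncomputable def gain (s : ℝ) (μ : Measure (ℝ^ d)) : ℝ≥0∞ := selfEnergy s μ - minEnergy s μ

/-! ### Elementary properties of the Riesz interaction -/

theorem measurable_riesz (s : ℝ) :
    Measurable fun p : (ℝ^ d) × (ℝ^ d) => riesz s p.1 p.2 := by
  unfold riesz
  fun_prop

theorem measurable_riesz_left (s : ℝ) (x : ℝ^ d) : Measurable (riesz s x) := by
  unfold riesz
  fun_prop

theorem riesz_comm (s : ℝ) (x y : ℝ^ d) : riesz s x y = riesz s y x := by
  unfold riesz; rw [edist_comm]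

theorem measurable_potential (s : ℝ) (ν : Measure (ℝ^ d)) [SFinite ν] :
    Measurable fun x => ∫⁻ y, riesz s x y ∂ν :=
  (measurable_riesz s).lintegral_prod_right'

/-! ### Bilinearity of the mutual energy -/

theorem mutualEnergy_comm (s : ℝ) (μ ν : Measure (ℝ^ d)) [SFinite μ] [SFinite ν] :
    mutualEnergy s μ ν = mutualEnergy s ν μ := by
  unfold mutualEnergy
  rw [lintegral_lintegral_swap (measurable_riesz s).aemeasurable]
  simp_rw [riesz_comm s]

theorem mutualEnergy_add_left (s : ℝ) (μ μ' ν : Measure (ℝ^ d)) :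
    mutualEnergy s (μ + μ') ν = mutualEnergy s μ ν + mutualEnergy s μ' ν :=
  lintegral_add_measure _ _ _

theorem mutualEnergy_add_right (s : ℝ) (μ ν ν' : Measure (ℝ^ d)) [SFinite ν] :
    mutualEnergy s μ (ν + ν') = mutualEnergy s μ ν + mutualEnergy s μ ν' := by
  unfold mutualEnergy
  simp_rw [lintegral_add_measure]
  exact lintegral_add_left (measurable_potential s ν) _

theorem mutualEnergy_smul_left (s : ℝ) (a : ℝ≥0∞) (μ ν : Measure (ℝ^ d)) :
    mutualEnergy s (a • μ) ν = a * mutualEnergy s μ ν :=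
  lintegral_smul_measure _ _

theorem mutualEnergy_smul_right (s : ℝ) (a : ℝ≥0∞) (μ ν : Measure (ℝ^ d)) [SFinite ν] :
    mutualEnergy s μ (a • ν) = a * mutualEnergy s μ ν := by
  unfold mutualEnergy
  simp_rw [lintegral_smul_measure, smul_eq_mul]
  exact lintegral_const_mul _ (measurable_potential s ν)

theorem mutualEnergy_zero_left (s : ℝ) (ν : Measure (ℝ^ d)) : mutualEnergy s 0 ν = 0 :=
  lintegral_zero_measure _

theorem mutualEnergy_zero_right (s : ℝ) (ν : Measure (ℝ^ d)) : mutualEnergy s ν 0 = 0 := by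
  simp [mutualEnergy]

theorem mutualEnergy_mono (s : ℝ) {μ μ' ν ν' : Measure (ℝ^ d)} (h : μ ≤ μ') (h' : ν ≤ ν') :
    mutualEnergy s μ ν ≤ mutualEnergy s μ' ν' :=
  lintegral_mono' h fun _ => lintegral_mono' h' le_rfl

theorem mutualEnergy_finset_sum_left {ι : Type*} (s : ℝ) (t : Finset ι)
    (μ : ι → Measure (ℝ^ d)) (ν : Measure (ℝ^ d)) :
    mutualEnergy s (∑ i ∈ t, μ i) ν = ∑ i ∈ t, mutualEnergy s (μ i) ν := by
  classical
  induction t using Finset.induction_on with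
  | empty => simp [mutualEnergy_zero_left]
  | insert a t ha ih => rw [Finset.sum_insert ha, Finset.sum_insert ha, mutualEnergy_add_left, ih]

theorem mutualEnergy_finset_sum_right {ι : Type*} (s : ℝ) (t : Finset ι)
    (μ : ι → Measure (ℝ^ d)) (ν : Measure (ℝ^ d)) (h : ∀ i, SFinite (μ i)) :
    mutualEnergy s ν (∑ i ∈ t, μ i) = ∑ i ∈ t, mutualEnergy s ν (μ i) := by
  classical
  induction t using Finset.induction_on with
  | empty => simp [mutualEnergy_zero_right]
  | insert a t ha ih =>
    rw [Finset.sum_insert ha, Finset.sum_insert ha, mutualEnergy_add_right, ih]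

theorem selfEnergy_add (s : ℝ) (μ ν : Measure (ℝ^ d)) [SFinite μ] [SFinite ν] :
    selfEnergy s (μ + ν) = selfEnergy s μ + selfEnergy s ν + mutualEnergy s μ ν := by
  unfold selfEnergy
  rw [mutualEnergy_add_left, mutualEnergy_add_right, mutualEnergy_add_right,
    mutualEnergy_comm s ν μ]
  have : (2⁻¹ : ℝ≥0∞) * 2 = 1 := ENNReal.inv_mul_cancel two_ne_zero ENNReal.ofNat_ne_top
  calc 2⁻¹ * (mutualEnergy s μ μ + mutualEnergy s μ ν + (mutualEnergy s μ ν + mutualEnergy s ν ν))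
      = 2⁻¹ * mutualEnergy s μ μ + 2⁻¹ * mutualEnergy s ν ν + 2⁻¹ * 2 * mutualEnergy s μ ν := by
        ring
    _ = _ := by rw [this, one_mul]

theorem selfEnergy_mono (s : ℝ) {μ ν : Measure (ℝ^ d)} (h : μ ≤ ν) :
    selfEnergy s μ ≤ selfEnergy s ν := by
  unfold selfEnergy
  gcongr
  exact mutualEnergy_mono s h h

theorem selfEnergy_smul (s : ℝ) (a : ℝ≥0∞) (μ : Measure (ℝ^ d)) [SFinite μ] :
    selfEnergy s (a • μ) = a ^ 2 * selfEnergy s μ := by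
  unfold selfEnergy
  rw [mutualEnergy_smul_left, mutualEnergy_smul_right]
  ring

/-! ### Transport of the energies -/

/-- The factor `a` serves two cases at once: it is 1 for isometries and c^(-s) for the dilation by
c. -/
theorem mutualEnergy_map {s : ℝ} {g : (ℝ^ d) → ℝ^ d} (hg : Measurable g) {a : ℝ≥0∞}
    (hr : ∀ x y, riesz s (g x) (g y) = a * riesz s x y) (μ ν : Measure (ℝ^ d))
    [SFinite ν] :
    mutualEnergy s (μ.map g) (ν.map g) = a * mutualEnergy s μ ν := by
  unfold mutualEnergy
  rw [lintegral_map (measurable_potential s _) hg]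
  simp_rw [lintegral_map (measurable_riesz_left s _) hg, hr]
  simp_rw [lintegral_const_mul _ (measurable_riesz_left s _)]
  exact lintegral_const_mul _ (measurable_potential s ν)

theorem selfEnergy_map {s : ℝ} {g : (ℝ^ d) → ℝ^ d} (hg : Measurable g) {a : ℝ≥0∞}
    (hr : ∀ x y, riesz s (g x) (g y) = a * riesz s x y) (μ : Measure (ℝ^ d)) [SFinite μ] :
    selfEnergy s (μ.map g) = a * selfEnergy s μ := by
  unfold selfEnergy
  rw [mutualEnergy_map hg hr]
  ring

theorem measurable_pairEnergy (s : ℝ) (n : ℕ) :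
    Measurable fun x : Fin n → ℝ^ d => ∑ j, ∑ k ∈ Finset.Ioi j, riesz s (x j) (x k) := by
  unfold riesz
  fun_prop

theorem particleDensity_univ {n : ℕ} (P : Measure (Fin n → ℝ^ d)) [IsProbabilityMeasure P] :
    particleDensity P univ = n := by
  simp [particleDensity, Measure.map_apply (measurable_pi_apply _) MeasurableSet.univ]

/-! ### Operations on many-particle states: transport, vacuum, products, mixtures. -/

namespace HasState

variable {s : ℝ} {n m : ℕ} {μ ν : Measure (ℝ^ d)} {c c' : ℝ≥0∞}

theorem measure_univ (h : HasState s n μ c) : μ univ = n := by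
  obtain ⟨P, hP, rfl, -⟩ := h
  exact particleDensity_univ P

theorem isFiniteMeasure (h : HasState s n μ c) : IsFiniteMeasure μ :=
  ⟨by rw [h.measure_univ]; exact ENNReal.natCast_lt_top n⟩

theorem mono (h : HasState s n μ c) (hc : c ≤ c') : HasState s n μ c' := by
  obtain ⟨P, hP, hd, hi⟩ := h
  exact ⟨P, hP, hd, hi.trans hc⟩

theorem map (h : HasState s n μ c) {g : (ℝ^ d) → ℝ^ d} (hg : Measurable g) {a : ℝ≥0∞}
    (hr : ∀ x y, riesz s (g x) (g y) = a * riesz s x y) : HasState s n (μ.map g) (a * c) := by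
  obtain ⟨P, hP, rfl, hi⟩ := h
  have hG : Measurable fun x : Fin n → ℝ^ d => fun i => g (x i) := by fun_prop
  refine ⟨P.map fun x i => g (x i), Measure.isProbabilityMeasure_map hG.aemeasurable, ?_, ?_⟩
  · unfold particleDensity
    ext A hA
    rw [Measure.map_apply hg hA]
    simp only [Measure.finsetSum_apply]
    refine Finset.sum_congr rfl fun i _ => ?_
    rw [Measure.map_apply (measurable_pi_apply i) hA, Measure.map_apply hG (measurable_pi_apply i hA),
      Measure.map_apply (measurable_pi_apply i) (hg hA)]
    rfl
  · unfold interactionEnergy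
    rw [lintegral_map (measurable_pairEnergy s n) hG]
    simp_rw [hr, ← Finset.mul_sum]
    rw [lintegral_const_mul _ (measurable_pairEnergy s n)]
    gcongr
    exact hi

/-- The vacuum, a point mass on the one-point space of empty configurations. Tiles left empty in the
final construction carry it. -/
theorem zero : HasState s 0 (0 : Measure (ℝ^ d)) 0 :=
  ⟨Measure.dirac default, inferInstance, by simp [particleDensity], by simp [interactionEnergy]⟩

theorem one [IsProbabilityMeasure μ] : HasState s 1 μ 0 := by
  have hG : Measurable fun (x : ℝ^ d) (_ : Fin 1) => x := by fun_prop
  refine ⟨μ.map fun x _ => x, Measure.isProbabilityMeasure_map hG.aemeasurable, ?_, ?_⟩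
  · simp only [particleDensity, Fin.sum_univ_one]
    rw [Measure.map_map (measurable_pi_apply _) hG]
    exact Measure.map_id
  · simp [interactionEnergy]

end HasState

theorem pairEnergy_append (s : ℝ) {n m : ℕ} (x : Fin n → ℝ^ d) (y : Fin m → ℝ^ d) :
    ∑ j, ∑ k ∈ Finset.Ioi j, riesz s (Fin.append x y j) (Fin.append x y k)
      = (∑ j, ∑ k ∈ Finset.Ioi j, riesz s (x j) (x k))
        + (∑ j, ∑ k ∈ Finset.Ioi j, riesz s (y j) (y k)) + ∑ j, ∑ k, riesz s (x j) (y k) := by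
  have key : ∀ {k : ℕ} (f : Fin k → Fin k → ℝ≥0∞),
      ∑ i, ∑ j ∈ Finset.Ioi i, f i j = ∑ i, ∑ j, if i < j then f i j else 0 := by
    intro k f
    refine Finset.sum_congr rfl fun i _ => ?_
    rw [← Finset.sum_filter]
    congr 1
    ext j; simp
  rw [key, key, key]
  simp only [Fin.sum_univ_add, Fin.append_left, Fin.append_right]
  have h1 : ∀ (i j : Fin n), (Fin.castAdd m i < Fin.castAdd m j) ↔ i < j := fun i j => Iff.rfl
  have h2 : ∀ (i j : Fin m), (Fin.natAdd n i < Fin.natAdd n j) ↔ i < j := fun i j => by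
    simp only [Fin.lt_def, Fin.val_natAdd]; omega
  have h3 : ∀ (i : Fin n) (j : Fin m), (Fin.castAdd m i < Fin.natAdd n j) := fun i j => by
    simp only [Fin.lt_def, Fin.val_castAdd, Fin.val_natAdd]; omega
  have h4 : ∀ (i : Fin n) (j : Fin m), ¬ (Fin.natAdd n j < Fin.castAdd m i) := fun i j => by
    simp only [Fin.lt_def, Fin.val_castAdd, Fin.val_natAdd]; omega
  simp only [h1, h2, h3, h4, if_true, if_false, Finset.sum_add_distrib, Finset.sum_const_zero,
    zero_add]
  ring

/-- Under the product measure, a particle of the first group and one of the second are independent,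
so their expected interaction only sees the two marginals. Summed over pairs it is the mutual energy
of the densities. -/
theorem HasState.prod {s : ℝ} {n m : ℕ} {μ ν : Measure (ℝ^ d)} {c c' : ℝ≥0∞}
    (h : HasState s n μ c) (h' : HasState s m ν c') :
    HasState s (n + m) (μ + ν) (c + c' + mutualEnergy s μ ν) := by
  obtain ⟨P, hP, rfl, hi⟩ := h
  obtain ⟨Q, hQ, rfl, hj⟩ := h'
  have hG : Measurable fun p : (Fin n → ℝ^ d) × (Fin m → ℝ^ d) => Fin.append p.1 p.2 := by
    refine measurable_pi_lambda _ fun i => ?_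
    refine Fin.addCases (fun i => ?_) (fun i => ?_) i
    · simp only [Fin.append_left]; fun_prop
    · simp only [Fin.append_right]; fun_prop
  refine ⟨(P.prod Q).map fun p => Fin.append p.1 p.2,
    Measure.isProbabilityMeasure_map hG.aemeasurable, ?_, ?_⟩
  · unfold particleDensity
    rw [Fin.sum_univ_add]
    congr 1 <;> refine Finset.sum_congr rfl fun i _ => ?_
    · rw [Measure.map_map (measurable_pi_apply _) hG]
      have : ((fun x : Fin (n + m) → ℝ^ d => x (Fin.castAdd m i)) ∘
          fun p : (Fin n → ℝ^ d) × (Fin m → ℝ^ d) => Fin.append p.1 p.2)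
          = (fun x : Fin n → ℝ^ d => x i) ∘ Prod.fst := by
        ext p; simp
      rw [this, ← Measure.map_map (measurable_pi_apply _) measurable_fst, Measure.map_fst_prod]
      simp
    · rw [Measure.map_map (measurable_pi_apply _) hG]
      have : ((fun x : Fin (n + m) → ℝ^ d => x (Fin.natAdd n i)) ∘
          fun p : (Fin n → ℝ^ d) × (Fin m → ℝ^ d) => Fin.append p.1 p.2)
          = (fun x : Fin m → ℝ^ d => x i) ∘ Prod.snd := by
        ext p; simp
      rw [this, ← Measure.map_map (measurable_pi_apply _) measurable_snd, Measure.map_snd_prod]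
      simp
  · unfold interactionEnergy
    rw [lintegral_map (measurable_pairEnergy s _) hG]
    simp_rw [pairEnergy_append]
    have hm1 : Measurable fun p : (Fin n → ℝ^ d) × (Fin m → ℝ^ d) =>
        ∑ j, ∑ k ∈ Finset.Ioi j, riesz s (p.1 j) (p.1 k) := by unfold riesz; fun_prop
    have hm2 : Measurable fun p : (Fin n → ℝ^ d) × (Fin m → ℝ^ d) =>
        ∑ j, ∑ k ∈ Finset.Ioi j, riesz s (p.2 j) (p.2 k) := by unfold riesz; fun_prop
    have hm3 : Measurable fun p : (Fin n → ℝ^ d) × (Fin m → ℝ^ d) =>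
        (∑ j, ∑ k ∈ Finset.Ioi j, riesz s (p.1 j) (p.1 k))
          + ∑ j, ∑ k ∈ Finset.Ioi j, riesz s (p.2 j) (p.2 k) := hm1.add hm2
    rw [lintegral_add_left hm3, lintegral_add_left hm1,
      lintegral_prod _ hm1.aemeasurable, lintegral_prod _ hm2.aemeasurable]
    simp only [lintegral_const, MeasureTheory.measure_univ, mul_one]
    refine add_le_add (add_le_add hi hj) (le_of_eq ?_)
    have hij : ∀ (i : Fin n) (j : Fin m),
        Measurable fun p : (Fin n → ℝ^ d) × (Fin m → ℝ^ d) => riesz s (p.1 i) (p.2 j) := by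
      intro i j; unfold riesz; fun_prop
    rw [lintegral_finsetSum _ fun i _ => Finset.measurable_sum _ fun j _ => hij i j]
    simp_rw [lintegral_finsetSum _ fun j _ => hij _ j]
    unfold particleDensity
    rw [mutualEnergy_finset_sum_left]
    refine Finset.sum_congr rfl fun i _ => ?_
    rw [mutualEnergy_finset_sum_right s _ _ _ (fun j => inferInstance)]
    refine Finset.sum_congr rfl fun j _ => ?_
    unfold mutualEnergy
    rw [lintegral_map (measurable_potential s _) (measurable_pi_apply i),
      lintegral_prod _ (hij i j).aemeasurable]
    refine lintegral_congr fun x => (lintegral_map (measurable_riesz_left s _) ?_).symm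
    exact measurable_pi_apply j

/-- Convex combinations of states. -/
theorem HasState.mix {ι : Type*} {s : ℝ} {n : ℕ} (t : Finset ι) {μ : ι → Measure (ℝ^ d)}
    {c w : ι → ℝ≥0∞} (hw : ∑ i ∈ t, w i = 1) (h : ∀ i ∈ t, HasState s n (μ i) (c i)) :
    HasState s n (∑ i ∈ t, w i • μ i) (∑ i ∈ t, w i * c i) := by
  classical
  -- Outside `t` the zero measure is a dummy value, so that `choose` applies to all indices.
  have h' : ∀ i, ∃ P : Measure (Fin n → ℝ^ d), i ∈ t → IsProbabilityMeasure P ∧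
      particleDensity P = μ i ∧ interactionEnergy s P ≤ c i := by
    intro i
    by_cases hi : i ∈ t
    · obtain ⟨P, hP⟩ := h i hi
      exact ⟨P, fun _ => hP⟩
    · exact ⟨0, fun H => absurd H hi⟩
  choose P hP using h'
  refine ⟨∑ i ∈ t, w i • P i, ⟨?_⟩, ?_, ?_⟩
  · rw [Measure.finsetSum_apply, ← hw]
    refine Finset.sum_congr rfl fun i hi => ?_
    have := (hP i hi).1
    simp
  · trans ∑ i ∈ t, w i • particleDensity (P i)
    · ext A hA
      have hmap : ∀ (i : Fin n) (Q : Measure (Fin n → ℝ^ d)),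
          Q.map (fun x => x i) A = Q ((fun x => x i) ⁻¹' A) :=
        fun i Q => Measure.map_apply (measurable_pi_apply i) hA
      unfold particleDensity
      simp only [Measure.finsetSum_apply, hmap, Measure.smul_apply, smul_eq_mul, Finset.mul_sum]
      rw [Finset.sum_comm]
    · exact Finset.sum_congr rfl fun i hi => by rw [(hP i hi).2.1]
  · unfold interactionEnergy
    rw [lintegral_finsetSum_measure]
    refine Finset.sum_le_sum fun i hi => ?_
    rw [lintegral_smul_measure, smul_eq_mul]
    gcongr
    exact (hP i hi).2.2

/-! ### Minimal energy and gain -/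

theorem HasState.minEnergy_le {s : ℝ} {n : ℕ} {μ : Measure (ℝ^ d)} {c : ℝ≥0∞}
    (h : HasState s n μ c) : minEnergy s μ ≤ c := by
  obtain ⟨P, hP, hd, hi⟩ := h
  exact (iInf_le_of_le n (iInf_le_of_le P (iInf_le_of_le hP (iInf_le _ hd)))).trans hi

theorem exists_hasState {s : ℝ} {μ : Measure (ℝ^ d)} {c : ℝ≥0∞} (h : minEnergy s μ < c) :
    ∃ n, HasState s n μ c := by
  unfold minEnergy at h
  simp only [iInf_lt_iff] at h
  obtain ⟨n, P, hP, hd, hi⟩ := h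
  exact ⟨n, P, hP, hd, hi.le⟩

/-- Take the independent product of two near-minimisers. -/
theorem minEnergy_add_le (s : ℝ) (μ ν : Measure (ℝ^ d)) :
    minEnergy s (μ + ν) ≤ minEnergy s μ + minEnergy s ν + mutualEnergy s μ ν := by
  rcases eq_or_ne (minEnergy s μ) ⊤ with h1 | h1
  · simp [h1]
  rcases eq_or_ne (minEnergy s ν) ⊤ with h2 | h2
  · simp [h2]
  refine ENNReal.le_of_forall_pos_le_add fun ε hε _ => ?_
  have hε' : ((ε / 2 : NNReal) : ℝ≥0∞) ≠ 0 := by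
    rw [ENNReal.coe_ne_zero]; exact (half_pos hε).ne'
  obtain ⟨n, hn⟩ := exists_hasState (ENNReal.lt_add_right h1 hε')
  obtain ⟨m, hm⟩ := exists_hasState (ENNReal.lt_add_right h2 hε')
  refine (hn.prod hm).minEnergy_le.trans (le_of_eq ?_)
  have : (ε : ℝ≥0∞) = ((ε / 2 : NNReal) : ℝ≥0∞) + ((ε / 2 : NNReal) : ℝ≥0∞) := by
    rw [← ENNReal.coe_add, add_halves]
  rw [this]
  ring

theorem minEnergy_map_le {s : ℝ} {g : (ℝ^ d) → ℝ^ d} (hg : Measurable g) {a : ℝ≥0∞}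
    (ha : a ≠ 0) (ha' : a ≠ ⊤)
    (hr : ∀ x y, riesz s (g x) (g y) = a * riesz s x y) (μ : Measure (ℝ^ d)) :
    minEnergy s (μ.map g) ≤ a * minEnergy s μ := by
  by_contra! h
  have h' : minEnergy s μ < minEnergy s (μ.map g) / a := by
    rw [ENNReal.lt_div_iff_mul_lt (Or.inl ha) (Or.inl ha'), mul_comm]
    exact h
  obtain ⟨c, hc, hc'⟩ := exists_between h'
  obtain ⟨n, hn⟩ := exists_hasState hc
  rw [ENNReal.lt_div_iff_mul_lt (Or.inl ha) (Or.inl ha'), mul_comm] at hc'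
  exact absurd (hn.map hg hr).minEnergy_le (not_le.mpr hc')

/-- Independent particles with common law `ν`. The exact energy has k(k-1)/2 pairs; k²/2 is kept
because it matches the direct energy. -/
theorem HasState.natCast_smul {s : ℝ} {ν : Measure (ℝ^ d)} [IsProbabilityMeasure ν] (k : ℕ) :
    HasState s k ((k : ℝ≥0∞) • ν) (2⁻¹ * ((k : ℝ≥0∞) ^ 2 * mutualEnergy s ν ν)) := by
  induction k with
  | zero => simpa using HasState.zero (d := d) (s := s)
  | succ k ih =>
    have h := ih.prod (HasState.one (s := s) (μ := ν))
    rw [show ((k + 1 : ℕ) : ℝ≥0∞) • ν = (k : ℝ≥0∞) • ν + ν by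
      rw [Nat.cast_succ, add_smul, one_smul]]
    refine h.mono ?_
    rw [mutualEnergy_smul_left, Nat.cast_succ]
    have : (2⁻¹ : ℝ≥0∞) * 2 = 1 := ENNReal.inv_mul_cancel two_ne_zero ENNReal.ofNat_ne_top
    calc 2⁻¹ * ((k : ℝ≥0∞) ^ 2 * mutualEnergy s ν ν) + 0 + k * mutualEnergy s ν ν
        = 2⁻¹ * ((k : ℝ≥0∞) ^ 2 * mutualEnergy s ν ν) + 2⁻¹ * 2 * (k * mutualEnergy s ν ν) := by
          rw [this]; ring
      -- The added half self-term completes the square (k + 1)².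
      _ ≤ 2⁻¹ * ((k : ℝ≥0∞) ^ 2 * mutualEnergy s ν ν) + 2⁻¹ * 2 * (k * mutualEnergy s ν ν)
          + 2⁻¹ * mutualEnergy s ν ν := le_self_add
      _ = _ := by ring

/-- Independent particles of law μ/k have energy at most D(μ). Thus for integer mass and finite D
the truncated subtraction defining `gain` loses nothing. -/
theorem minEnergy_le_selfEnergy (s : ℝ) {μ : Measure (ℝ^ d)} {k : ℕ} (hk : μ univ = k) :
    minEnergy s μ ≤ selfEnergy s μ := by
  rcases Nat.eq_zero_or_pos k with rfl | hk0
  · have : μ = 0 := by simpa using hk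
    subst this
    exact HasState.zero.minEnergy_le.trans zero_le
  have hk1 : (k : ℝ≥0∞) ≠ 0 := by exact_mod_cast hk0.ne'
  have hk2 : (k : ℝ≥0∞) ≠ ⊤ := ENNReal.natCast_ne_top k
  have hfin : IsFiniteMeasure μ := ⟨by rw [hk]; exact hk2.lt_top⟩
  have hP : IsProbabilityMeasure ((k : ℝ≥0∞)⁻¹ • μ) :=
    ⟨by simp [hk, ENNReal.inv_mul_cancel hk1 hk2]⟩
  have h := HasState.natCast_smul (s := s) (ν := (k : ℝ≥0∞)⁻¹ • μ) k
  have e : (k : ℝ≥0∞) • (k : ℝ≥0∞)⁻¹ • μ = μ := by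
    rw [smul_smul, ENNReal.mul_inv_cancel hk1 hk2, one_smul]
  rw [e] at h
  refine h.minEnergy_le.trans (le_of_eq ?_)
  unfold selfEnergy
  rw [mutualEnergy_smul_left, mutualEnergy_smul_right, ← mul_assoc, ← mul_assoc, ← mul_assoc]
  congr 1
  rw [sq, mul_assoc, mul_assoc, mul_assoc, ← mul_assoc (k : ℝ≥0∞) ((k : ℝ≥0∞)⁻¹),
    ENNReal.mul_inv_cancel hk1 hk2, one_mul, ENNReal.mul_inv_cancel hk1 hk2, mul_one]

/-- The gain is superadditive on measures of integer mass. -/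
theorem gain_add_le {s : ℝ} {μ ν : Measure (ℝ^ d)} {k m : ℕ} (hk : μ univ = k) (hm : ν univ = m)
    (hD : selfEnergy s (μ + ν) ≠ ⊤) : gain s μ + gain s ν ≤ gain s (μ + ν) := by
  have h1 : IsFiniteMeasure μ := ⟨by rw [hk]; exact ENNReal.natCast_lt_top k⟩
  have h2 : IsFiniteMeasure ν := ⟨by rw [hm]; exact ENNReal.natCast_lt_top m⟩
  have hkm : (μ + ν) univ = ((k + m : ℕ) : ℝ≥0∞) := by simp [hk, hm]
  have hF : minEnergy s (μ + ν) ≠ ⊤ :=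
    ((minEnergy_le_selfEnergy s hkm).trans_lt hD.lt_top).ne
  unfold gain
  refine ENNReal.le_sub_of_add_le_right hF ?_
  -- The mutual energy paid by the product state is the one that appears in D(μ + ν), so the two
  -- cancel.
  calc (selfEnergy s μ - minEnergy s μ) + (selfEnergy s ν - minEnergy s ν) + minEnergy s (μ + ν)
      ≤ (selfEnergy s μ - minEnergy s μ) + (selfEnergy s ν - minEnergy s ν)
        + (minEnergy s μ + minEnergy s ν + mutualEnergy s μ ν) := by
        gcongr; exact minEnergy_add_le s μ ν
    _ = (selfEnergy s μ - minEnergy s μ + minEnergy s μ)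
        + (selfEnergy s ν - minEnergy s ν + minEnergy s ν) + mutualEnergy s μ ν := by ring
    _ = _ := by
      rw [tsub_add_cancel_of_le (minEnergy_le_selfEnergy s hk),
        tsub_add_cancel_of_le (minEnergy_le_selfEnergy s hm), selfEnergy_add]

theorem mul_gain_le_gain_map {s : ℝ} {g : (ℝ^ d) → ℝ^ d} (hg : Measurable g) {a : ℝ≥0∞}
    (ha : a ≠ 0) (ha' : a ≠ ⊤)
    (hr : ∀ x y, riesz s (g x) (g y) = a * riesz s x y) (μ : Measure (ℝ^ d)) [SFinite μ] :
    a * gain s μ ≤ gain s (μ.map g) := by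
  unfold gain
  rw [selfEnergy_map hg hr, ENNReal.mul_sub (fun _ _ => ha')]
  exact tsub_le_tsub_left (minEnergy_map_le hg ha ha' hr μ) _

theorem gain_map {s : ℝ} (g : (ℝ^ d) ≃ᵐ (ℝ^ d)) {a : ℝ≥0∞} (ha : a ≠ 0) (ha' : a ≠ ⊤)
    (hr : ∀ x y, riesz s (g x) (g y) = a * riesz s x y) (μ : Measure (ℝ^ d)) [SFinite μ] :
    gain s (μ.map g) = a * gain s μ := by
  refine le_antisymm ?_ (mul_gain_le_gain_map g.measurable ha ha' hr μ)
  -- The reverse inequality is the same lemma for the inverse map, which scales the interaction by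
  -- `a⁻¹`.
  have hr' : ∀ x y, riesz s (g.symm x) (g.symm y) = a⁻¹ * riesz s x y := by
    intro x y
    conv_rhs => rw [← g.apply_symm_apply x, ← g.apply_symm_apply y, hr, ← mul_assoc,
      ENNReal.inv_mul_cancel ha ha', one_mul]
  have h := mul_gain_le_gain_map g.symm.measurable (ENNReal.inv_ne_zero.mpr ha')
    (ENNReal.inv_ne_top.mpr ha) hr' (μ.map g)
  rw [Measure.map_map g.symm.measurable g.measurable, g.symm_comp_self, Measure.map_id] at h
  calc gain s (μ.map g) = a * (a⁻¹ * gain s (μ.map g)) := by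
        rw [← mul_assoc, ENNReal.mul_inv_cancel ha ha', one_mul]
    _ ≤ _ := by gcongr

theorem riesz_isometry (s : ℝ) {g : (ℝ^ d) → ℝ^ d} (hg : Isometry g) (x y : ℝ^ d) :
    riesz s (g x) (g y) = 1 * riesz s x y := by
  rw [one_mul]; unfold riesz; rw [hg.edist_eq]

/-! ### Averages over permutations -/

section Perm

variable {T A : Type*} [Fintype T] [DecidableEq T] [AddCommMonoid A]

/-- The image of a fixed point under a uniform permutation is uniform: composing with a
transposition shows that the sum does not depend on the point. The identity is multiplied out
because `A` has no division. -/
theorem card_nsmul_sum_perm (h : T → A) (t : T) :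
    Fintype.card T • ∑ σ : Equiv.Perm T, h (σ t) = (Fintype.card T).factorial • ∑ u, h u := by
  have key : ∀ t', ∑ σ : Equiv.Perm T, h (σ t') = ∑ σ : Equiv.Perm T, h (σ t) := fun t' =>
    Fintype.sum_equiv (Equiv.mulRight (Equiv.swap t t')) _ _ fun σ => by simp
  calc Fintype.card T • ∑ σ : Equiv.Perm T, h (σ t)
      = ∑ t', ∑ σ : Equiv.Perm T, h (σ t') := by simp [key]
    _ = ∑ σ : Equiv.Perm T, ∑ t', h (σ t') := Finset.sum_comm
    _ = ∑ σ : Equiv.Perm T, ∑ u, h u :=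
        Finset.sum_congr rfl fun σ _ => Equiv.sum_comp σ h
    _ = _ := by simp [Fintype.card_perm]

theorem card_nsmul_sum_perm_pair (H : T → T → A) {t t' : T} (htt : t ≠ t') :
    (Fintype.card T * (Fintype.card T - 1)) • ∑ σ : Equiv.Perm T, H (σ t) (σ t')
      = (Fintype.card T).factorial • ∑ p ∈ (Finset.univ : Finset T).offDiag, H p.1 p.2 := by
  have key : ∀ p ∈ (Finset.univ : Finset T).offDiag,
      ∑ σ : Equiv.Perm T, H (σ p.1) (σ p.2) = ∑ σ : Equiv.Perm T, H (σ t) (σ t') := by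
    rintro ⟨u, u'⟩ hp
    have hu : u ≠ u' := by simpa using hp
    have hne : Equiv.swap t u t' ≠ u := by
      intro h
      apply htt
      have := congrArg (Equiv.swap t u) h
      simpa using this.symm
    -- Double transitivity: the inner swap sends t to u; the outer one then moves the image of t' to
    -- u' and fixes u.
    refine Fintype.sum_equiv
      (Equiv.mulRight (Equiv.swap (Equiv.swap t u t') u' * Equiv.swap t u)) _ _ fun σ => ?_
    simp [Equiv.swap_apply_of_ne_of_ne hne.symm hu]
  calc (Fintype.card T * (Fintype.card T - 1)) • ∑ σ : Equiv.Perm T, H (σ t) (σ t')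
      = ∑ p ∈ (Finset.univ : Finset T).offDiag, ∑ σ : Equiv.Perm T, H (σ p.1) (σ p.2) := by
        rw [Finset.sum_congr rfl key, Finset.sum_const, Finset.offDiag_card, Finset.card_univ,
          Nat.mul_sub_one]
    _ = ∑ σ : Equiv.Perm T, ∑ p ∈ (Finset.univ : Finset T).offDiag, H (σ p.1) (σ p.2) :=
        Finset.sum_comm
    _ = ∑ σ : Equiv.Perm T, ∑ p ∈ (Finset.univ : Finset T).offDiag, H p.1 p.2 := by
        refine Finset.sum_congr rfl fun σ _ => ?_
        refine Finset.sum_equiv (σ.prodCongr σ) (fun p => ?_) fun p _ => rfl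
        simp
    _ = _ := by simp [Fintype.card_perm]

end Perm

/-! ### Many independent components -/

/-- Independent products of finitely many states. -/
theorem HasState.finset_prod {T : Type*} [DecidableEq T] {s : ℝ} {n : T → ℕ}
    {μ : T → Measure (ℝ^ d)} {c : T → ℝ≥0∞} (S : Finset T)
    (h : ∀ t, HasState s (n t) (μ t) (c t)) :
    HasState s (∑ t ∈ S, n t) (∑ t ∈ S, μ t) (∑ t ∈ S, c t + 2⁻¹ *
      ∑ t ∈ S, ∑ t' ∈ S, if t = t' then 0 else mutualEnergy s (μ t) (μ t')) := by
  have hfin : ∀ t, IsFiniteMeasure (μ t) := fun t => (h t).isFiniteMeasure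
  induction S using Finset.induction_on with
  | empty => simpa using HasState.zero (d := d) (s := s)
  | insert a S ha ih =>
    simp only [Finset.sum_insert ha]
    refine ((h a).prod ih).mono (le_of_eq ?_)
    rw [mutualEnergy_finset_sum_right s S μ (μ a) fun i => inferInstance]
    have e1 : ∑ t' ∈ S, (if a = t' then 0 else mutualEnergy s (μ a) (μ t'))
        = ∑ t' ∈ S, mutualEnergy s (μ a) (μ t') :=
      Finset.sum_congr rfl fun t ht => if_neg (by rintro rfl; exact ha ht)
    have e2 : ∑ t ∈ S, (if t = a then 0 else mutualEnergy s (μ t) (μ a))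
        = ∑ t' ∈ S, mutualEnergy s (μ a) (μ t') :=
      Finset.sum_congr rfl fun t ht => by
        rw [if_neg (by rintro rfl; exact ha ht), mutualEnergy_comm]
    rw [Finset.sum_add_distrib, e1, e2, if_pos trivial, zero_add]
    have : (2⁻¹ : ℝ≥0∞) * 2 = 1 := ENNReal.inv_mul_cancel two_ne_zero ENNReal.ofNat_ne_top
    generalize (∑ t' ∈ S, mutualEnergy s (μ a) (μ t')) = X
    generalize (∑ t ∈ S, ∑ t' ∈ S, if t = t' then 0 else mutualEnergy s (μ t) (μ t')) = Y
    calc c a + (∑ t ∈ S, c t + 2⁻¹ * Y) + X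
        = c a + (∑ t ∈ S, c t + 2⁻¹ * Y) + 2⁻¹ * 2 * X := by rw [this, one_mul]
      _ = _ := by ring

/-- The direct energy of a finite sum. -/
theorem selfEnergy_finset_sum {T : Type*} [DecidableEq T] (s : ℝ) (S : Finset T)
    (μ : T → Measure (ℝ^ d)) (h : ∀ t, SFinite (μ t)) :
    selfEnergy s (∑ t ∈ S, μ t) = (∑ t ∈ S, selfEnergy s (μ t)) + 2⁻¹ *
      ∑ t ∈ S, ∑ t' ∈ S, if t = t' then 0 else mutualEnergy s (μ t) (μ t') := by
  unfold selfEnergy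
  rw [mutualEnergy_finset_sum_left]
  simp_rw [mutualEnergy_finset_sum_right s S μ _ h]
  rw [← Finset.mul_sum, ← mul_add, ← Finset.sum_add_distrib]
  congr 1
  refine Finset.sum_congr rfl fun t ht => ?_
  rw [← Finset.add_sum_erase S _ ht, ← Finset.add_sum_erase S (fun t' => ite _ _ _) ht, if_pos rfl,
    zero_add]
  congr 1
  refine Finset.sum_congr rfl fun t' ht' => ?_
  rw [if_neg (Finset.ne_of_mem_erase ht').symm]

/-- The states `μ u`, with `u ∈ T`, are distributed over the sites `t ∈ T` by a uniformly random
permutation, the state at the site `t` being moved by the isometry `g t`. This makes the sites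
essentially independent, although the total number of particles does not fluctuate. -/
theorem HasState.permute {T : Type*} [Fintype T] [DecidableEq T] {s : ℝ} {k : ℕ} (hk : k ≠ 0)
    (hT : Fintype.card T = k + 1) {n : T → ℕ} {μ : T → Measure (ℝ^ d)} {c : T → ℝ≥0∞}
    (h : ∀ t, HasState s (n t) (μ t) (c t)) {g : T → (ℝ^ d) → ℝ^ d} (hg : ∀ t, Isometry (g t))
    {σ : T → Measure (ℝ^ d)}
    (hσ : ∀ t, σ t = ((((k + 1 : ℕ) : ℝ≥0∞))⁻¹ • ∑ u, μ u).map (g t)) :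
    HasState s (∑ t, n t) (∑ t, σ t) (∑ t, c t + (1 + (k : ℝ≥0∞)⁻¹) * (2⁻¹ *
      ∑ t, ∑ t', if t = t' then 0 else mutualEnergy s (σ t) (σ t'))) := by
  have hfin : ∀ t, IsFiniteMeasure (μ t) := fun t => (h t).isFiniteMeasure
  have hgm : ∀ t, Measurable (g t) := fun t => (hg t).continuous.measurable
  have hM0 : ((k + 1 : ℕ) : ℝ≥0∞) ≠ 0 := by exact_mod_cast k.succ_ne_zero
  have hM1 : ((k + 1 : ℕ) : ℝ≥0∞) ≠ ⊤ := ENNReal.natCast_ne_top _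
  have hk0 : (k : ℝ≥0∞) ≠ 0 := by exact_mod_cast hk
  have hk1 : (k : ℝ≥0∞) ≠ ⊤ := ENNReal.natCast_ne_top _
  have hf0 : ((k + 1).factorial : ℝ≥0∞) ≠ 0 := by exact_mod_cast (k + 1).factorial_ne_zero
  have hf1 : ((k + 1).factorial : ℝ≥0∞) ≠ ⊤ := ENNReal.natCast_ne_top _
  set w : ℝ≥0∞ := ((k + 1).factorial : ℝ≥0∞)⁻¹ with hw
  have hwsum : ∑ _π : Equiv.Perm T, w = 1 := by
    rw [Finset.sum_const, Finset.card_univ, Fintype.card_perm, hT, nsmul_eq_mul,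
      ENNReal.mul_inv_cancel hf0 hf1]
  -- For a fixed permutation the sites are independent; the states obtained are then averaged with
  -- weight 1/M!.
  have hpi : ∀ π : Equiv.Perm T, HasState s (∑ t, n t) (∑ t, (μ (π t)).map (g t))
      (∑ t, c t + 2⁻¹ * ∑ t, ∑ t', if t = t' then 0 else
        mutualEnergy s ((μ (π t)).map (g t)) ((μ (π t')).map (g t'))) := by
    intro π
    have := HasState.finset_prod (n := fun t => n (π t)) (μ := fun t => (μ (π t)).map (g t))
      (c := fun t => 1 * c (π t)) Finset.univ
      fun t => (h (π t)).map (hgm t) (riesz_isometry s (hg t))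
    simp only [one_mul] at this
    rwa [Equiv.sum_comp π n, Equiv.sum_comp π c] at this
  have hmix := HasState.mix Finset.univ hwsum fun π _ => hpi π
  have hdens : ∑ π : Equiv.Perm T, w • ∑ t, (μ (π t)).map (g t) = ∑ t, σ t := by
    ext A hA
    simp only [Measure.finsetSum_apply, Measure.smul_apply, smul_eq_mul]
    rw [← Finset.mul_sum, Finset.sum_comm, Finset.mul_sum]
    refine Finset.sum_congr rfl fun t _ => ?_
    rw [hσ, Measure.map_apply (hgm t) hA]
    simp only [Measure.map_apply (hgm t) hA, Measure.smul_apply, smul_eq_mul,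
      Measure.finsetSum_apply]
    have e := card_nsmul_sum_perm (fun u => μ u (g t ⁻¹' A)) t
    rw [hT, nsmul_eq_mul, nsmul_eq_mul] at e
    generalize (∑ π : Equiv.Perm T, μ (π t) (g t ⁻¹' A)) = X at e ⊢
    generalize (∑ u, μ u (g t ⁻¹' A)) = Y at e ⊢
    have hX : X = ((k + 1 : ℕ) : ℝ≥0∞)⁻¹ * ((k + 1).factorial * Y) := by
      rw [← e, ← mul_assoc, ENNReal.inv_mul_cancel hM0 hM1, one_mul]
    calc w * X = w * (k + 1).factorial * (((k + 1 : ℕ) : ℝ≥0∞)⁻¹ * Y) := by rw [hX]; ring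
      _ = _ := by rw [hw, ENNReal.inv_mul_cancel hf0 hf1, one_mul]
  rw [hdens] at hmix
  refine hmix.mono ?_
  simp_rw [mul_add]
  rw [Finset.sum_add_distrib]
  gcongr ?_ + ?_
  · rw [← Finset.sum_mul, hwsum, one_mul]
  · simp_rw [mul_left_comm _ (2⁻¹ : ℝ≥0∞)]
    rw [← Finset.mul_sum]
    gcongr 2⁻¹ * ?_
    simp_rw [Finset.mul_sum]
    rw [Finset.sum_comm]
    refine Finset.sum_le_sum fun t _ => ?_
    rw [Finset.sum_comm]
    refine Finset.sum_le_sum fun t' _ => ?_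
    by_cases htt : t = t'
    · simp [htt]
    simp only [if_neg htt]
    rw [← Finset.mul_sum]
    have e := card_nsmul_sum_perm_pair
      (fun u u' => mutualEnergy s ((μ u).map (g t)) ((μ u').map (g t'))) htt
    have hS : ∀ t, ((k + 1 : ℕ) : ℝ≥0∞) • σ t = ∑ u, (μ u).map (g t) := by
      intro t
      ext A hA
      rw [hσ, Measure.smul_apply, Measure.map_apply (hgm t) hA]
      simp only [Measure.map_apply (hgm t) hA, Measure.smul_apply, smul_eq_mul,
        Measure.finsetSum_apply]
      rw [← mul_assoc, ENNReal.mul_inv_cancel hM0 hM1, one_mul]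
    have hσf : SFinite (σ t') := by rw [hσ]; infer_instance
    -- Two distinct sites receive a uniformly random ordered pair of distinct states. Adding the
    -- nonnegative diagonal pairs makes the sum bilinear, and replacing 1/(M(M-1)) by 1/M² costs the
    -- factor M/(M-1) = 1 + 1/k.
    have hle : ∑ p ∈ (Finset.univ : Finset T).offDiag,
        mutualEnergy s ((μ p.1).map (g t)) ((μ p.2).map (g t'))
        ≤ ((k + 1 : ℕ) : ℝ≥0∞) * (((k + 1 : ℕ) : ℝ≥0∞) * mutualEnergy s (σ t) (σ t')) := by
      rw [← mutualEnergy_smul_right, ← mutualEnergy_smul_left, hS, hS,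
        mutualEnergy_finset_sum_left]
      simp_rw [mutualEnergy_finset_sum_right s _ _ _ fun u =>
        (inferInstance : SFinite ((μ u).map (g t')))]
      rw [← Finset.sum_product']
      exact Finset.sum_le_sum_of_subset fun p _ => by simp
    rw [hT, Nat.add_sub_cancel, nsmul_eq_mul, nsmul_eq_mul] at e
    rw [hw, ENNReal.inv_mul_le_iff hf0 hf1]
    generalize (∑ π : Equiv.Perm T, mutualEnergy s ((μ (π t)).map (g t))
      ((μ (π t')).map (g t'))) = X at e ⊢
    have h1 : ((k + 1 : ℕ) : ℝ≥0∞) * (k * X) ≤ ((k + 1 : ℕ) : ℝ≥0∞) *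
        (((k + 1).factorial : ℝ≥0∞) * (((k + 1 : ℕ) : ℝ≥0∞) * mutualEnergy s (σ t) (σ t'))) := by
      rw [← mul_assoc, ← Nat.cast_mul, e]
      calc _ ≤ _ := mul_le_mul_right hle _
        _ = _ := by ring
    rw [ENNReal.mul_le_mul_iff_right hM0 hM1] at h1
    calc X = (k : ℝ≥0∞)⁻¹ * (k * X) := by
          rw [← mul_assoc, ENNReal.inv_mul_cancel hk0 hk1, one_mul]
      _ ≤ (k : ℝ≥0∞)⁻¹ * (((k + 1).factorial : ℝ≥0∞) *
          (((k + 1 : ℕ) : ℝ≥0∞) * mutualEnergy s (σ t) (σ t'))) := by gcongr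
      _ = ((k + 1).factorial : ℝ≥0∞) * (((k : ℝ≥0∞)⁻¹ * ((k + 1 : ℕ) : ℝ≥0∞)) *
          mutualEnergy s (σ t) (σ t')) := by ring
      _ = _ := by
        rw [Nat.cast_succ, mul_add, ENNReal.inv_mul_cancel hk0 hk1, mul_one]

/-- Each site contributes the same self-energy by isometry invariance, so adding M times that value
completes the off-diagonal sum to the full direct energy. The additive form avoids subtraction in
`ℝ≥0∞`. -/
theorem minEnergy_permute_le {T : Type*} [Fintype T] [DecidableEq T] {s : ℝ} {k : ℕ} (hk : k ≠ 0)
    (hT : Fintype.card T = k + 1) {n : T → ℕ} {μ : T → Measure (ℝ^ d)} {c : T → ℝ≥0∞}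
    (h : ∀ t, HasState s (n t) (μ t) (c t)) {g : T → (ℝ^ d) → ℝ^ d} (hg : ∀ t, Isometry (g t)) :
    minEnergy s (∑ t, ((((k + 1 : ℕ) : ℝ≥0∞))⁻¹ • ∑ u, μ u).map (g t))
      + ((k + 1 : ℕ) : ℝ≥0∞) * selfEnergy s ((((k + 1 : ℕ) : ℝ≥0∞))⁻¹ • ∑ u, μ u)
      ≤ ∑ t, c t + (1 + (k : ℝ≥0∞)⁻¹) *
        selfEnergy s (∑ t, ((((k + 1 : ℕ) : ℝ≥0∞))⁻¹ • ∑ u, μ u).map (g t)) := by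
  have hfin : ∀ t, IsFiniteMeasure (μ t) := fun t => (h t).isFiniteMeasure
  have hstate := (HasState.permute hk hT h hg fun t => rfl).minEnergy_le
  set ρ := ((((k + 1 : ℕ) : ℝ≥0∞))⁻¹ • ∑ u, μ u) with hρ
  have hρf : SFinite ρ := by rw [hρ]; infer_instance
  have hself : ∀ t, selfEnergy s (ρ.map (g t)) = selfEnergy s ρ := fun t => by
    rw [selfEnergy_map (hg t).continuous.measurable (riesz_isometry s (hg t)), one_mul]
  rw [selfEnergy_finset_sum s _ _ fun t => inferInstance]
  simp only [hself, Finset.sum_const, Finset.card_univ, hT, nsmul_eq_mul]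
  generalize (2⁻¹ * ∑ t, ∑ t', if t = t' then 0 else
    mutualEnergy s (ρ.map (g t)) (ρ.map (g t'))) = X at hstate ⊢
  calc _ ≤ (∑ t, c t + (1 + (k : ℝ≥0∞)⁻¹) * X)
        + ((k + 1 : ℕ) : ℝ≥0∞) * selfEnergy s ρ := by gcongr
    _ ≤ (∑ t, c t + (1 + (k : ℝ≥0∞)⁻¹) * X)
        + (1 + (k : ℝ≥0∞)⁻¹) * (((k + 1 : ℕ) : ℝ≥0∞) * selfEnergy s ρ) := by
        refine add_le_add le_rfl ?_
        rw [add_mul, one_mul]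
        exact le_self_add
    _ = _ := by ring

/-! ### Gaussian decomposition of the interaction -/

/-- The Gaussian kernel `exp (- t |x - y| ^ 2)`. -/
noncomputable def gaussianKernel (t : ℝ) (x y : ℝ^ d) : ℝ≥0∞ :=
  ENNReal.ofReal (Real.exp (-t * dist x y ^ 2))

theorem gaussianKernel_comm (t : ℝ) (x y : ℝ^ d) : gaussianKernel t x y = gaussianKernel t y x := by
  unfold gaussianKernel; rw [dist_comm]

theorem gaussianKernel_self (t : ℝ) (x : ℝ^ d) : gaussianKernel t x x = 1 := by
  simp [gaussianKernel]

theorem gaussianKernel_le_one {t : ℝ} (ht : 0 ≤ t) (x y : ℝ^ d) : gaussianKernel t x y ≤ 1 := by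
  unfold gaussianKernel
  rw [ENNReal.ofReal_le_one, Real.exp_le_one_iff]
  have := sq_nonneg (dist x y)
  nlinarith

theorem lintegral_gaussianKernel {t : ℝ} (ht : 0 < t) (x : ℝ^ d) :
    ∫⁻ y, gaussianKernel t x y = ENNReal.ofReal ((Real.pi / t) ^ ((d : ℝ) / 2)) := by
  have h0 : ∫⁻ y : ℝ^ d, gaussianKernel t x y = ∫⁻ y : ℝ^ d,
      ENNReal.ofReal (Real.exp (-t * ‖y‖ ^ 2)) := by
    rw [← lintegral_sub_right_eq_self (fun y : ℝ^ d => ENNReal.ofReal (Real.exp (-t * ‖y‖ ^ 2))) x]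
    refine lintegral_congr fun y => ?_
    rw [gaussianKernel_comm, gaussianKernel, dist_eq_norm]
  have h1 := GaussianFourier.integral_rexp_neg_mul_sq_norm (V := ℝ^ d) ht
  rw [finrank_euclideanSpace_fin] at h1
  have h2 : Integrable fun y : ℝ^ d => Real.exp (-t * ‖y‖ ^ 2) := by
    -- A non-integrable function would have integral zero, whereas the known value is positive.
    by_contra h
    rw [integral_undef h] at h1
    have : (0 : ℝ) < (Real.pi / t) ^ ((d : ℝ) / 2) := by positivity
    exact this.ne h1
  rw [h0, ← ofReal_integral_eq_lintegral_ofReal h2 (ae_of_all _ fun y => (Real.exp_pos _).le), h1]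

/-- The parallelogram law about the midpoint of x and y separates the variable z. The kernel is
thus, up to a constant, a convolution square; this is its positive definiteness. -/
theorem lintegral_gaussianKernel_mul {t : ℝ} (ht : 0 < t) (x y : ℝ^ d) :
    ∫⁻ z, gaussianKernel (2 * t) x z * gaussianKernel (2 * t) y z
      = ENNReal.ofReal ((Real.pi / (4 * t)) ^ ((d : ℝ) / 2)) * gaussianKernel t x y := by
  rw [← lintegral_gaussianKernel (by positivity : 0 < 4 * t) (midpoint ℝ x y),
    ← lintegral_mul_const _ (by unfold gaussianKernel; fun_prop)]
  refine lintegral_congr fun z => ?_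
  unfold gaussianKernel
  rw [← ENNReal.ofReal_mul (Real.exp_pos _).le, ← ENNReal.ofReal_mul (Real.exp_pos _).le,
    ← Real.exp_add, ← Real.exp_add]
  congr 2
  have h := parallelogram_law_with_norm ℝ (x - z) (y - z)
  have h1 : x - z + (y - z) = (2 : ℝ) • (midpoint ℝ x y - z) := by
    rw [midpoint_eq_smul_add, smul_sub, smul_smul]
    norm_num
    module
  rw [h1, norm_smul, sub_sub_sub_cancel_right] at h
  simp only [dist_eq_norm]
  norm_num at h
  linear_combination t * h

/-- Off the diagonal this is the Gamma integral; on the diagonal both sides are infinite, the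
integral diverging at large t. -/
theorem riesz_eq_lintegral {s : ℝ} (hs : 0 < s) (x y : ℝ^ d) :
    riesz s x y = ENNReal.ofReal (1 / Real.Gamma (s / 2)) *
      ∫⁻ t in Ioi (0 : ℝ), ENNReal.ofReal (t ^ (s / 2 - 1)) * gaussianKernel t x y := by
  have hΓ : 0 < Real.Gamma (s / 2) := Real.Gamma_pos_of_pos (by positivity)
  rcases eq_or_ne x y with rfl | hxy
  · simp only [gaussianKernel_self, mul_one]
    have h1 : ∫⁻ t in Ioi (0 : ℝ), ENNReal.ofReal (t ^ (s / 2 - 1)) = ⊤ := by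
      by_contra h
      refine not_integrableOn_Ioi_rpow (s / 2 - 1) ⟨by fun_prop, ?_⟩
      rw [hasFiniteIntegral_iff_ofReal]
      · exact lt_top_iff_ne_top.mpr h
      · exact (ae_restrict_mem measurableSet_Ioi).mono fun t ht => Real.rpow_nonneg (le_of_lt ht) _
    rw [h1, ENNReal.mul_top (by simpa using hΓ)]
    unfold riesz
    rw [edist_self, ENNReal.zero_rpow_of_neg (by linarith)]
  · have hd : 0 < dist x y := dist_pos.mpr hxy
    have h1 := Real.integral_rpow_mul_exp_neg_mul_Ioi (half_pos hs) (pow_pos hd 2)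
    have hpos : 0 < (1 / dist x y ^ 2) ^ (s / 2) * Real.Gamma (s / 2) := by positivity
    have h2 : IntegrableOn (fun t : ℝ => t ^ (s / 2 - 1) * Real.exp (-(dist x y ^ 2 * t)))
        (Ioi 0) := by
      by_contra h
      rw [integral_undef h] at h1
      exact hpos.ne h1
    have h3 : ∫⁻ t in Ioi (0 : ℝ), ENNReal.ofReal (t ^ (s / 2 - 1)) * gaussianKernel t x y
        = ENNReal.ofReal ((1 / dist x y ^ 2) ^ (s / 2) * Real.Gamma (s / 2)) := by
      rw [← h1, ofReal_integral_eq_lintegral_ofReal h2]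
      · refine setLIntegral_congr_fun measurableSet_Ioi fun t ht => ?_
        simp only [gaussianKernel]
        rw [← ENNReal.ofReal_mul (Real.rpow_nonneg (le_of_lt ht) _)]
        ring_nf
      · exact (ae_restrict_mem measurableSet_Ioi).mono fun t ht =>
          mul_nonneg (Real.rpow_nonneg (le_of_lt ht) _) (Real.exp_pos _).le
    rw [h3, ← ENNReal.ofReal_mul (by positivity)]
    unfold riesz
    rw [edist_dist, ENNReal.ofReal_rpow_of_pos hd]
    congr 1
    rw [one_div, one_div, Real.inv_rpow (by positivity), ← Real.rpow_natCast, ← Real.rpow_mul hd.le,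
      Real.rpow_neg hd.le]
    have : ((2 : ℕ) : ℝ) * (s / 2) = s := by push_cast; ring
    rw [this]
    field_simp

/-- The self-energy of a measure with respect to a Gaussian interaction. -/
noncomputable def gaussianEnergy (t : ℝ) (μ : Measure (ℝ^ d)) : ℝ≥0∞ :=
  ∫⁻ x, ∫⁻ y, gaussianKernel t x y ∂μ ∂μ

theorem mutualEnergy_self_eq {s : ℝ} (hs : 0 < s) (μ : Measure (ℝ^ d)) [SFinite μ] :
    mutualEnergy s μ μ = ENNReal.ofReal (1 / Real.Gamma (s / 2)) *
      ∫⁻ t in Ioi (0 : ℝ), ENNReal.ofReal (t ^ (s / 2 - 1)) * gaussianEnergy t μ := by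
  unfold mutualEnergy
  simp_rw [riesz_eq_lintegral hs]
  have hm : Measurable fun p : ((ℝ^ d) × (ℝ^ d)) × ℝ =>
      ENNReal.ofReal (p.2 ^ (s / 2 - 1)) * gaussianKernel p.2 p.1.1 p.1.2 := by
    unfold gaussianKernel; fun_prop
  have hm1 : Measurable fun p : (ℝ^ d) × (ℝ^ d) => ∫⁻ t in Ioi (0 : ℝ),
      ENNReal.ofReal (t ^ (s / 2 - 1)) * gaussianKernel t p.1 p.2 := hm.lintegral_prod_right'
  have e0 : ∀ x, ∫⁻ y, (ENNReal.ofReal (1 / Real.Gamma (s / 2)) * ∫⁻ t in Ioi (0 : ℝ),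
      ENNReal.ofReal (t ^ (s / 2 - 1)) * gaussianKernel t x y) ∂μ
      = ENNReal.ofReal (1 / Real.Gamma (s / 2)) * ∫⁻ y, (∫⁻ t in Ioi (0 : ℝ),
      ENNReal.ofReal (t ^ (s / 2 - 1)) * gaussianKernel t x y) ∂μ :=
    fun x => lintegral_const_mul _ <| by
      refine Measurable.lintegral_prod_right' (f := fun p : (ℝ^ d) × ℝ =>
        ENNReal.ofReal (p.2 ^ (s / 2 - 1)) * gaussianKernel p.2 x p.1) ?_
      unfold gaussianKernel; fun_prop
  simp_rw [e0]
  rw [lintegral_const_mul _ hm1.lintegral_prod_right']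
  congr 1
  have e1 : ∀ x, ∫⁻ y, (∫⁻ t in Ioi (0 : ℝ),
      ENNReal.ofReal (t ^ (s / 2 - 1)) * gaussianKernel t x y) ∂μ
      = ∫⁻ t in Ioi (0 : ℝ), ∫⁻ y, ENNReal.ofReal (t ^ (s / 2 - 1)) * gaussianKernel t x y ∂μ := by
    intro x
    refine lintegral_lintegral_swap (Measurable.aemeasurable ?_)
    unfold gaussianKernel; fun_prop
  simp only [e1]
  rw [lintegral_lintegral_swap]
  · refine lintegral_congr fun t => ?_
    unfold gaussianEnergy
    rw [← lintegral_const_mul]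
    · refine lintegral_congr fun x => lintegral_const_mul _ ?_
      unfold gaussianKernel; fun_prop
    · refine Measurable.lintegral_prod_right' (f := fun p : (ℝ^ d) × (ℝ^ d) =>
        gaussianKernel t p.1 p.2) ?_
      unfold gaussianKernel; fun_prop
  · refine Measurable.aemeasurable ?_
    refine Measurable.lintegral_prod_right' (f := fun p : ((ℝ^ d) × ℝ) × (ℝ^ d) =>
        ENNReal.ofReal (p.1.2 ^ (s / 2 - 1)) * gaussianKernel p.1.2 p.1.1 p.2) ?_
    unfold gaussianKernel; fun_prop

/-- Used for small t, where the weight t^(s/2-1) is integrable; `gaussianEnergy_le_mul` takes over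
for large t. -/
theorem gaussianEnergy_le_sq {t : ℝ} (ht : 0 ≤ t) (μ : Measure (ℝ^ d)) :
    gaussianEnergy t μ ≤ μ univ ^ 2 := by
  calc gaussianEnergy t μ ≤ ∫⁻ _, ∫⁻ _, 1 ∂μ ∂μ :=
        lintegral_mono fun x => lintegral_mono fun y => gaussianKernel_le_one ht x y
    _ = _ := by simp [sq]

/-- A density at most one has Gaussian potential at most the total integral of the kernel. -/
theorem gaussianEnergy_le_mul {t : ℝ} (ht : 0 < t) {μ : Measure (ℝ^ d)} (hμ : μ ≤ volume) :
    gaussianEnergy t μ ≤ ENNReal.ofReal ((Real.pi / t) ^ ((d : ℝ) / 2)) * μ univ := by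
  calc gaussianEnergy t μ ≤ ∫⁻ _, ENNReal.ofReal ((Real.pi / t) ^ ((d : ℝ) / 2)) ∂μ := by
        refine lintegral_mono fun x => ?_
        simp only
        rw [← lintegral_gaussianKernel ht x]
        exact lintegral_mono' hμ le_rfl
    _ = _ := by simp

/-! ### Positive definiteness of the Gaussian and particle fluctuations. -/

theorem sq_lintegral_le {α : Type*} [MeasurableSpace α] (P : Measure α) [IsProbabilityMeasure P]
    {f : α → ℝ≥0∞} (hf : AEMeasurable f P) : (∫⁻ x, f x ∂P) ^ 2 ≤ ∫⁻ x, f x ^ 2 ∂P := by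
  have h := ENNReal.lintegral_mul_le_Lp_mul_Lq P
    (Real.holderConjugate_iff.mpr ⟨one_lt_two, by norm_num⟩ : (2 : ℝ).HolderConjugate 2) hf
    (aemeasurable_const (b := (1 : ℝ≥0∞)))
  simp only [Pi.mul_apply, mul_one, lintegral_const, measure_univ, ENNReal.rpow_two, one_pow,
    ENNReal.one_rpow] at h
  calc (∫⁻ x, f x ∂P) ^ 2 ≤ ((∫⁻ x, f x ^ 2 ∂P) ^ (1 / 2 : ℝ)) ^ 2 := by gcongr
    _ = _ := by
      rw [← ENNReal.rpow_two, ← ENNReal.rpow_mul]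
      norm_num

theorem sum_sum_eq_diag_add {n : ℕ} {f : Fin n → Fin n → ℝ≥0∞} (hf : ∀ i j, f i j = f j i) :
    ∑ i, ∑ j, f i j = ∑ i, f i i + 2 * ∑ i, ∑ j ∈ Finset.Ioi i, f i j := by
  have key : ∑ i, ∑ j ∈ Finset.Ioi i, f i j = ∑ i, ∑ j, if i < j then f i j else 0 := by
    refine Finset.sum_congr rfl fun i _ => ?_
    rw [← Finset.sum_filter]
    congr 1
    ext j; simp
  have key' : ∑ i, ∑ j ∈ Finset.Ioi i, f i j = ∑ i, ∑ j, if j < i then f i j else 0 := by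
    rw [key, Finset.sum_comm]
    simp_rw [hf]
  rw [two_mul]
  nth_rewrite 1 [key]
  rw [key', ← Finset.sum_add_distrib, ← Finset.sum_add_distrib]
  refine Finset.sum_congr rfl fun i _ => ?_
  rw [← Finset.sum_add_distrib]
  have : f i i = ∑ j, if j = i then f i j else 0 := by simp
  rw [this, ← Finset.sum_add_distrib]
  refine Finset.sum_congr rfl fun j _ => ?_
  rcases lt_trichotomy i j with h | h | h
  · simp [h, h.ne', h.not_gt]
  · simp [h]
  · simp [h, h.ne, h.not_gt]

/-- The Gaussian pair energy of a many-particle probability. -/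
noncomputable def gaussianPairEnergy {n : ℕ} (t : ℝ) (P : Measure (Fin n → ℝ^ d)) : ℝ≥0∞ :=
  ∫⁻ x, ∑ j, ∑ k ∈ Finset.Ioi j, gaussianKernel t (x j) (x k) ∂P

theorem interactionEnergy_eq {s : ℝ} (hs : 0 < s) {n : ℕ} (P : Measure (Fin n → ℝ^ d)) [SFinite P] :
    interactionEnergy s P = ENNReal.ofReal (1 / Real.Gamma (s / 2)) *
      ∫⁻ t in Ioi (0 : ℝ), ENNReal.ofReal (t ^ (s / 2 - 1)) * gaussianPairEnergy t P := by
  unfold interactionEnergy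
  have hm : ∀ y z : ℝ^ d, Measurable fun t : ℝ =>
      ENNReal.ofReal (t ^ (s / 2 - 1)) * gaussianKernel t y z := by
    intro y z; unfold gaussianKernel; fun_prop
  have e0 : ∀ x : Fin n → ℝ^ d, ∑ j, ∑ k ∈ Finset.Ioi j, riesz s (x j) (x k)
      = ENNReal.ofReal (1 / Real.Gamma (s / 2)) * ∫⁻ t in Ioi (0 : ℝ),
        ENNReal.ofReal (t ^ (s / 2 - 1)) *
          ∑ j, ∑ k ∈ Finset.Ioi j, gaussianKernel t (x j) (x k) := by
    intro x
    simp_rw [riesz_eq_lintegral hs, ← Finset.mul_sum]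
    congr 1
    simp_rw [Finset.mul_sum]
    rw [lintegral_finsetSum _ fun j _ => Finset.measurable_sum _ fun k _ => hm _ _]
    simp_rw [lintegral_finsetSum _ fun k _ => hm _ _]
  simp_rw [e0]
  have hm2 : Measurable fun p : (Fin n → ℝ^ d) × ℝ => ENNReal.ofReal (p.2 ^ (s / 2 - 1)) *
      ∑ j, ∑ k ∈ Finset.Ioi j, gaussianKernel p.2 (p.1 j) (p.1 k) := by
    unfold gaussianKernel; fun_prop
  rw [lintegral_const_mul _ hm2.lintegral_prod_right', lintegral_lintegral_swap hm2.aemeasurable]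
  congr 1
  refine lintegral_congr fun t => ?_
  unfold gaussianPairEnergy
  exact lintegral_const_mul (μ := P) (ENNReal.ofReal (t ^ (s / 2 - 1)))
    (f := fun x => ∑ j, ∑ k ∈ Finset.Ioi j, gaussianKernel t (x j) (x k))
    (by unfold gaussianKernel; fun_prop)

/-- Positive definiteness of the Gaussian, applied to the fluctuations of the particles. -/
theorem gaussianEnergy_particleDensity_le {t : ℝ} (ht : 0 < t) {n : ℕ}
    (P : Measure (Fin n → ℝ^ d)) [IsProbabilityMeasure P] :
    gaussianEnergy t (particleDensity P) ≤ n + 2 * gaussianPairEnergy t P := by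
  set G := ENNReal.ofReal ((Real.pi / (4 * t)) ^ ((d : ℝ) / 2)) with hG
  have hG0 : G ≠ 0 := by
    rw [hG, Ne, ENNReal.ofReal_eq_zero, not_le]; positivity
  have hG1 : G ≠ ⊤ := ENNReal.ofReal_ne_top
  have hfin : IsFiniteMeasure (particleDensity P) :=
    ⟨by rw [particleDensity_univ]; exact ENNReal.natCast_lt_top n⟩
  set μ := particleDensity P with hμ
  have hk : ∀ z : ℝ^ d, Measurable fun x => gaussianKernel (2 * t) x z := by
    intro z; unfold gaussianKernel; fun_prop
  have hk2 : Measurable fun p : (ℝ^ d) × (ℝ^ d) => gaussianKernel (2 * t) p.1 p.2 := by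
    unfold gaussianKernel; fun_prop
  -- the self-energy of the density as an integral of a square
  have e1 : G * gaussianEnergy t μ = ∫⁻ z, (∫⁻ x, gaussianKernel (2 * t) x z ∂μ) ^ 2 := by
    unfold gaussianEnergy
    have hmm : Measurable fun p : (ℝ^ d) × (ℝ^ d) => gaussianKernel t p.1 p.2 := by
      unfold gaussianKernel; fun_prop
    rw [← lintegral_const_mul _ hmm.lintegral_prod_right']
    have a1 : ∀ x, G * ∫⁻ y, gaussianKernel t x y ∂μ
        = ∫⁻ z, gaussianKernel (2 * t) x z * ∫⁻ y, gaussianKernel (2 * t) y z ∂μ := by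
      intro x
      rw [← lintegral_const_mul _ (by unfold gaussianKernel; fun_prop)]
      simp_rw [hG, ← lintegral_gaussianKernel_mul ht]
      rw [lintegral_lintegral_swap (by
        refine Measurable.aemeasurable ?_
        unfold gaussianKernel; fun_prop)]
      exact lintegral_congr fun z => lintegral_const_mul _ (hk z)
    simp_rw [a1]
    have hswap : Measurable fun p : (ℝ^ d) × (ℝ^ d) => ∫⁻ y, gaussianKernel (2 * t) y p.2 ∂μ := by
      refine Measurable.lintegral_prod_right' (f := fun p : ((ℝ^ d) × (ℝ^ d)) × (ℝ^ d) =>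
        gaussianKernel (2 * t) p.2 p.1.2) ?_
      unfold gaussianKernel; fun_prop
    rw [lintegral_lintegral_swap (hk2.mul hswap).aemeasurable]
    refine lintegral_congr fun z => ?_
    rw [lintegral_mul_const _ (hk z), sq]
  have e2 : ∀ z, ∫⁻ x, gaussianKernel (2 * t) x z ∂μ
      = ∫⁻ x, ∑ j, gaussianKernel (2 * t) (x j) z ∂P := by
    intro z
    rw [hμ, particleDensity, lintegral_finsetSum_measure, lintegral_finsetSum]
    · exact Finset.sum_congr rfl fun j _ => lintegral_map (hk z) (measurable_pi_apply j)
    · intro j _; unfold gaussianKernel; fun_prop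
  have e3 : ∀ x : Fin n → ℝ^ d, ∫⁻ z, (∑ j, gaussianKernel (2 * t) (x j) z) ^ 2
      = G * (n + 2 * ∑ j, ∑ k ∈ Finset.Ioi j, gaussianKernel t (x j) (x k)) := by
    intro x
    have b1 : ∑ j, ∑ k, gaussianKernel t (x j) (x k)
        = n + 2 * ∑ j, ∑ k ∈ Finset.Ioi j, gaussianKernel t (x j) (x k) := by
      rw [sum_sum_eq_diag_add fun i j => gaussianKernel_comm t _ _]
      simp [gaussianKernel_self]
    have hmz : ∀ j k, Measurable fun z =>
        gaussianKernel (2 * t) (x j) z * gaussianKernel (2 * t) (x k) z := by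
      intro j k; unfold gaussianKernel; fun_prop
    rw [← b1]
    simp_rw [sq, Finset.sum_mul_sum]
    rw [lintegral_finsetSum _ fun j _ => Finset.measurable_sum _ fun k _ => hmz j k]
    simp_rw [lintegral_finsetSum _ fun k _ => hmz _ k, lintegral_gaussianKernel_mul ht,
      ← Finset.mul_sum]
    rfl
  have hmP : Measurable fun p : (ℝ^ d) × (Fin n → ℝ^ d) =>
      (∑ j, gaussianKernel (2 * t) (p.2 j) p.1) ^ 2 := by
    unfold gaussianKernel; fun_prop
  have hmQ : Measurable fun x : Fin n → ℝ^ d =>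
      ∑ j, ∑ k ∈ Finset.Ioi j, gaussianKernel t (x j) (x k) := by
    unfold gaussianKernel; fun_prop
  have main : G * gaussianEnergy t μ ≤ G * (n + 2 * gaussianPairEnergy t P) := by
    rw [e1]
    calc ∫⁻ z, (∫⁻ x, gaussianKernel (2 * t) x z ∂μ) ^ 2
        = ∫⁻ z, (∫⁻ x, ∑ j, gaussianKernel (2 * t) (x j) z ∂P) ^ 2 := by simp_rw [e2]
      -- Jensen's inequality: the variance of the smeared particle number at z is nonnegative. The
      -- diagonal of the expanded square produces the term n.
      _ ≤ ∫⁻ z, ∫⁻ x, (∑ j, gaussianKernel (2 * t) (x j) z) ^ 2 ∂P := by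
        refine lintegral_mono fun z => sq_lintegral_le P (Measurable.aemeasurable ?_)
        unfold gaussianKernel; fun_prop
      _ = ∫⁻ x, G * (n + 2 * ∑ j, ∑ k ∈ Finset.Ioi j, gaussianKernel t (x j) (x k)) ∂P := by
        rw [lintegral_lintegral_swap hmP.aemeasurable]
        simp_rw [e3]
      _ = _ := by
        rw [lintegral_const_mul _ ((hmQ.const_mul 2).const_add _),
          lintegral_add_left measurable_const, lintegral_const_mul _ hmQ]
        simp [gaussianPairEnergy]
  exact (ENNReal.mul_le_mul_iff_right hG0 hG1).mp main

/-! ### Bounds on the energies -/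

theorem lintegral_weight_Ioc {s : ℝ} (hs : 0 < s) {a : ℝ} (ha : 0 < a) :
    ∫⁻ t in Ioc (0 : ℝ) a, ENNReal.ofReal (t ^ (s / 2 - 1)) = ENNReal.ofReal (a ^ (s / 2) / (s / 2)) := by
  have h1 : IntervalIntegrable (fun t : ℝ => t ^ (s / 2 - 1)) volume 0 a :=
    intervalIntegral.intervalIntegrable_rpow' (by linarith)
  rw [← ofReal_integral_eq_lintegral_ofReal
    ((intervalIntegrable_iff_integrableOn_Ioc_of_le ha.le).mp h1)
    ((ae_restrict_mem measurableSet_Ioc).mono fun t ht => Real.rpow_nonneg ht.1.le _),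
    ← intervalIntegral.integral_of_le ha.le, integral_rpow (Or.inl (by linarith))]
  rw [sub_add_cancel, Real.zero_rpow (by positivity), sub_zero]

/-- The exponent s/2 - 1 - d/2 lies below -1 precisely because s < d. -/
theorem lintegral_weight_Ioi {s : ℝ} (hsd : s < d) {a : ℝ} (ha : 0 < a) :
    ∫⁻ t in Ioi a, ENNReal.ofReal (t ^ (s / 2 - 1)) *
      ENNReal.ofReal ((Real.pi / t) ^ ((d : ℝ) / 2)) ≠ ⊤ := by
  have h1 : IntegrableOn (fun t : ℝ => Real.pi ^ ((d : ℝ) / 2) * t ^ (s / 2 - 1 - (d : ℝ) / 2))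
      (Ioi a) := (integrableOn_Ioi_rpow_of_lt (by linarith) ha).const_mul _
  have h2 := h1.lintegral_lt_top
  refine ne_of_lt (lt_of_eq_of_lt (setLIntegral_congr_fun measurableSet_Ioi fun t ht => ?_) h2)
  have ht0 : 0 < t := ha.trans ht
  rw [← ENNReal.ofReal_mul (by positivity)]
  congr 1
  rw [Real.div_rpow Real.pi_pos.le ht0.le, Real.rpow_sub ht0 (s / 2 - 1)]
  ring

/-- The part of the energy coming from wide Gaussians. -/
theorem lintegral_weight_gaussianEnergy_le {s a : ℝ} (ha : 0 < a) {μ : Measure (ℝ^ d)}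
    (hμ : μ ≤ volume) :
    ∫⁻ t in Ioi a, ENNReal.ofReal (t ^ (s / 2 - 1)) * gaussianEnergy t μ
      ≤ (∫⁻ t in Ioi a, ENNReal.ofReal (t ^ (s / 2 - 1)) *
      ENNReal.ofReal ((Real.pi / t) ^ ((d : ℝ) / 2))) * μ univ := by
  rw [← lintegral_mul_const _ (by fun_prop)]
  refine setLIntegral_mono (by fun_prop) fun t ht => ?_
  rw [mul_assoc]
  gcongr
  exact gaussianEnergy_le_mul (ha.trans ht) hμ

theorem mutualEnergy_self_split {s : ℝ} (hs : 0 < s) (μ : Measure (ℝ^ d)) [SFinite μ] {a : ℝ}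
    (ha : 0 < a) :
    mutualEnergy s μ μ = ENNReal.ofReal (1 / Real.Gamma (s / 2)) *
      ((∫⁻ t in Ioc (0 : ℝ) a, ENNReal.ofReal (t ^ (s / 2 - 1)) * gaussianEnergy t μ)
        + ∫⁻ t in Ioi a, ENNReal.ofReal (t ^ (s / 2 - 1)) * gaussianEnergy t μ) := by
  rw [mutualEnergy_self_eq hs, ← Ioc_union_Ioi_eq_Ioi ha.le,
    lintegral_union measurableSet_Ioi (Ioc_disjoint_Ioi le_rfl)]

/-- Cut the Gaussian parameter at a small a: below a the total weight is of order a^(s/2), hence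
small; above a the energy is linear in the mass. So D grows slower than the squared mass, which
makes the correction D(Q)/k negligible per tile. -/
theorem selfEnergy_le {s : ℝ} (hs : 0 < s) (hsd : s < d) {ε : ℝ≥0∞} (hε : ε ≠ 0) :
    ∃ C : ℝ≥0∞, C ≠ ⊤ ∧ ∀ μ : Measure (ℝ^ d), SFinite μ → μ ≤ volume →
      selfEnergy s μ ≤ ε * μ univ ^ 2 + C * μ univ := by
  set K := ENNReal.ofReal (1 / Real.Gamma (s / 2)) with hK
  obtain ⟨a, ha, ha'⟩ : ∃ a : ℝ, 0 < a ∧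
      2⁻¹ * (K * ENNReal.ofReal (a ^ (s / 2) / (s / 2))) ≤ ε := by
    have h1 : Tendsto (fun a : ℝ => a ^ (s / 2) / (s / 2)) (𝓝[>] 0) (𝓝 0) := by
      have := ((Real.continuousAt_rpow_const 0 (s / 2) (Or.inr (by positivity))).tendsto).div_const
        (s / 2)
      rw [Real.zero_rpow (by positivity), zero_div] at this
      exact this.mono_left nhdsWithin_le_nhds
    have h2 := ENNReal.Tendsto.const_mul (a := 2⁻¹) (ENNReal.Tendsto.const_mul (a := K)
      (ENNReal.tendsto_ofReal h1) (Or.inr ENNReal.ofReal_ne_top)) (Or.inr (by simp))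
    simp only [ENNReal.ofReal_zero, mul_zero] at h2
    obtain ⟨a, h3, h4⟩ := ((h2.eventually_le_const (pos_iff_ne_zero.mpr hε)).and
      self_mem_nhdsWithin).exists
    exact ⟨a, h4, h3⟩
  set T := ∫⁻ t in Ioi a, ENNReal.ofReal (t ^ (s / 2 - 1)) *
      ENNReal.ofReal ((Real.pi / t) ^ ((d : ℝ) / 2)) with hT
  refine ⟨2⁻¹ * (K * T), ENNReal.mul_ne_top (by simp)
    (ENNReal.mul_ne_top ENNReal.ofReal_ne_top (lintegral_weight_Ioi hsd ha)), fun μ _ hμ => ?_⟩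
  unfold selfEnergy
  rw [mutualEnergy_self_split hs μ ha]
  have h1 : ∫⁻ t in Ioc (0 : ℝ) a, ENNReal.ofReal (t ^ (s / 2 - 1)) * gaussianEnergy t μ
      ≤ ENNReal.ofReal (a ^ (s / 2) / (s / 2)) * μ univ ^ 2 := by
    rw [← lintegral_weight_Ioc hs ha, ← lintegral_mul_const _ (by fun_prop)]
    refine setLIntegral_mono (by fun_prop) fun t ht => ?_
    gcongr
    exact gaussianEnergy_le_sq ht.1.le μ
  calc _ ≤ 2⁻¹ * (K * (ENNReal.ofReal (a ^ (s / 2) / (s / 2)) * μ univ ^ 2 + T * μ univ)) := by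
        gcongr
        exact lintegral_weight_gaussianEnergy_le ha hμ
    _ = 2⁻¹ * (K * ENNReal.ofReal (a ^ (s / 2) / (s / 2))) * μ univ ^ 2
        + 2⁻¹ * (K * T) * μ univ := by ring
    _ ≤ _ := by gcongr

theorem selfEnergy_ne_top {s : ℝ} (hs : 0 < s) (hsd : s < d) {μ : Measure (ℝ^ d)}
    [IsFiniteMeasure μ] (hμ : μ ≤ volume) : selfEnergy s μ ≠ ⊤ := by
  obtain ⟨C, hC, h⟩ := selfEnergy_le hs hsd one_ne_zero
  refine ((h μ inferInstance hμ).trans_lt ?_).ne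
  exact ENNReal.add_lt_top.mpr ⟨ENNReal.mul_lt_top (by simp)
    (ENNReal.pow_lt_top (measure_lt_top μ univ)), ENNReal.mul_lt_top hC.lt_top (measure_lt_top μ univ)⟩

/-- A bound of Lieb-Oxford type on the indirect energy for densities bounded by one. -/
theorem HasState.selfEnergy_le {s : ℝ} (hs : 0 < s) (hsd : s < d) :
    ∃ C : ℝ≥0∞, C ≠ ⊤ ∧ ∀ (n : ℕ) (μ : Measure (ℝ^ d)) (c : ℝ≥0∞), μ ≤ volume →
      HasState s n μ c → selfEnergy s μ ≤ c + C * n := by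
  set K := ENNReal.ofReal (1 / Real.Gamma (s / 2)) with hK
  set T := ∫⁻ t in Ioi (1 : ℝ), ENNReal.ofReal (t ^ (s / 2 - 1)) *
      ENNReal.ofReal ((Real.pi / t) ^ ((d : ℝ) / 2)) with hT
  set W := ∫⁻ t in Ioc (0 : ℝ) 1, ENNReal.ofReal (t ^ (s / 2 - 1)) with hW
  have hW1 : W ≠ ⊤ := by rw [hW, lintegral_weight_Ioc hs one_pos]; exact ENNReal.ofReal_ne_top
  refine ⟨2⁻¹ * (K * (W + T)), ENNReal.mul_ne_top (by simp) (ENNReal.mul_ne_top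
    ENNReal.ofReal_ne_top (ENNReal.add_ne_top.mpr ⟨hW1, lintegral_weight_Ioi hsd one_pos⟩)),
    fun n μ c hμ h => ?_⟩
  have hmass := h.measure_univ
  have hfin := h.isFiniteMeasure
  obtain ⟨P, hP, rfl, hi⟩ := h
  refine le_trans ?_ (add_le_add hi le_rfl)
  unfold selfEnergy
  rw [mutualEnergy_self_split hs _ one_pos, interactionEnergy_eq hs]
  have hEm : Measurable fun t => gaussianPairEnergy t P := by
    refine Measurable.lintegral_prod_right' (f := fun p : ℝ × (Fin n → ℝ^ d) =>
      ∑ j, ∑ k ∈ Finset.Ioi j, gaussianKernel p.1 (p.2 j) (p.2 k)) ?_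
    unfold gaussianKernel; fun_prop
  -- For t ≤ 1 the fluctuation inequality compares with the true pair energy at the price `W * n`;
  -- for t > 1 the density bound alone suffices.
  have h1 : ∫⁻ t in Ioc (0 : ℝ) 1,
      ENNReal.ofReal (t ^ (s / 2 - 1)) * gaussianEnergy t (particleDensity P)
      ≤ W * n + 2 * ∫⁻ t in Ioi (0 : ℝ),
        ENNReal.ofReal (t ^ (s / 2 - 1)) * gaussianPairEnergy t P := by
    calc _ ≤ ∫⁻ t in Ioc (0 : ℝ) 1, (ENNReal.ofReal (t ^ (s / 2 - 1)) * n
          + 2 * (ENNReal.ofReal (t ^ (s / 2 - 1)) * gaussianPairEnergy t P)) := by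
          refine setLIntegral_mono (by fun_prop) fun t ht => ?_
          calc _ ≤ ENNReal.ofReal (t ^ (s / 2 - 1)) * (n + 2 * gaussianPairEnergy t P) := by
                gcongr
                exact gaussianEnergy_particleDensity_le ht.1 P
            _ = _ := by ring
      _ = W * n + 2 * ∫⁻ t in Ioc (0 : ℝ) 1,
          ENNReal.ofReal (t ^ (s / 2 - 1)) * gaussianPairEnergy t P := by
          rw [lintegral_add_left (by fun_prop), lintegral_mul_const _ (by fun_prop),
            lintegral_const_mul _ (by fun_prop)]
      _ ≤ _ := by
          gcongr
          exact Ioc_subset_Ioi_self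
  generalize (∫⁻ t in Ioi (0 : ℝ), ENNReal.ofReal (t ^ (s / 2 - 1)) * gaussianPairEnergy t P) = X
    at h1 ⊢
  have h2 := lintegral_weight_gaussianEnergy_le (s := s) one_pos hμ
  rw [hmass] at h2
  have h3 : (2⁻¹ : ℝ≥0∞) * 2 = 1 := ENNReal.inv_mul_cancel two_ne_zero ENNReal.ofNat_ne_top
  calc _ ≤ 2⁻¹ * (K * ((W * n + 2 * X) + T * n)) := by gcongr
    _ = 2⁻¹ * 2 * (K * X) + 2⁻¹ * (K * (W + T)) * n := by ring
    _ = _ := by rw [h3, one_mul]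

/-- Extensivity of the gain, from applying the Lieb-Oxford type bound to near-minimisers. It makes
`kappa` finite. -/
theorem gain_le {s : ℝ} (hs : 0 < s) (hsd : s < d) :
    ∃ C : ℝ≥0∞, C ≠ ⊤ ∧ ∀ μ : Measure (ℝ^ d), μ ≤ volume → gain s μ ≤ C * μ univ := by
  obtain ⟨C, hC, h⟩ := HasState.selfEnergy_le (d := d) hs hsd
  refine ⟨C, hC, fun μ hμ => ?_⟩
  unfold gain
  rcases eq_or_ne (minEnergy s μ) ⊤ with h1 | h1
  · simp [h1]
  rw [tsub_le_iff_left]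
  refine ENNReal.le_of_forall_pos_le_add fun ε hε _ => ?_
  obtain ⟨n, hn⟩ := exists_hasState (ENNReal.lt_add_right h1 (ENNReal.coe_ne_zero.mpr hε.ne'))
  refine (h n μ _ hμ hn).trans (le_of_eq ?_)
  rw [hn.measure_univ]
  ring

/-! ### The gain of a set -/

/-- Minus the indirect energy of the uniform density one on `A`. -/
noncomputable def setGain (s : ℝ) (A : Set (ℝ^ d)) : ℝ≥0∞ := gain s (volume.restrict A)

/-- What remains after removing an integer mass from an integer mass is again integer, so
superadditivity applies to complements. -/
theorem natCast_sub_of_add_eq {a b : ℝ≥0∞} {k m : ℕ} (ha : a = k) (h : a + b = m) :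
    ∃ n : ℕ, b = n := by
  refine ⟨m - k, ?_⟩
  rw [ENNReal.natCast_sub, ← ha, ← h]
  exact (ENNReal.add_sub_cancel_left (by rw [ha]; exact ENNReal.natCast_ne_top k)).symm

section SetGain

variable {s : ℝ}

theorem selfEnergy_restrict_ne_top (hs : 0 < s) (hsd : s < d) {A : Set (ℝ^ d)}
    (hA : volume A ≠ ⊤) : selfEnergy s (volume.restrict A) ≠ ⊤ := by
  have : IsFiniteMeasure (volume.restrict A) := ⟨by simpa using hA.lt_top⟩
  exact selfEnergy_ne_top hs hsd Measure.restrict_le_self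

theorem setGain_add_le (hs : 0 < s) (hsd : s < d) {A B : Set (ℝ^ d)} {k m : ℕ}
    (hB : MeasurableSet B) (hk : volume A = k) (hm : volume B = m) (hAB : Disjoint A B) :
    setGain s A + setGain s B ≤ setGain s (A ∪ B) := by
  unfold setGain
  have hfin : selfEnergy s (volume.restrict (A ∪ B)) ≠ ⊤ :=
    selfEnergy_restrict_ne_top hs hsd
      ((measure_union_le A B).trans_lt (by rw [hk, hm]; simp)).ne
  rw [Measure.restrict_union hAB hB] at hfin ⊢
  exact gain_add_le (by simpa using hk) (by simpa using hm) hfin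

/-- The difference set has integer volume and nonnegative gain, so superadditivity implies
monotonicity. -/
theorem setGain_mono (hs : 0 < s) (hsd : s < d) {A B : Set (ℝ^ d)} {k m : ℕ}
    (hA : MeasurableSet A) (hB : MeasurableSet B) (hk : volume A = k) (hm : volume B = m)
    (hAB : A ⊆ B) : setGain s A ≤ setGain s B := by
  obtain ⟨n, hn⟩ := natCast_sub_of_add_eq hk (m := m) (b := volume (B \ A)) (by
    rw [← hm, ← measure_union disjoint_sdiff_right (hB.diff hA), union_sdiff_cancel hAB])
  have h := setGain_add_le hs hsd (hB.diff hA) hk hn disjoint_sdiff_right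
  rw [union_sdiff_cancel hAB] at h
  exact le_self_add.trans h

theorem setGain_image (g : (ℝ^ d) ≃ᵢ (ℝ^ d)) (hg : MeasurePreserving g) (A : Set (ℝ^ d)) :
    setGain s (g '' A) = setGain s A := by
  have hme : MeasurableEmbedding g := g.toHomeomorph.measurableEmbedding
  have h := gain_map (s := s) g.toHomeomorph.toMeasurableEquiv one_ne_zero ENNReal.one_ne_top
    (riesz_isometry s g.isometry) (volume.restrict A)
  rw [one_mul] at h
  unfold setGain
  rw [← h]
  congr 1
  have e := hg.restrict_image_emb hme A
  exact e.map_eq.symm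

/-- Superadditivity for finitely many disjoint sets of equal integer volume. -/
theorem card_mul_le_setGain_biUnion (hs : 0 < s) (hsd : s < d) {ι : Type*} (Z : Finset ι)
    {A : ι → Set (ℝ^ d)} {k : ℕ} {j : ℝ≥0∞} (hA : ∀ i, MeasurableSet (A i))
    (hk : ∀ i, volume (A i) = k) (hj : ∀ i, j ≤ setGain s (A i))
    (hd : Pairwise (Function.onFun Disjoint A)) :
    Z.card * j ≤ setGain s (⋃ i ∈ Z, A i) := by
  classical
  induction Z using Finset.induction_on with
  | empty => simp
  | insert a Z ha ih =>
    rw [Finset.set_biUnion_insert, Finset.card_insert_of_notMem ha, Nat.cast_succ, add_mul, one_mul,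
      add_comm]
    have hvol : volume (⋃ i ∈ Z, A i) = ((Z.card * k : ℕ) : ℝ≥0∞) := by
      rw [measure_biUnion_finset (fun i _ i' _ h => hd h) fun i _ => hA i]
      simp [hk]
    refine (add_le_add (hj a) ih).trans (setGain_add_le hs hsd
      (Finset.measurableSet_biUnion _ fun i _ => hA i) (hk a) hvol ?_)
    rw [disjoint_iUnion₂_right]
    intro i hi
    exact hd (by rintro rfl; exact ha hi)

end SetGain

/-! ### Boxes and grids -/

/-- The half-open cube of side `ℓ` with lower corner `a`. -/
def box (a : Fin d → ℝ) (ℓ : ℝ) : Set (ℝ^ d) := {x | ∀ i, a i ≤ x i ∧ x i < a i + ℓ}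

theorem box_eq_preimage (a : Fin d → ℝ) (ℓ : ℝ) :
    (box a ℓ : Set (ℝ^ d)) = WithLp.ofLp ⁻¹' (Set.pi univ fun i => Ico (a i) (a i + ℓ)) := by
  ext x; simp [box]

theorem measurableSet_box (a : Fin d → ℝ) (ℓ : ℝ) : MeasurableSet (box a ℓ : Set (ℝ^ d)) := by
  rw [box_eq_preimage]
  exact (PiLp.volume_preserving_ofLp (Fin d)).measurable
    (MeasurableSet.univ_pi fun i => measurableSet_Ico)

theorem volume_box (a : Fin d → ℝ) (ℓ : ℝ) :
    volume (box a ℓ : Set (ℝ^ d)) = ENNReal.ofReal ℓ ^ d := by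
  rw [box_eq_preimage, (PiLp.volume_preserving_ofLp (Fin d)).measure_preimage
    (MeasurableSet.univ_pi fun i => measurableSet_Ico).nullMeasurableSet, Real.volume_pi_Ico]
  simp

theorem volume_box_nat (a : Fin d → ℝ) (L : ℕ) :
    volume (box a L : Set (ℝ^ d)) = ((L ^ d : ℕ) : ℝ≥0∞) := by
  rw [volume_box]; simp

theorem convex_box (a : Fin d → ℝ) (ℓ : ℝ) : Convex ℝ (box a ℓ : Set (ℝ^ d)) := by
  rw [box_eq_preimage]
  exact (convex_pi fun i _ => convex_Ico (𝕜 := ℝ) (a i) (a i + ℓ)).linear_preimage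
    (WithLp.linearEquiv 2 ℝ (Fin d → ℝ)).toLinearMap

theorem dist_le_of_mem_box {a : Fin d → ℝ} {ℓ : ℝ} {x y : ℝ^ d} (hx : x ∈ box a ℓ)
    (hy : y ∈ box a ℓ) : dist x y ≤ d * ℓ := by
  rcases Nat.eq_zero_or_pos d with rfl | hd
  · simp [Subsingleton.elim x y]
  have hℓ : 0 ≤ ℓ := by have := hx ⟨0, hd⟩; linarith [this.1, this.2]
  rw [EuclideanSpace.dist_eq]
  refine Real.sqrt_le_iff.mpr ⟨by positivity, ?_⟩
  have h1 : ∀ i, dist (x i) (y i) ^ 2 ≤ ℓ ^ 2 := by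
    intro i
    rw [Real.dist_eq]
    gcongr
    rw [abs_le]
    have h1 := hx i
    have h2 := hy i
    constructor <;> linarith [h1.1, h1.2, h2.1, h2.2]
  calc ∑ i, dist (x i) (y i) ^ 2 ≤ ∑ _i : Fin d, ℓ ^ 2 := Finset.sum_le_sum fun i _ => h1 i
    _ = d * ℓ ^ 2 := by simp
    -- The sharp diameter √d ℓ is relaxed to d ℓ.
    _ ≤ (d : ℝ) * d * ℓ ^ 2 := by
      have : (1 : ℝ) ≤ d := by exact_mod_cast hd
      have h3 : 0 ≤ (d : ℝ) * ℓ ^ 2 := by positivity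
      nlinarith
    _ = _ := by ring

theorem setGain_box (s : ℝ) (a : Fin d → ℝ) (ℓ : ℝ) :
    setGain s (box a ℓ : Set (ℝ^ d)) = setGain s (box 0 ℓ : Set (ℝ^ d)) := by
  rw [← setGain_image (IsometryEquiv.addRight (WithLp.toLp 2 a : ℝ^ d))
    (measurePreserving_add_right volume _) (box 0 ℓ)]
  congr 1
  ext x
  constructor
  · intro hx
    refine ⟨x - WithLp.toLp 2 a, fun i => ?_, by simp⟩
    have := hx i
    simp only [PiLp.sub_apply, Pi.zero_apply]
    constructor <;> linarith [this.1, this.2]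
  · rintro ⟨y, hy, rfl⟩ i
    have := hy i
    simp only [Pi.zero_apply] at this
    simp only [IsometryEquiv.addRight_apply, PiLp.add_apply]
    constructor <;> linarith [this.1, this.2]

/-- The cube of the grid of mesh `L` with index `z`. -/
def gridBox (L : ℕ) (z : Fin d → ℤ) : Set (ℝ^ d) := box (fun i => L * z i) L

theorem mem_gridBox_iff {L : ℕ} (hL : 0 < L) {z : Fin d → ℤ} {x : ℝ^ d} :
    x ∈ gridBox L z ↔ (fun i => ⌊x i / L⌋) = z := by
  have hL' : (0 : ℝ) < L := by exact_mod_cast hL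
  rw [funext_iff]
  refine forall_congr' fun i => ?_
  rw [Int.floor_eq_iff, le_div_iff₀ hL', div_lt_iff₀ hL']
  constructor <;> rintro ⟨h1, h2⟩ <;> constructor <;> nlinarith

theorem pairwise_disjoint_gridBox {L : ℕ} (hL : 0 < L) :
    Pairwise (Function.onFun Disjoint (gridBox L : (Fin d → ℤ) → Set (ℝ^ d))) := by
  intro z z' h
  rw [Function.onFun, Set.disjoint_left]
  intro x hx hx'
  exact h (((mem_gridBox_iff hL).mp hx).symm.trans ((mem_gridBox_iff hL).mp hx'))

/-- The union of the `(2 k) ^ d` grid cubes around the grid point of index `z`. -/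
theorem biUnion_gridBox {L : ℕ} (hL : 0 < L) (z : Fin d → ℤ) (k : ℕ) :
    ⋃ z' ∈ Fintype.piFinset fun i => Finset.Ico (z i - k) (z i + k), gridBox L z'
      = (box (fun i => L * ((z i : ℝ) - k)) ((2 * k * L : ℕ) : ℝ) : Set (ℝ^ d)) := by
  have hL' : (0 : ℝ) < L := by exact_mod_cast hL
  ext x
  simp only [mem_iUnion, Fintype.mem_piFinset, Finset.mem_Ico, mem_gridBox_iff hL, exists_prop,
    exists_eq_right']
  refine forall_congr' fun i => ?_
  rw [Int.le_floor, Int.floor_lt, le_div_iff₀ hL', div_lt_iff₀ hL']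
  push_cast
  constructor <;> rintro ⟨h1, h2⟩ <;> constructor <;> nlinarith

/-! ### The energy per unit volume -/

/-- Minus the energy of the uniform gas. -/
noncomputable def kappa (d : ℕ) (s : ℝ) : ℝ≥0∞ :=
  ⨆ L : {L : ℕ // 0 < L}, setGain s (box 0 (L : ℕ) : Set (ℝ^ d)) / (((L : ℕ) ^ d : ℕ) : ℝ≥0∞)

theorem kappa_ne_top {s : ℝ} (hs : 0 < s) (hsd : s < d) : kappa d s ≠ ⊤ := by
  obtain ⟨C, hC, h⟩ := gain_le (d := d) hs hsd
  refine ((iSup_le fun L => ?_).trans_lt hC.lt_top).ne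
  refine ENNReal.div_le_of_le_mul ((h _ Measure.restrict_le_self).trans (le_of_eq ?_))
  rw [Measure.restrict_apply_univ, volume_box_nat]

theorem setGain_box_le (s : ℝ) {L : ℕ} (hL : 0 < L) (a : Fin d → ℝ) :
    setGain s (box a L : Set (ℝ^ d)) ≤ kappa d s * ((L ^ d : ℕ) : ℝ≥0∞) := by
  rw [setGain_box]
  have h : setGain s (box 0 L : Set (ℝ^ d)) / ((L ^ d : ℕ) : ℝ≥0∞) ≤ kappa d s :=
    le_iSup (fun L : {L : ℕ // 0 < L} =>
      setGain s (box 0 (L : ℕ) : Set (ℝ^ d)) / (((L : ℕ) ^ d : ℕ) : ℝ≥0∞)) ⟨L, hL⟩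
  rwa [ENNReal.div_le_iff_le_mul (Or.inl (by exact_mod_cast (pow_pos hL d).ne'))
    (Or.inl (ENNReal.natCast_ne_top _))] at h

/-! ### Comparison of a domain with a grid -/

/-- A convex set is connected, so if it meets both Ω and its complement it meets the frontier; its
diameter then controls the distance to that point. -/
theorem mem_cthickening_frontier {Ω S : Set (ℝ^ d)} {δ : ℝ} (hS : Convex ℝ S)
    (hδ : ∀ x ∈ S, ∀ y ∈ S, dist x y ≤ δ) {x y z : ℝ^ d} (hx : x ∈ S) (hy : y ∈ S) (hz : z ∈ S)
    (hxΩ : x ∈ Ω) (hyΩ : y ∉ Ω) : z ∈ Metric.cthickening δ (frontier Ω) := by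
  obtain ⟨w, hw, hwf⟩ : (S ∩ frontier Ω).Nonempty := by
    by_contra h
    rw [Set.not_nonempty_iff_eq_empty, ← Set.disjoint_iff_inter_eq_empty, Set.disjoint_left] at h
    have hfr : ∀ p ∈ S, p ∈ closure Ω → p ∈ interior Ω := fun p hp hpc => by
      by_contra hpi
      exact h hp ⟨hpc, hpi⟩
    obtain ⟨p, -, hp1, hp2⟩ := hS.isPreconnected (interior Ω) (closure Ω)ᶜ isOpen_interior
      isClosed_closure.isOpen_compl
      (fun p hp => (em (p ∈ closure Ω)).imp (hfr p hp) id)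
      ⟨x, hx, hfr x hx (subset_closure hxΩ)⟩
      ⟨y, hy, fun hyc => hyΩ (interior_subset (hfr y hy hyc))⟩
    exact hp2 (subset_closure (interior_subset hp1))
  exact Metric.mem_cthickening_of_dist_le z w δ _ hwf (hδ z hz w hw)

theorem gridBox_subset_cthickening {Ω : Set (ℝ^ d)} (L : ℕ) {z : Fin d → ℤ} {x y w : ℝ^ d}
    (hx : x ∈ gridBox L z) (hy : y ∈ gridBox L z) (hw : w ∈ gridBox L z) (hxΩ : x ∈ Ω)
    (hyΩ : y ∉ Ω) : w ∈ Metric.cthickening (d * L) (frontier Ω) :=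
  mem_cthickening_frontier (convex_box _ _) (fun _ h _ h' => dist_le_of_mem_box h h') hx hy hw
    hxΩ hyΩ

section Domain

variable {s : ℝ} {Ω : Set (ℝ^ d)} {L m : ℕ}

/-- Filling a domain with the grid cubes it contains. -/
theorem setGain_box_mul_volume_le (hs : 0 < s) (hsd : s < d) (hΩ : MeasurableSet Ω)
    (hm : volume Ω = m) (hL : 0 < L) :
    setGain s (box 0 L : Set (ℝ^ d)) * volume Ω ≤ ((L ^ d : ℕ) : ℝ≥0∞) * setGain s Ω
      + setGain s (box 0 L : Set (ℝ^ d)) * volume (Metric.cthickening (d * L) (frontier Ω)) := by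
  -- Disjoint cubes of equal positive volume inside a set of finite volume are finite in number.
  have hfin : {z : Fin d → ℤ | gridBox L z ⊆ Ω}.Finite := by
    have h := Measure.finite_const_le_meas_of_disjoint_iUnion (volume : Measure (ℝ^ d))
      (ε := ((L ^ d : ℕ) : ℝ≥0∞)) (by exact_mod_cast pow_pos hL d)
      (As := fun z : Fin d → ℤ => Ω ∩ gridBox L z)
      (fun z => hΩ.inter (measurableSet_box _ _))
      (fun z z' hz => ((pairwise_disjoint_gridBox hL hz).mono inter_subset_right
        inter_subset_right))
      (ne_top_of_le_ne_top (by rw [hm]; exact ENNReal.natCast_ne_top m)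
        (measure_mono (iUnion_subset fun z => inter_subset_left)))
    refine h.subset fun z hz => ?_
    have hz' : Ω ∩ gridBox L z = gridBox L z := inter_eq_right.mpr hz
    simp only [mem_ofPred_eq, hz']
    exact (volume_box_nat _ L).ge
  set Z := hfin.toFinset with hZ
  have hZm : ∀ z ∈ Z, gridBox L z ⊆ Ω := fun z hz => by simpa [hZ] using hz
  have hvolU : volume (⋃ z ∈ Z, gridBox L z : Set (ℝ^ d)) = ((Z.card * L ^ d : ℕ) : ℝ≥0∞) := by
    rw [measure_biUnion_finset (fun i _ i' _ h => pairwise_disjoint_gridBox hL h)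
      fun i _ => measurableSet_box _ _]
    simp [gridBox, volume_box_nat]
  have h1 : Z.card * setGain s (box 0 L : Set (ℝ^ d)) ≤ setGain s Ω :=
    (card_mul_le_setGain_biUnion hs hsd Z (fun z => measurableSet_box _ _)
      (fun z => volume_box_nat _ L) (fun z => (setGain_box s _ _).ge)
      (pairwise_disjoint_gridBox hL)).trans
    (setGain_mono hs hsd (Finset.measurableSet_biUnion _ fun z _ => measurableSet_box _ _) hΩ
      hvolU hm (iUnion₂_subset hZm))
  have h2 : volume Ω ≤ ((Z.card * L ^ d : ℕ) : ℝ≥0∞)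
      + volume (Metric.cthickening (d * L) (frontier Ω)) := by
    rw [← hvolU]
    refine (measure_mono fun x hx => ?_).trans (measure_union_le _ _)
    have hxz := (mem_gridBox_iff (x := x) hL).mpr rfl
    by_cases hsub : gridBox L (fun i => ⌊x i / L⌋) ⊆ Ω
    · left
      exact mem_biUnion (show _ ∈ (Z : Set (Fin d → ℤ)) by simpa [hZ] using hsub) hxz
    · right
      obtain ⟨y, hy, hyΩ⟩ := not_subset.mp hsub
      exact gridBox_subset_cthickening L hxz hy hxz hx hyΩ
  calc _ ≤ setGain s (box 0 L : Set (ℝ^ d)) * (((Z.card * L ^ d : ℕ) : ℝ≥0∞)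
      + volume (Metric.cthickening (d * L) (frontier Ω))) := by gcongr
    _ = ((L ^ d : ℕ) : ℝ≥0∞) * (Z.card * setGain s (box 0 L : Set (ℝ^ d)))
      + setGain s (box 0 L : Set (ℝ^ d)) * volume (Metric.cthickening (d * L) (frontier Ω)) := by
      push_cast; ring
    _ ≤ _ := by gcongr

/-- Filling the complement of a domain in a large cube with grid cubes. -/
theorem setGain_add_le_kappa (hs : 0 < s) (hsd : s < d) (hΩ : MeasurableSet Ω)
    (hm : volume Ω = m) (hL : 0 < L) {k : ℕ} (hk : 0 < k) (z : Fin d → ℤ)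
    (hsub : Ω ⊆ box (fun i => L * ((z i : ℝ) - k)) ((2 * k * L : ℕ) : ℝ)) :
    ((L ^ d : ℕ) : ℝ≥0∞) * setGain s Ω
      + setGain s (box 0 L : Set (ℝ^ d)) * (((2 * k * L) ^ d : ℕ) : ℝ≥0∞)
      ≤ ((L ^ d : ℕ) : ℝ≥0∞) * (kappa d s * (((2 * k * L) ^ d : ℕ) : ℝ≥0∞))
      + setGain s (box 0 L : Set (ℝ^ d)) *
        (volume Ω + volume (Metric.cthickening (d * L) (frontier Ω))) := by
  classical
  set B : Set (ℝ^ d) := box (fun i => L * ((z i : ℝ) - k)) ((2 * k * L : ℕ) : ℝ) with hB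
  set Zb := Fintype.piFinset fun i => Finset.Ico (z i - k) (z i + k) with hZb
  have hBu : ⋃ z' ∈ Zb, gridBox L z' = B := biUnion_gridBox hL z k
  set Z := Zb.filter fun z' => Disjoint Ω (gridBox L z' : Set (ℝ^ d)) with hZ
  have hvolU : volume (⋃ z ∈ Z, gridBox L z : Set (ℝ^ d)) = ((Z.card * L ^ d : ℕ) : ℝ≥0∞) := by
    rw [measure_biUnion_finset (fun i _ i' _ h => pairwise_disjoint_gridBox hL h)
      fun i _ => measurableSet_box _ _]
    simp [gridBox, volume_box_nat]
  have hUm : MeasurableSet (⋃ z ∈ Z, gridBox L z : Set (ℝ^ d)) :=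
    Finset.measurableSet_biUnion _ fun z _ => measurableSet_box _ _
  have hUB : (⋃ z ∈ Z, gridBox L z : Set (ℝ^ d)) ⊆ B := by
    rw [← hBu]
    exact biUnion_subset_biUnion_left fun z hz => (Finset.mem_filter.mp hz).1
  have hdisj : Disjoint Ω (⋃ z ∈ Z, gridBox L z : Set (ℝ^ d)) := by
    rw [disjoint_iUnion₂_right]
    exact fun z hz => (Finset.mem_filter.mp hz).2
  -- Ω and the cubes avoiding it form a subset of `B` of integer volume, whose gain is at most κ
  -- |B|. When the cubes nearly saturate κ, little more than κ |Ω| is left for Ω.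
  have h1 : setGain s Ω + Z.card * setGain s (box 0 L : Set (ℝ^ d))
      ≤ kappa d s * (((2 * k * L) ^ d : ℕ) : ℝ≥0∞) := by
    have a1 := card_mul_le_setGain_biUnion hs hsd Z (A := fun z => (gridBox L z : Set (ℝ^ d)))
      (fun z => measurableSet_box _ _)
      (fun z => volume_box_nat _ L) (fun z => (setGain_box s _ _).ge) (pairwise_disjoint_gridBox hL)
    refine (add_le_add le_rfl a1).trans ((setGain_add_le hs hsd hUm hm hvolU hdisj).trans ?_)
    refine le_trans ?_ (setGain_box_le s (by positivity) (fun i => L * ((z i : ℝ) - k)))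
    refine setGain_mono hs hsd (hΩ.union hUm) (measurableSet_box _ _) ?_ (volume_box_nat _ _)
      (union_subset hsub hUB) (k := m + Z.card * L ^ d)
    rw [measure_union hdisj hUm, hvolU, hm]
    push_cast; rfl
  have h2 : (((2 * k * L) ^ d : ℕ) : ℝ≥0∞) ≤ ((Z.card * L ^ d : ℕ) : ℝ≥0∞)
      + (volume Ω + volume (Metric.cthickening (d * L) (frontier Ω))) := by
    rw [← hvolU, ← volume_box_nat (fun i => L * ((z i : ℝ) - k)), ← hB]
    refine (measure_mono fun x hx => ?_).trans ((measure_union_le _ _).trans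
      (add_le_add le_rfl (measure_union_le _ _)))
    by_cases hxΩ : x ∈ Ω
    · exact Or.inr (Or.inl hxΩ)
    rw [← hBu] at hx
    obtain ⟨z', hz', hxz⟩ := mem_iUnion₂.mp hx
    by_cases hd : Disjoint Ω (gridBox L z' : Set (ℝ^ d))
    · left
      exact mem_biUnion (show z' ∈ (Z : Set (Fin d → ℤ)) by simp [hZ, hz', hd]) hxz
    · obtain ⟨y, hyΩ, hy⟩ := not_disjoint_iff.mp hd
      exact Or.inr (Or.inr (gridBox_subset_cthickening L hy hxz hxz hyΩ hxΩ))
  calc _ ≤ ((L ^ d : ℕ) : ℝ≥0∞) * setGain s Ω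
      + setGain s (box 0 L : Set (ℝ^ d)) * (((Z.card * L ^ d : ℕ) : ℝ≥0∞)
      + (volume Ω + volume (Metric.cthickening (d * L) (frontier Ω)))) := by gcongr
    _ = ((L ^ d : ℕ) : ℝ≥0∞) * (setGain s Ω + Z.card * setGain s (box 0 L : Set (ℝ^ d)))
      + setGain s (box 0 L : Set (ℝ^ d)) *
        (volume Ω + volume (Metric.cthickening (d * L) (frontier Ω))) := by
      push_cast; ring
    _ ≤ _ := by gcongr

end Domain

/-! ### The diameter of a regular domain -/

/-- If y lies outside Ω, the ball around the midpoint of x and y with radius r/2 is convex, has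
diameter at most r and contains both points. -/
theorem ball_subset_union_cthickening {Ω : Set (ℝ^ d)} {x : ℝ^ d} (hx : x ∈ Ω) (r : ℝ) :
    Metric.ball x r ⊆ Ω ∪ Metric.cthickening r (frontier Ω) := by
  intro y hy
  by_cases hyΩ : y ∈ Ω
  · exact Or.inl hyΩ
  right
  rw [Metric.mem_ball'] at hy
  have h1 : x ∈ Metric.closedBall (midpoint ℝ x y) (r / 2) := by
    rw [Metric.mem_closedBall, dist_left_midpoint]
    norm_num; linarith
  have h2 : y ∈ Metric.closedBall (midpoint ℝ x y) (r / 2) := by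
    rw [Metric.mem_closedBall, dist_right_midpoint]
    norm_num; linarith
  refine mem_cthickening_frontier (convex_closedBall (midpoint ℝ x y) (r / 2)) ?_ h1 h2 h2 hx hyΩ
  intro p hp q hq
  have := dist_triangle_right p q (midpoint ℝ x y)
  rw [Metric.mem_closedBall] at hp hq
  linarith

/-- By connectedness Ω contains points at distances 0, 2r, 4r, … from y's partner, up to the
distance of the two given points, with r = t |Ω|^(1/d). The r-balls around them are disjoint and lie
in Ω or its boundary layer, whose total volume is O(|Ω|). As each ball has volume of order |Ω|,
their number is bounded, and so is the diameter relative to |Ω|^(1/d). -/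
theorem exists_dist_le_of_regular (hd : 0 < d) {t₀ t : ℝ} (η : ℝ → ℝ) (ht : 0 < t) (htt : t < t₀) :
    ∃ A : ℝ, 0 < A ∧ ∀ Ω : Set (ℝ^ d), IsOpen Ω → IsConnected Ω → volume Ω ≠ ⊤ →
      HasRegularBoundary t₀ η Ω →
      ∀ x ∈ Ω, ∀ y ∈ Ω, dist x y ≤ A * (volume Ω).toReal ^ (1 / (d : ℝ)) := by
  have hω : 0 < volume (Metric.ball (0 : ℝ^ d) 1) := Metric.measure_ball_pos _ _ one_pos
  have hω' : volume (Metric.ball (0 : ℝ^ d) 1) ≠ ⊤ := measure_ball_lt_top.ne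
  set ω := (volume (Metric.ball (0 : ℝ^ d) 1)).toReal with hωdef
  have hωpos : 0 < ω := ENNReal.toReal_pos hω.ne' hω'
  -- Volume available divided by the volume of one ball, both in units of |Ω|. The maximum is needed
  -- since η is not assumed nonnegative here.
  set A₀ := (1 + max (η t) 0) / (ω * t ^ d) with hA₀
  have hA₀pos : 0 < A₀ := by positivity
  refine ⟨2 * t * A₀, by positivity, fun Ω hΩo hΩc hΩv hreg x hx y hy => ?_⟩
  have hvpos : 0 < (volume Ω).toReal :=
    ENNReal.toReal_pos (hΩo.measure_pos volume hΩc.nonempty).ne' hΩv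
  set v := (volume Ω).toReal with hv
  set u := v ^ (1 / (d : ℝ)) with hu
  have hupos : 0 < u := by positivity
  have hud : u ^ d = v := by
    rw [hu, ← Real.rpow_natCast, ← Real.rpow_mul hvpos.le, one_div,
      inv_mul_cancel₀ (by exact_mod_cast hd.ne'), Real.rpow_one]
  set r := u * t with hr
  have hrpos : 0 < r := by positivity
  -- The points are indexed by j = 0, …, n, so there are n + 1 balls, and the distance is less than
  -- 2r(n + 1).
  set n := ⌊dist y x / (2 * r)⌋₊ with hn
  have hpts : ∀ j : Fin (n + 1), ∃ p ∈ Ω, dist p x = 2 * r * j := by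
    intro j
    have hj : (j : ℝ) ≤ dist y x / (2 * r) :=
      (Nat.cast_le.mpr (Nat.lt_succ_iff.mp j.2)).trans (Nat.floor_le (by positivity))
    rw [le_div_iff₀ (by positivity)] at hj
    have h2 : 2 * r * j ∈ Icc (dist x x) (dist y x) :=
      ⟨by rw [dist_self]; positivity, by linarith⟩
    obtain ⟨p, hp, hpe⟩ := hΩc.isPreconnected.intermediate_value hx hy
      (f := fun p => dist p x) (by fun_prop) h2
    exact ⟨p, hp, hpe⟩
  choose p hpΩ hpd using hpts
  have hdisj : Pairwise (Function.onFun Disjoint fun j => Metric.ball (p j) r) := by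
    have key : ∀ i j : Fin (n + 1), (i : ℕ) < j → 2 * r ≤ dist (p j) (p i) := by
      intro i j hij
      have h1 := dist_triangle (p j) (p i) x
      rw [hpd, hpd] at h1
      have h2 : (i : ℝ) + 1 ≤ j := by exact_mod_cast hij
      nlinarith
    intro i j hij
    refine Metric.ball_disjoint_ball ?_
    rcases lt_or_gt_of_ne (Fin.val_ne_iff.mpr hij) with h | h
    · have := key i j h; rw [dist_comm] at this; linarith
    · have := key j i h; linarith
  have hsub : (⋃ j, Metric.ball (p j) r) ⊆ Ω ∪ Metric.cthickening r (frontier Ω) :=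
    iUnion_subset fun j => ball_subset_union_cthickening (hpΩ j) r
  have hvol := (measure_mono hsub).trans ((measure_union_le _ _).trans
    (add_le_add le_rfl (hreg t ⟨ht.le, htt⟩)))
  rw [measure_iUnion hdisj fun j => measurableSet_ball, tsum_fintype] at hvol
  have hball : ∀ y : ℝ^ d, volume (Metric.ball y r)
      = ENNReal.ofReal (r ^ d) * volume (Metric.ball (0 : ℝ^ d) 1) := fun y => by
    rw [Measure.addHaar_ball_of_pos volume y hrpos, finrank_euclideanSpace_fin]
  simp only [hball, Finset.sum_const, Finset.card_univ, Fintype.card_fin, nsmul_eq_mul] at hvol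
  have hreal : ((n : ℝ) + 1) * (r ^ d * ω) ≤ v + v * max (η t) 0 := by
    have hfin : volume Ω + volume Ω * ENNReal.ofReal (η t) ≠ ⊤ :=
      ENNReal.add_ne_top.mpr ⟨hΩv, ENNReal.mul_ne_top hΩv ENNReal.ofReal_ne_top⟩
    have := ENNReal.toReal_mono hfin hvol
    rw [ENNReal.toReal_add hΩv (ENNReal.mul_ne_top hΩv ENNReal.ofReal_ne_top)] at this
    simp only [ENNReal.toReal_mul, ENNReal.toReal_natCast, ENNReal.toReal_ofReal',
      max_eq_left (pow_nonneg hrpos.le d)] at this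
    exact_mod_cast this
  have hle : (n : ℝ) + 1 ≤ A₀ := by
    rw [hA₀, le_div_iff₀ (by positivity)]
    rw [hr, mul_pow, hud] at hreal
    have : v * (((n : ℝ) + 1) * (ω * t ^ d)) ≤ v * (1 + max (η t) 0) := by nlinarith
    exact le_of_mul_le_mul_left this hvpos
  have hlt : dist y x / (2 * r) < n + 1 := Nat.lt_floor_add_one _
  rw [div_lt_iff₀ (by positivity)] at hlt
  rw [dist_comm]
  calc dist y x ≤ ((n : ℝ) + 1) * (2 * r) := hlt.le
    _ ≤ A₀ * (2 * r) := by gcongr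
    _ = _ := by rw [hr]; ring

/-! ### The thermodynamic limit at density one -/

theorem setGain_ne_top {s : ℝ} (hs : 0 < s) (hsd : s < d) {A : Set (ℝ^ d)} (hA : volume A ≠ ⊤) :
    setGain s A ≠ ⊤ := by
  obtain ⟨C, hC, h⟩ := gain_le (d := d) hs hsd
  refine ne_top_of_le_ne_top (ENNReal.mul_ne_top hC hA) ((h _ Measure.restrict_le_self).trans ?_)
  rw [Measure.restrict_apply_univ]

theorem exists_box_gain {s : ℝ} (hs : 0 < s) (hsd : s < d) {ε : ℝ} (hε : 0 < ε) :
    ∃ L : ℕ, 0 < L ∧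
      (kappa d s).toReal - ε < (setGain s (box 0 L : Set (ℝ^ d))).toReal / (L : ℝ) ^ d := by
  by_contra! h
  have hκ := kappa_ne_top (d := d) hs hsd
  have h0 : 0 ≤ (kappa d s).toReal - ε := le_trans (by positivity) (h 1 one_pos)
  have : kappa d s ≤ ENNReal.ofReal ((kappa d s).toReal - ε) := by
    refine iSup_le fun ⟨L, hL⟩ => ?_
    have hb : setGain s (box 0 L : Set (ℝ^ d)) ≠ ⊤ :=
      setGain_ne_top hs hsd (by rw [volume_box_nat]; exact ENNReal.natCast_ne_top _)
    have hLd : 0 < (L : ℝ) ^ d := by positivity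
    have := h L hL
    rw [← ENNReal.ofReal_toReal hb, ← ENNReal.ofReal_natCast, ← ENNReal.ofReal_div_of_pos
      (by exact_mod_cast pow_pos hL d)]
    refine ENNReal.ofReal_le_ofReal ?_
    simpa using this
  rw [← ENNReal.ofReal_toReal hκ, ENNReal.ofReal_le_ofReal_iff
    (by rwa [ENNReal.toReal_ofReal (by positivity)])] at this
  rw [ENNReal.toReal_ofReal (by positivity)] at this
  linarith

theorem box_gain_le_kappa {s : ℝ} (hs : 0 < s) (hsd : s < d) {L : ℕ} (hL : 0 < L) :
    (setGain s (box 0 L : Set (ℝ^ d))).toReal / (L : ℝ) ^ d ≤ (kappa d s).toReal := by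
  have hκ := kappa_ne_top (d := d) hs hsd
  rw [div_le_iff₀ (by positivity)]
  have := ENNReal.toReal_mono (ENNReal.mul_ne_top hκ (ENNReal.natCast_ne_top _))
    (setGain_box_le (d := d) s hL 0)
  simpa [ENNReal.toReal_mul] using this

section Bounds

variable {s : ℝ} {Ω : Set (ℝ^ d)} {L m : ℕ}

theorem box_gain_mul_le_setGain (hs : 0 < s) (hsd : s < d) (hΩ : MeasurableSet Ω)
    (hm : volume Ω = m) (hL : 0 < L) {e : ℝ} (he : 0 ≤ e)
    (hth : volume (Metric.cthickening (d * L) (frontier Ω)) ≤ volume Ω * ENNReal.ofReal e) :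
    (setGain s (box 0 L : Set (ℝ^ d))).toReal / (L : ℝ) ^ d * (m * (1 - e))
      ≤ (setGain s Ω).toReal := by
  have h := (setGain_box_mul_volume_le hs hsd hΩ hm hL).trans (add_le_add le_rfl
    (mul_le_mul_right hth _))
  have hb : setGain s (box 0 L : Set (ℝ^ d)) ≠ ⊤ :=
    setGain_ne_top hs hsd (by rw [volume_box_nat]; exact ENNReal.natCast_ne_top _)
  have hG : setGain s Ω ≠ ⊤ :=
    setGain_ne_top hs hsd (by rw [hm]; exact ENNReal.natCast_ne_top _)
  rw [hm] at h
  have h2 := ENNReal.toReal_mono (by finiteness) h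
  rw [ENNReal.toReal_add (by finiteness) (by finiteness)] at h2
  simp only [ENNReal.toReal_mul, ENNReal.toReal_natCast, ENNReal.toReal_ofReal he] at h2
  push_cast at h2
  have hLd : (0 : ℝ) < (L : ℝ) ^ d := by positivity
  rw [div_mul_eq_mul_div, div_le_iff₀ hLd]
  linarith

/-- The first term is the defect of the chosen cube from optimality, multiplied by the volume of the
surrounding cube. It is harmless once that volume is O(|Ω|). -/
theorem setGain_le_kappa (hs : 0 < s) (hsd : s < d) (hΩ : MeasurableSet Ω)
    (hm : volume Ω = m) (hL : 0 < L) {k : ℕ} (hk : 0 < k) (z : Fin d → ℤ)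
    (hsub : Ω ⊆ box (fun i => L * ((z i : ℝ) - k)) ((2 * k * L : ℕ) : ℝ)) {e : ℝ} (he : 0 ≤ e)
    (hth : volume (Metric.cthickening (d * L) (frontier Ω)) ≤ volume Ω * ENNReal.ofReal e) :
    (setGain s Ω).toReal
      ≤ ((kappa d s).toReal - (setGain s (box 0 L : Set (ℝ^ d))).toReal / (L : ℝ) ^ d)
          * (2 * k * L) ^ d
        + (setGain s (box 0 L : Set (ℝ^ d))).toReal / (L : ℝ) ^ d * (m * (1 + e)) := by
  have h := (setGain_add_le_kappa hs hsd hΩ hm hL hk z hsub).trans (add_le_add le_rfl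
    (mul_le_mul_right (add_le_add le_rfl hth) _))
  have hb : setGain s (box 0 L : Set (ℝ^ d)) ≠ ⊤ :=
    setGain_ne_top hs hsd (by rw [volume_box_nat]; exact ENNReal.natCast_ne_top _)
  have hG : setGain s Ω ≠ ⊤ :=
    setGain_ne_top hs hsd (by rw [hm]; exact ENNReal.natCast_ne_top _)
  have hκ := kappa_ne_top (d := d) hs hsd
  rw [hm] at h
  have h2 := ENNReal.toReal_mono (by finiteness) h
  rw [ENNReal.toReal_add (by finiteness) (by finiteness),
    ENNReal.toReal_add (by finiteness) (by finiteness)] at h2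
  simp only [ENNReal.toReal_mul, ENNReal.toReal_natCast] at h2
  rw [ENNReal.toReal_add (by finiteness) (by finiteness), ENNReal.toReal_mul,
    ENNReal.toReal_ofReal he] at h2
  push_cast at h2
  have hLd : (0 : ℝ) < (L : ℝ) ^ d := by positivity
  generalize (setGain s (box 0 L : Set (ℝ^ d))).toReal = b at h2 ⊢
  have e1 : b = b / (L : ℝ) ^ d * (L : ℝ) ^ d := by field_simp
  generalize b / (L : ℝ) ^ d = j at e1 ⊢
  subst e1
  refine le_of_mul_le_mul_left ?_ hLd
  simp only [ENNReal.toReal_natCast] at h2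
  linarith

end Bounds

/-- Every set of small diameter lies in a large grid cube. -/
theorem exists_subset_box {Ω : Set (ℝ^ d)} {R : ℝ} {x₀ : ℝ^ d} (hR : ∀ x ∈ Ω, dist x x₀ ≤ R)
    {L k : ℕ} (hL : 0 < L) (hk : R + L ≤ k * L) :
    ∃ z : Fin d → ℤ, Ω ⊆ box (fun i => L * ((z i : ℝ) - k)) ((2 * k * L : ℕ) : ℝ) := by
  have hL' : (0 : ℝ) < L := by exact_mod_cast hL
  refine ⟨fun i => ⌊x₀ i / L⌋, fun x hx i => ?_⟩
  have h1 : |x i - x₀ i| ≤ R := by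
    have := (PiLp.norm_apply_le (x - x₀) i).trans ((dist_eq_norm x x₀).symm.le.trans (hR x hx))
    simpa using this
  rw [abs_le] at h1
  have h2 := Int.floor_le (x₀ i / L)
  have h3 := Int.lt_floor_add_one (x₀ i / L)
  rw [le_div_iff₀ hL'] at h2
  rw [div_lt_iff₀ hL'] at h3
  push_cast
  constructor <;> nlinarith

/-- A single nearly optimal cube side L serves both bounds: pack such cubes into Ω, and pack them
around Ω in a large cube. The diameter bound keeps the large cube within a fixed multiple of |Ω|, so
the defect of optimality stays small per volume. -/
theorem tendsto_setGain {s : ℝ} (hs : 0 < s) (hsd : s < d) {t₀ : ℝ} {η : ℝ → ℝ}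
    {Ω : ℕ → Set (ℝ^ d)} {m : ℕ → ℕ} (ht₀ : 0 < t₀) (hη : ContinuousOn η (Ico 0 t₀))
    (hη0 : η 0 = 0) (hηpos : ∀ t ∈ Ico 0 t₀, 0 ≤ η t) (hΩo : ∀ N, IsOpen (Ω N))
    (hΩc : ∀ N, IsConnected (Ω N)) (hm : ∀ N, volume (Ω N) = m N)
    (hinf : Tendsto m atTop atTop) (hreg : ∀ N, HasRegularBoundary t₀ η (Ω N)) :
    Tendsto (fun N => (setGain s (Ω N)).toReal / m N) atTop (𝓝 (kappa d s).toReal) := by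
  have hd : 0 < d := by
    rcases Nat.eq_zero_or_pos d with rfl | h
    · simp at hsd; linarith
    · exact h
  have hd' : (0 : ℝ) < d := by exact_mod_cast hd
  obtain ⟨A, hA, hdiam⟩ := exists_dist_le_of_regular hd η (half_pos ht₀) (half_lt_self ht₀)
  set κ := (kappa d s).toReal with hκ
  have hκ0 : 0 ≤ κ := ENNReal.toReal_nonneg
  -- The surrounding cube has side 2kL ≤ 2Au + 4L ≤ (2A + 4)u with u = |Ω|^(1/d).
  set B := (2 * A + 4) ^ d with hB
  have hB0 : 0 < B := by positivity
  have hu : Tendsto (fun N => (m N : ℝ) ^ (1 / (d : ℝ))) atTop atTop :=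
    (tendsto_rpow_atTop (by positivity)).comp (tendsto_natCast_atTop_atTop.comp hinf)
  rw [Metric.tendsto_atTop']
  intro δ hδ
  -- The errors below add up to at most ε(1 + κ + B) = δ/2.
  set ε := δ / (2 * (1 + κ + B)) with hε
  have hεpos : 0 < ε := by positivity
  have hεδ : ε * (1 + κ + B) < δ := by
    rw [hε, div_mul_eq_mul_div, div_lt_iff₀ (by positivity)]
    nlinarith [mul_pos hδ (by positivity : 0 < 1 + κ + B)]
  obtain ⟨L, hL, hLκ⟩ := exists_box_gain (d := d) hs hsd hεpos
  have hLκ' := box_gain_le_kappa (d := d) hs hsd hL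
  set j := (setGain s (box 0 L : Set (ℝ^ d))).toReal / (L : ℝ) ^ d with hj
  have hj0 : 0 ≤ j := by positivity
  have hL' : (0 : ℝ) < L := by exact_mod_cast hL
  obtain ⟨t, ⟨htε, ht0, htt⟩⟩ : ∃ t, η t < ε ∧ 0 < t ∧ t < t₀ := by
    have h1 : Tendsto η (𝓝[>] 0) (𝓝 0) := by
      have := hη 0 ⟨le_rfl, ht₀⟩
      unfold ContinuousWithinAt at this
      rw [nhdsWithin_Ico_eq_nhdsGE ht₀, hη0] at this
      exact this.mono_left (nhdsWithin_mono _ Ioi_subset_Ici_self)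
    exact ((h1.eventually_lt_const hεpos).and (Ioo_mem_nhdsGT ht₀)).exists
  have he0 : 0 ≤ η t := hηpos t ⟨ht0.le, htt⟩
  have hev := (hu.eventually_ge_atTop (max (d * L / t) L)).and (hinf.eventually_ge_atTop 1)
  obtain ⟨N₀, hN₀⟩ := eventually_atTop.mp hev
  refine ⟨N₀, fun N hN => ?_⟩
  obtain ⟨huN, hm1⟩ := hN₀ N hN.le
  have hm0 : (0 : ℝ) < m N := by exact_mod_cast hm1
  have hvol : (volume (Ω N)).toReal = m N := by rw [hm]; simp
  set u := (m N : ℝ) ^ (1 / (d : ℝ)) with hudef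
  have hud : u ^ d = m N := by
    rw [hudef, ← Real.rpow_natCast, ← Real.rpow_mul hm0.le, one_div,
      inv_mul_cancel₀ hd'.ne', Real.rpow_one]
  -- Cubes of fixed side straddling the boundary eventually fit in the layer of relative width t.
  have hu1 : d * L ≤ u * t := by
    rw [← div_le_iff₀ ht0]; exact (le_max_left _ _).trans huN
  have hu2 : (L : ℝ) ≤ u := (le_max_right _ _).trans huN
  have hth : volume (Metric.cthickening (d * L) (frontier (Ω N)))
      ≤ volume (Ω N) * ENNReal.ofReal (η t) := by
    refine (measure_mono (Metric.cthickening_mono ?_ _)).trans (hreg N t ⟨ht0.le, htt⟩)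
    rw [hvol]
    exact hu1
  have hlow := box_gain_mul_le_setGain hs hsd (hΩo N).measurableSet (hm N) hL he0 hth
  obtain ⟨x₀, hx₀⟩ := (hΩc N).nonempty
  have hR : ∀ x ∈ Ω N, dist x x₀ ≤ A * u := fun x hx => by
    have := hdiam (Ω N) (hΩo N) (hΩc N) (by rw [hm]; exact ENNReal.natCast_ne_top _)
      (fun t ht => hreg N t ht) x hx x₀ hx₀
    rwa [hvol] at this
  have hupos : 0 < u := hL'.trans_le hu2
  set k := ⌈(A * u + L) / L⌉₊ with hk
  have hk1 : A * u + L ≤ k * L := by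
    rw [← div_le_iff₀ hL']; exact Nat.le_ceil _
  have hk0 : 0 < k := Nat.ceil_pos.mpr (by positivity)
  have hk2 : (k : ℝ) * L ≤ A * u + 2 * L := by
    have := (Nat.ceil_lt_add_one (a := (A * u + L) / L) (by positivity)).le
    calc (k : ℝ) * L ≤ ((A * u + L) / L + 1) * L := by gcongr
      _ = _ := by field_simp; ring
  obtain ⟨z, hz⟩ := exists_subset_box hR hL hk1
  have hupp := setGain_le_kappa hs hsd (hΩo N).measurableSet (hm N) hL hk0 z hz he0 hth
  rw [← hj] at hlow hupp
  have hkd : (2 * (k : ℝ) * L) ^ d ≤ B * m N := by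
    rw [hB, ← hud, ← mul_pow]
    refine pow_le_pow_left₀ (by positivity) ?_ d
    linarith
  rw [Real.dist_eq, abs_lt]
  constructor
  · have h1 : κ - δ < j * (1 - η t) := by
      have : j * η t ≤ κ * ε := by gcongr
      have : ε * (1 + κ) ≤ ε * (1 + κ + B) := mul_le_mul_of_nonneg_left (by linarith) hεpos.le
      linarith
    have h2 : j * (1 - η t) ≤ (setGain s (Ω N)).toReal / m N := by
      rw [le_div_iff₀ hm0]; linarith
    linarith
  · have h2 : (setGain s (Ω N)).toReal / m N ≤ (κ - j) * B + j * (1 + η t) := by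
      rw [div_le_iff₀ hm0]
      have : (κ - j) * (2 * (k : ℝ) * L) ^ d ≤ (κ - j) * (B * m N) :=
        mul_le_mul_of_nonneg_left hkd (by linarith)
      linarith
    have h3 : (κ - j) * B ≤ ε * B := by gcongr; linarith
    have h4 : j * (1 + η t) ≤ κ * (1 + ε) := by gcongr
    linarith

/-! ### Energies of densities in terms of the gain -/

theorem directEnergy_eq (s : ℝ) {ρ : (ℝ^ d) → ℝ≥0∞} (hρ : Measurable ρ)
    [SFinite (volume.withDensity ρ)] :
    directEnergy s ρ = selfEnergy s (volume.withDensity ρ) := by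
  unfold directEnergy selfEnergy mutualEnergy
  congr 1
  rw [lintegral_withDensity_eq_lintegral_mul _ hρ (measurable_potential s _)]
  refine lintegral_congr fun x => ?_
  rw [Pi.mul_apply, lintegral_withDensity_eq_lintegral_mul _ hρ (measurable_riesz_left s x),
    ← lintegral_const_mul _ (hρ.mul (measurable_riesz_left s x))]
  simp [mul_assoc]

theorem withDensity_indicator_const {Ω : Set (ℝ^ d)} (hΩ : MeasurableSet Ω) (c : ℝ≥0∞) :
    volume.withDensity (Ω.indicator fun _ => c) = c • volume.restrict Ω := by
  rw [withDensity_indicator hΩ, withDensity_const]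

theorem canonicalEnergy_eq {s : ℝ} {ρ : (ℝ^ d) → ℝ≥0∞} (hρ : Measurable ρ) {m : ℕ}
    (hm : volume.withDensity ρ univ = m) (hD : selfEnergy s (volume.withDensity ρ) ≠ ⊤) :
    canonicalEnergy s ρ = ((-(gain s (volume.withDensity ρ)).toReal : ℝ) : EReal) := by
  have hfin : IsFiniteMeasure (volume.withDensity ρ) :=
    ⟨by rw [hm]; exact ENNReal.natCast_lt_top m⟩
  have hF := minEnergy_le_selfEnergy s hm
  unfold canonicalEnergy
  rw [directEnergy_eq s hρ]
  change (minEnergy s (volume.withDensity ρ) : EReal) - _ = _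
  have hF' : minEnergy s (volume.withDensity ρ) ≠ ⊤ := ne_top_of_le_ne_top hD hF
  unfold gain
  rw [ENNReal.toReal_sub_of_le hF hD, neg_sub, EReal.coe_sub, EReal.coe_ennreal_toReal hF',
    EReal.coe_ennreal_toReal hD]

/-! ### Scaling -/

theorem riesz_smul (s : ℝ) {c : ℝ} (hc : 0 < c) (x y : ℝ^ d) :
    riesz s (c • x) (c • y) = ENNReal.ofReal c ^ (-s) * riesz s x y := by
  unfold riesz
  rw [edist_smul₀, ENNReal.smul_def, smul_eq_mul, ENNReal.mul_rpow_of_ne_top ENNReal.coe_ne_top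
    (edist_ne_top x y)]
  rw [← enorm_eq_nnnorm, Real.enorm_of_nonneg hc.le]

theorem volume_smul_set {c : ℝ} (hc : 0 < c) (Ω : Set (ℝ^ d)) :
    volume (c • Ω) = ENNReal.ofReal (c ^ d) * volume Ω := by
  rw [Measure.addHaar_smul, finrank_euclideanSpace_fin, abs_of_pos (pow_pos hc d)]

theorem map_smul_restrict {c : ℝ} (hc : 0 < c) (Ω : Set (ℝ^ d)) :
    (ENNReal.ofReal (c ^ d) • volume.restrict Ω).map (fun x : ℝ^ d => c • x)
      = volume.restrict (c • Ω) := by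
  set e : (ℝ^ d) ≃ᵐ (ℝ^ d) := (Homeomorph.smulOfNeZero c hc.ne').toMeasurableEquiv
  have he : (e : (ℝ^ d) → ℝ^ d) = fun x => c • x := rfl

  ext S hS
  rw [← he, Measure.map_apply e.measurable hS, Measure.smul_apply,
    Measure.restrict_apply (e.measurable hS), Measure.restrict_apply hS, smul_eq_mul,
    ← volume_smul_set hc]
  congr 1
  rw [smul_set_inter₀ hc.ne', he]
  congr 1
  exact image_preimage_eq S e.surjective

/-- Dilating by c turns density c^d on Ω into density one on cΩ and multiplies the interaction by
c^(-s). -/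
theorem gain_smul_restrict {s c : ℝ} (hc : 0 < c) {Ω : Set (ℝ^ d)} (hΩ : volume Ω ≠ ⊤) :
    gain s (ENNReal.ofReal (c ^ d) • volume.restrict Ω)
      = ENNReal.ofReal (c ^ s) * setGain s (c • Ω) := by
  have hfin : IsFiniteMeasure (volume.restrict Ω) := ⟨by simpa using hΩ.lt_top⟩
  have hfin' : IsFiniteMeasure (ENNReal.ofReal (c ^ d) • volume.restrict Ω) :=
    Measure.smul_finite _ ENNReal.ofReal_ne_top
  have hc0 : ENNReal.ofReal (c ^ (-s)) ≠ 0 := by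
    rw [Ne, ENNReal.ofReal_eq_zero, not_le]; positivity
  have h := gain_map (s := s) (Homeomorph.smulOfNeZero c hc.ne').toMeasurableEquiv
    hc0 ENNReal.ofReal_ne_top (fun x y => by
      rw [← ENNReal.ofReal_rpow_of_pos hc]; exact riesz_smul s hc x y)
    (ENNReal.ofReal (c ^ d) • volume.restrict Ω)
  have h' : Measure.map (fun x : ℝ^ d => c • x) (ENNReal.ofReal (c ^ d) • volume.restrict Ω)
    = Measure.map (Homeomorph.smulOfNeZero c hc.ne').toMeasurableEquiv
      (ENNReal.ofReal (c ^ d) • volume.restrict Ω) := rfl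
  rw [← h', map_smul_restrict hc] at h
  unfold setGain
  rw [h, ← mul_assoc, ← ENNReal.ofReal_mul (by positivity), ← Real.rpow_add hc, add_neg_cancel,
    Real.rpow_zero, ENNReal.ofReal_one, one_mul]

/-- The layer width is measured in units of |Ω|^(1/d), so the condition is scale invariant and the
same η works. -/
theorem HasRegularBoundary.smul {t₀ : ℝ} {η : ℝ → ℝ} {Ω : Set (ℝ^ d)} (hd : 0 < d)
    (h : HasRegularBoundary t₀ η Ω) {c : ℝ} (hc : 0 < c) :
    HasRegularBoundary t₀ η (c • Ω) := by
  intro t ht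
  have hvol : (volume (c • Ω)).toReal ^ (1 / (d : ℝ)) = c * (volume Ω).toReal ^ (1 / (d : ℝ)) := by
    rw [volume_smul_set hc, ENNReal.toReal_mul, ENNReal.toReal_ofReal (by positivity),
      Real.mul_rpow (by positivity) (by positivity), ← Real.rpow_natCast, ← Real.rpow_mul hc.le,
      mul_one_div_cancel (by exact_mod_cast hd.ne'), Real.rpow_one]
  have hfr : frontier (c • Ω) = c • frontier Ω :=
    ((Homeomorph.smulOfNeZero (α := ℝ^ d) c hc.ne').image_frontier Ω).symm
  rw [hvol, hfr]
  have hsub : Metric.cthickening (c * (volume Ω).toReal ^ (1 / (d : ℝ)) * t) (c • frontier Ω)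
      ⊆ c • Metric.cthickening ((volume Ω).toReal ^ (1 / (d : ℝ)) * t) (frontier Ω) := by
    intro y hy
    obtain ⟨x, rfl⟩ : ∃ x, c • x = y := ⟨c⁻¹ • y, smul_inv_smul₀ hc.ne' y⟩
    refine smul_mem_smul_set ?_
    rw [Metric.mem_cthickening_iff] at hy ⊢
    rw [infEDist_smul₀ hc.ne', ENNReal.smul_def, smul_eq_mul, ← enorm_eq_nnnorm,
      Real.enorm_of_nonneg hc.le, mul_assoc, ENNReal.ofReal_mul hc.le] at hy
    exact (ENNReal.mul_le_mul_iff_right (by simpa using hc) ENNReal.ofReal_ne_top).mp hy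
  calc _ ≤ _ := measure_mono hsub
    _ = ENNReal.ofReal (c ^ d) *
      volume (Metric.cthickening ((volume Ω).toReal ^ (1 / (d : ℝ)) * t) (frontier Ω)) :=
      volume_smul_set hc _
    _ ≤ ENNReal.ofReal (c ^ d) * (volume Ω * ENNReal.ofReal (η t)) := by gcongr; exact h t ht
    _ = _ := by rw [volume_smul_set hc, mul_assoc]

/-- Existence of the thermodynamic limit. -/
theorem isUEGEnergy_neg_kappa {s : ℝ} (hs : 0 < s) (hsd : s < d) :
    IsUEGEnergy d s (-(kappa d s).toReal) := by
  intro ρ₀ t₀ η Ω hρ₀ ht₀ hη hη0 hηpos hΩ hint hinf hreg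
  have hd : 0 < d := by
    rcases Nat.eq_zero_or_pos d with rfl | h
    · simp at hsd; linarith
    · exact h
  have hd' : (d : ℝ) ≠ 0 := by exact_mod_cast hd.ne'
  choose m hm using hint
  -- Dilation by this c brings the density to one. The gain contributes ρ₀^(s/d), and the change of
  -- volume one further factor ρ₀.
  set c := ρ₀ ^ (1 / (d : ℝ)) with hc
  have hcpos : 0 < c := by positivity
  have hcd : c ^ d = ρ₀ := by
    rw [hc, ← Real.rpow_natCast, ← Real.rpow_mul hρ₀.le, one_div_mul_cancel hd', Real.rpow_one]
  have hcs : c ^ s = ρ₀ ^ (s / d) := by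
    rw [hc, ← Real.rpow_mul hρ₀.le]; congr 1; field_simp
  have hm' : ∀ N, volume (c • Ω N) = m N := fun N => by
    rw [volume_smul_set hcpos, hcd, hm]
  have hvfin : ∀ N, volume (Ω N) ≠ ⊤ := fun N => (hΩ N).2.2.measure_lt_top.ne
  have hv : ∀ N, (volume (Ω N)).toReal = m N / ρ₀ := fun N => by
    have := congrArg ENNReal.toReal (hm N)
    rw [ENNReal.toReal_mul, ENNReal.toReal_ofReal hρ₀.le, ENNReal.toReal_natCast] at this
    rw [← this]; field_simp
  have hminf : Tendsto m atTop atTop := by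
    have h1 : Tendsto (fun N => (m N : ℝ≥0∞)) atTop (𝓝 ⊤) := by
      have := ENNReal.Tendsto.const_mul (a := ENNReal.ofReal ρ₀) hinf
        (Or.inl ENNReal.top_ne_zero)
      rw [ENNReal.mul_top (by simpa using hρ₀)] at this
      simpa only [hm] using this
    rw [ENNReal.tendsto_nhds_top_iff_nat] at h1
    exact tendsto_atTop.mpr fun n => (h1 n).mono fun N hN => by exact_mod_cast hN.le
  have hlim := tendsto_setGain (Ω := fun N => c • Ω N) hs hsd ht₀ hη hη0 hηpos
    (fun N => (hΩ N).1.smul₀ hcpos.ne')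
    (fun N => ((hΩ N).2.1).image _ (continuous_const_smul c).continuousOn) hm' hminf
    (fun N => (hreg N).smul hd hcpos)
  have hE : ∀ N, canonicalEnergy s ((Ω N).indicator fun _ => ENNReal.ofReal ρ₀)
      / (volume (Ω N) : EReal)
      = ((-(ρ₀ ^ (1 + s / d) * ((setGain s (c • Ω N)).toReal / m N)) : ℝ) : EReal) := by
    intro N
    have hmeas := (hΩ N).1.measurableSet
    have hdens := withDensity_indicator_const hmeas (ENNReal.ofReal ρ₀)
    have hfin : IsFiniteMeasure (volume.restrict (Ω N)) := ⟨by simpa using (hvfin N).lt_top⟩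
    rw [canonicalEnergy_eq (m := m N) (measurable_const.indicator hmeas)
      (by rw [hdens]; simp [hm]) (by
        rw [hdens, selfEnergy_smul]
        exact ENNReal.mul_ne_top (by finiteness) (selfEnergy_restrict_ne_top hs hsd (hvfin N))),
      hdens, ← hcd, gain_smul_restrict hcpos (hvfin N), ← EReal.coe_ennreal_toReal (hvfin N),
      ← EReal.coe_div, hv, ENNReal.toReal_mul, ENNReal.toReal_ofReal (by positivity), hcd, hcs,
      Real.rpow_add hρ₀, Real.rpow_one]
    congr 1
    field_simp
  simp_rw [hE]
  have := (hlim.const_mul (ρ₀ ^ (1 + s / d))).neg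
  rw [← mul_neg] at this
  exact (continuous_coe_real_ereal.tendsto _).comp this

/-! ### Uniqueness of the energy of the uniform gas -/

/-- The neighbourhood of a sphere lies in a shell whose volume is explicit. The bound t < 1/c keeps
the inner radius positive, c being the ratio of |B_R|^(1/d) to R. All balls share one η. -/
theorem hasRegularBoundary_ball (hd : 0 < d) {R : ℝ} (hR : 0 < R) {c : ℝ}
    (hc : c = (volume (Metric.ball (0 : ℝ^ d) 1)).toReal ^ (1 / (d : ℝ))) :
    HasRegularBoundary (1 / c) (fun t => (1 + c * t) ^ d - (1 - c * t) ^ d)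
      (Metric.ball (0 : ℝ^ d) R) := by
  have hω : 0 < volume (Metric.ball (0 : ℝ^ d) 1) := Metric.measure_ball_pos _ _ one_pos
  have hω' : volume (Metric.ball (0 : ℝ^ d) 1) ≠ ⊤ := measure_ball_lt_top.ne
  have hωpos : 0 < (volume (Metric.ball (0 : ℝ^ d) 1)).toReal := ENNReal.toReal_pos hω.ne' hω'
  have hcpos : 0 < c := by rw [hc]; positivity
  intro t ht
  have hct : c * t < 1 := by
    have := ht.2
    rw [lt_div_iff₀ hcpos] at this
    linarith
  have hct0 : 0 ≤ c * t := mul_nonneg hcpos.le ht.1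
  have hball : ∀ r : ℝ, 0 < r → volume (Metric.ball (0 : ℝ^ d) r)
      = ENNReal.ofReal (r ^ d) * volume (Metric.ball (0 : ℝ^ d) 1) := fun r hr => by
    rw [Measure.addHaar_ball_of_pos volume _ hr, finrank_euclideanSpace_fin]
  have hv : (volume (Metric.ball (0 : ℝ^ d) R)).toReal ^ (1 / (d : ℝ)) = R * c := by
    rw [hball R hR, ENNReal.toReal_mul, ENNReal.toReal_ofReal (by positivity),
      Real.mul_rpow (by positivity) hωpos.le, ← hc, ← Real.rpow_natCast, ← Real.rpow_mul hR.le,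
      mul_one_div_cancel (by exact_mod_cast hd.ne'), Real.rpow_one]
  rw [hv]
  set δ := R * c * t with hδ
  have hδ0 : 0 ≤ δ := by rw [hδ, mul_assoc]; positivity
  have hδR : δ < R := by rw [hδ, mul_assoc]; nlinarith
  have hsub : Metric.cthickening δ (frontier (Metric.ball (0 : ℝ^ d) R))
      ⊆ Metric.closedBall 0 (R + δ) \ Metric.ball 0 (R - δ) := by
    have h1 : frontier (Metric.ball (0 : ℝ^ d) R) = Metric.sphere 0 R := frontier_ball _ hR.ne'
    rw [h1, (isCompact_sphere (0 : ℝ^ d) R).cthickening_eq_biUnion_closedBall hδ0]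
    intro z hz
    obtain ⟨y, hy, hzy⟩ := mem_iUnion₂.mp hz
    rw [Metric.mem_closedBall] at hzy
    rw [mem_sphere_zero_iff_norm] at hy
    rw [dist_eq_norm] at hzy
    have h2 := norm_sub_norm_le y z
    have h3 := norm_sub_norm_le z y
    rw [norm_sub_rev] at h2
    refine ⟨?_, ?_⟩
    · rw [mem_closedBall_zero_iff]; linarith
    · rw [mem_ball_zero_iff, not_lt]; linarith
  refine (measure_mono hsub).trans ?_
  have hin : Metric.ball (0 : ℝ^ d) (R - δ) ⊆ Metric.closedBall 0 (R + δ) :=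
    Metric.ball_subset_closedBall.trans (Metric.closedBall_subset_closedBall (by linarith))
  rw [measure_sdiff hin measurableSet_ball.nullMeasurableSet measure_ball_lt_top.ne,
    Measure.addHaar_closedBall volume _ (by linarith), finrank_euclideanSpace_fin,
    hball (R - δ) (by linarith), hball R hR, ← ENNReal.sub_mul (fun _ _ => hω'),
    ← ENNReal.ofReal_sub _ (by apply pow_nonneg; linarith), mul_right_comm,
    ← ENNReal.ofReal_mul (by positivity)]
  refine le_of_eq ?_
  congr 2
  rw [mul_sub, ← mul_pow, ← mul_pow, hδ]
  ring_nf

/-- The balls of volume N + 1 at density one are admissible, so both numbers are the limit of the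
same sequence. -/
theorem IsUEGEnergy.unique {s e e' : ℝ} (hd : 0 < d) (h : IsUEGEnergy d s e)
    (h' : IsUEGEnergy d s e') : e = e' := by
  have hd' : (d : ℝ) ≠ 0 := by exact_mod_cast hd.ne'
  have hω : 0 < volume (Metric.ball (0 : ℝ^ d) 1) := Metric.measure_ball_pos _ _ one_pos
  have hω' : volume (Metric.ball (0 : ℝ^ d) 1) ≠ ⊤ := measure_ball_lt_top.ne
  set ω := (volume (Metric.ball (0 : ℝ^ d) 1)).toReal with hωdef
  have hωpos : 0 < ω := ENNReal.toReal_pos hω.ne' hω'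
  set c := ω ^ (1 / (d : ℝ)) with hc
  have hcpos : 0 < c := by positivity
  set R : ℕ → ℝ := fun N => (((N : ℝ) + 1) / ω) ^ (1 / (d : ℝ)) with hRdef
  have hR : ∀ N, 0 < R N := fun N => by positivity
  have hvol : ∀ N, volume (Metric.ball (0 : ℝ^ d) (R N)) = ((N + 1 : ℕ) : ℝ≥0∞) := fun N => by
    rw [Measure.addHaar_ball_of_pos volume _ (hR N), finrank_euclideanSpace_fin,
      ← ENNReal.ofReal_toReal hω', ← hωdef, ← ENNReal.ofReal_mul (by positivity),
      ← ENNReal.ofReal_natCast]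
    congr 1
    simp only [hRdef]
    rw [← Real.rpow_natCast, ← Real.rpow_mul (by positivity), one_div_mul_cancel hd', Real.rpow_one]
    push_cast
    field_simp
  have key : ∀ {e : ℝ}, IsUEGEnergy d s e → Tendsto (fun N => canonicalEnergy s
      ((Metric.ball (0 : ℝ^ d) (R N)).indicator fun _ => ENNReal.ofReal 1)
        / (volume (Metric.ball (0 : ℝ^ d) (R N)) : EReal)) atTop (𝓝 (e : EReal)) := by
    intro e he
    have := he 1 (1 / c) (fun t => (1 + c * t) ^ d - (1 - c * t) ^ d)
      (fun N => Metric.ball (0 : ℝ^ d) (R N)) one_pos (by positivity)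
      (by fun_prop) (by simp) (fun t ht => ?_)
      (fun N => ⟨Metric.isOpen_ball, ?_, Metric.isBounded_ball⟩)
      (fun N => ⟨N + 1, by rw [hvol]; simp⟩) ?_ (fun N => hasRegularBoundary_ball hd (hR N) hc)
    · simpa using this
    · have h1 : c * t < 1 := by
        have := ht.2
        rw [lt_div_iff₀ hcpos] at this
        linarith
      have h2 : 0 ≤ c * t := mul_nonneg hcpos.le ht.1
      rw [sub_nonneg]
      exact pow_le_pow_left₀ (by linarith) (by linarith) d
    · exact (convex_ball (0 : ℝ^ d) (R N)).isConnected ⟨0, Metric.mem_ball_self (hR N)⟩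
    · simp_rw [hvol]
      exact ENNReal.tendsto_nat_nhds_top.comp (tendsto_add_atTop_nat 1)
  exact EReal.coe_injective (tendsto_nhds_unique (key h) (key h'))

/-! ### Geometry of tilings -/

theorem measurePreserving_affineIsometryEquiv (g : (ℝ^ d) ≃ᵃⁱ[ℝ] (ℝ^ d)) :
    MeasurePreserving g (volume : Measure (ℝ^ d)) volume := by
  have h : (g : (ℝ^ d) → ℝ^ d) = (fun x => x + g 0) ∘ g.linearIsometryEquiv := by
    ext1 x
    have := g.map_vadd 0 x
    simpa using this
  rw [h]
  exact (measurePreserving_add_right volume (g 0)).comp g.linearIsometryEquiv.measurePreserving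

theorem map_restrict_affineIsometryEquiv (g : (ℝ^ d) ≃ᵃⁱ[ℝ] (ℝ^ d)) (A : Set (ℝ^ d)) :
    (volume.restrict A).map g = volume.restrict (g '' A) :=
  ((measurePreserving_affineIsometryEquiv g).restrict_image_emb
    g.toHomeomorph.measurableEmbedding A).map_eq

theorem volume_image_affineIsometryEquiv (g : (ℝ^ d) ≃ᵃⁱ[ℝ] (ℝ^ d)) (A : Set (ℝ^ d)) :
    volume (g '' A) = volume A := by
  have := congrArg (fun μ : Measure (ℝ^ d) => μ univ) (map_restrict_affineIsometryEquiv g A)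
  simp only [Measure.restrict_apply_univ] at this
  rw [← this, Measure.map_apply g.continuous.measurable MeasurableSet.univ]
  simp

theorem IsConvexPolyhedron.convex {Ω : Set (ℝ^ d)} (h : IsConvexPolyhedron Ω) : Convex ℝ Ω := by
  obtain ⟨-, F, -, rfl⟩ := h
  exact (convex_convexHull ℝ F).interior

theorem IsConvexPolyhedron.isOpen {Ω : Set (ℝ^ d)} (h : IsConvexPolyhedron Ω) : IsOpen Ω := by
  obtain ⟨-, F, -, rfl⟩ := h
  exact isOpen_interior

theorem IsConvexPolyhedron.isBounded {Ω : Set (ℝ^ d)} (h : IsConvexPolyhedron Ω) :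
    Bornology.IsBounded Ω := by
  obtain ⟨-, F, hF, rfl⟩ := h
  exact (isBounded_convexHull.mpr hF.isBounded).subset interior_subset

/-- The tiles inside a large cube almost exhaust its volume. -/
theorem exists_finset_tiles {Ω : Set (ℝ^ d)} (hΩ : IsConvexPolyhedron Ω) (ht : TilesSpace Ω) :
    ∃ R : ℝ, ∀ L : ℕ, ∃ T : Finset ((ℝ^ d) ≃ᵃⁱ[ℝ] (ℝ^ d)),
      (T : Set ((ℝ^ d) ≃ᵃⁱ[ℝ] (ℝ^ d))).PairwiseDisjoint (fun g => g '' Ω) ∧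
      (∀ g ∈ T, g '' Ω ⊆ box 0 L) ∧ ENNReal.ofReal (L - 2 * R) ^ d ≤ T.card * volume Ω := by
  obtain ⟨Γ, hcov, hdisj⟩ := ht
  have hpos : 0 < volume Ω := hΩ.isOpen.measure_pos volume hΩ.1
  -- The frontier of a convex set is null, so the closed tiles of the covering have the volume of
  -- the open disjoint ones.
  have hcl : volume (closure Ω) = volume Ω := by
    refine le_antisymm ?_ (measure_mono subset_closure)
    rw [closure_eq_self_union_frontier]
    refine (measure_union_le _ _).trans ?_
    rw [hΩ.convex.addHaar_frontier volume, add_zero]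
  set R := Metric.diam (closure Ω) + 1 with hR
  refine ⟨R, fun L => ?_⟩
  set G : Set ((ℝ^ d) ≃ᵃⁱ[ℝ] (ℝ^ d)) := {g ∈ Γ | g '' Ω ⊆ box 0 L} with hG
  have hGfin : G.Finite := by
    have h := Measure.finite_const_le_meas_of_disjoint_iUnion (volume : Measure (ℝ^ d))
      hpos (As := fun g : G => (g : (ℝ^ d) ≃ᵃⁱ[ℝ] (ℝ^ d)) '' Ω)
      (fun g => (g.1.toHomeomorph.isOpenMap _ hΩ.isOpen).measurableSet)
      (fun g g' hgg => hdisj g.2.1 g'.2.1 fun h => hgg (Subtype.ext h))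
      (ne_top_of_le_ne_top (by rw [volume_box_nat]; exact ENNReal.natCast_ne_top _)
        (measure_mono (iUnion_subset fun g => g.2.2)))
    have huniv : {g : G | volume Ω ≤ volume ((g : (ℝ^ d) ≃ᵃⁱ[ℝ] (ℝ^ d)) '' Ω)} = univ :=
      eq_univ_of_forall fun g => (volume_image_affineIsometryEquiv g.1 Ω).ge
    rw [huniv] at h
    exact Set.finite_coe_iff.mp (Set.finite_univ_iff.mp h)
  refine ⟨hGfin.toFinset, ?_, ?_, ?_⟩
  · rw [hGfin.coe_toFinset]
    exact hdisj.subset fun g hg => hg.1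
  · intro g hg
    exact ((hGfin.mem_toFinset).mp hg).2
  · rw [← volume_box (fun _ => R)]
    -- A closed tile through a point at depth R inside the cube cannot reach its faces, since R
    -- exceeds the diameter of the tile.
    have hsub : (box (fun _ => R) (L - 2 * R) : Set (ℝ^ d))
        ⊆ ⋃ g ∈ hGfin.toFinset, g '' closure Ω := by
      intro x hx
      have hxu : x ∈ ⋃ g ∈ Γ, g '' closure Ω := by rw [hcov]; trivial
      obtain ⟨g, hg, y, hy, hyx⟩ := mem_iUnion₂.mp hxu
      refine mem_iUnion₂.mpr ⟨g, ?_, ⟨y, hy, hyx⟩⟩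
      rw [hGfin.mem_toFinset]
      refine ⟨hg, ?_⟩
      rintro _ ⟨w, hw, rfl⟩ i
      have h1 : dist (g w) x ≤ Metric.diam (closure Ω) := by
        rw [← hyx, g.dist_map]
        exact Metric.dist_le_diam_of_mem hΩ.isBounded.closure (subset_closure hw) hy
      have h2 : |g w i - x i| ≤ Metric.diam (closure Ω) := by
        have := (PiLp.norm_apply_le (g w - x) i).trans
          ((dist_eq_norm (g w) x).symm.le.trans h1)
        simpa using this
      rw [abs_le] at h2
      have h3 := hx i
      simp only [Pi.zero_apply]
      constructor <;> linarith [h2.1, h2.2, h3.1, h3.2]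
    refine (measure_mono hsub).trans ((measure_biUnion_finset_le _ _).trans (le_of_eq ?_))
    simp [volume_image_affineIsometryEquiv, hcl]

/-! ### The canonical state built from many tiles -/

/-- The permuted state is canonical with density below that of the full cube, so its minimal energy
is at least its direct energy minus κ L^d. Against the upper bound of `minEnergy_permute_le` the
direct energies cancel, up to the 1/k correction, and the self-energies of the tiles remain. -/
theorem mul_selfEnergy_le_of_tiles {s : ℝ} (hs : 0 < s) (hsd : s < d) {Ω : Set (ℝ^ d)}
    (hΩ : MeasurableSet Ω) {U : Type*} [Fintype U] [DecidableEq U] {k L : ℕ}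
    (hk : k ≠ 0) (hL : 0 < L) (hU : Fintype.card U = k + 1) {g : U → (ℝ^ d) ≃ᵃⁱ[ℝ] (ℝ^ d)}
    (hg : Pairwise fun u u' => Disjoint (g u '' Ω) (g u' '' Ω))
    (hgL : ∀ u, g u '' Ω ⊆ box 0 L)
    {n : U → ℕ} {μ : U → Measure (ℝ^ d)} {c : U → ℝ≥0∞} (h : ∀ u, HasState s (n u) (μ u) (c u))
    (hle : ((k + 1 : ℕ) : ℝ≥0∞)⁻¹ • ∑ u, μ u ≤ volume.restrict Ω) :
    ((k + 1 : ℕ) : ℝ≥0∞) * selfEnergy s (((k + 1 : ℕ) : ℝ≥0∞)⁻¹ • ∑ u, μ u)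
      ≤ ∑ u, c u + kappa d s * ((L ^ d : ℕ) : ℝ≥0∞)
        + (k : ℝ≥0∞)⁻¹ * selfEnergy s (volume.restrict (box 0 L : Set (ℝ^ d))) := by
  have hgi : ∀ u, Isometry (g u) := fun u => (g u).isometry
  have hmain := minEnergy_permute_le hk hU h hgi
  have hstate := HasState.permute hk hU h hgi fun t => rfl
  set ρ := ((k + 1 : ℕ) : ℝ≥0∞)⁻¹ • ∑ u, μ u with hρ
  set ν := ∑ u, ρ.map (g u) with hν
  have hmass := hstate.measure_univ
  have hfin := hstate.isFiniteMeasure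
  set Q : Set (ℝ^ d) := box 0 L with hQ
  have hQfin : volume Q ≠ ⊤ := by rw [hQ, volume_box_nat]; exact ENNReal.natCast_ne_top _
  have hνle : ν ≤ volume.restrict Q := by
    have h1 : ν ≤ ∑ u, volume.restrict (g u '' Ω) := by
      refine Finset.sum_le_sum fun u _ => ?_
      rw [← map_restrict_affineIsometryEquiv]
      exact Measure.map_mono hle (g u).continuous.measurable
    refine h1.trans ?_
    rw [← Measure.sum_fintype, ← Measure.restrict_iUnion hg
      fun u => (g u).toHomeomorph.measurableEmbedding.measurableSet_image.mpr hΩ]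
    exact Measure.restrict_mono (iUnion_subset hgL) le_rfl
  have hDQ := selfEnergy_restrict_ne_top hs hsd hQfin
  have hDν : selfEnergy s ν ≤ selfEnergy s (volume.restrict Q) := selfEnergy_mono s hνle
  have hFν : minEnergy s ν ≠ ⊤ :=
    ne_top_of_le_ne_top (ne_top_of_le_ne_top hDQ hDν) (minEnergy_le_selfEnergy s hmass)
  -- `ν` is not uniform, but the missing density `volume.restrict Q - ν` has integer mass and
  -- nonnegative gain, so `ν` gains no more than the full cube.
  have hgain : gain s ν ≤ kappa d s * ((L ^ d : ℕ) : ℝ≥0∞) := by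
    have hsplit := Measure.sub_add_cancel_of_le hνle
    rw [add_comm] at hsplit
    obtain ⟨m, hm⟩ := natCast_sub_of_add_eq hmass (m := L ^ d)
      (b := (volume.restrict Q - ν) univ) (by
        rw [← Measure.add_apply, hsplit, Measure.restrict_apply_univ, hQ, volume_box_nat])
    have := gain_add_le hmass hm (s := s) (by rw [hsplit]; exact hDQ)
    rw [hsplit] at this
    exact (le_self_add.trans this).trans (setGain_box_le s hL 0)
  have hsum : minEnergy s ν + ((k + 1 : ℕ) : ℝ≥0∞) * selfEnergy s ρ ≤ minEnergy s ν +
      (∑ u, c u + kappa d s * ((L ^ d : ℕ) : ℝ≥0∞)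
        + (k : ℝ≥0∞)⁻¹ * selfEnergy s (volume.restrict Q)) := by
    calc _ ≤ ∑ u, c u + (1 + (k : ℝ≥0∞)⁻¹) * selfEnergy s ν := hmain
      _ = ∑ u, c u + selfEnergy s ν + (k : ℝ≥0∞)⁻¹ * selfEnergy s ν := by ring
      _ ≤ ∑ u, c u + (minEnergy s ν + gain s ν)
          + (k : ℝ≥0∞)⁻¹ * selfEnergy s (volume.restrict Q) := by
          gcongr
          exact le_add_tsub
      _ ≤ ∑ u, c u + (minEnergy s ν + kappa d s * ((L ^ d : ℕ) : ℝ≥0∞))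
          + (k : ℝ≥0∞)⁻¹ * selfEnergy s (volume.restrict Q) := by gcongr
      _ = _ := by ring
  exact (ENNReal.add_le_add_iff_left hFν).mp hsum

/-- The direct energy of a countable sum is the limit of those of the partial sums. -/
theorem selfEnergy_sum_le {s : ℝ} {μ : ℕ → Measure (ℝ^ d)} (hμ : ∀ n, SFinite (μ n)) {X : ℝ≥0∞}
    (h : ∀ K, selfEnergy s (∑ n ∈ Finset.range K, μ n) ≤ X) :
    selfEnergy s (Measure.sum μ) ≤ X := by
  have e1 : mutualEnergy s (Measure.sum μ) (Measure.sum μ)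
      = ∑' n, ∑' n', mutualEnergy s (μ n) (μ n') := by
    unfold mutualEnergy
    simp_rw [lintegral_sum_measure]
    exact tsum_congr fun n => lintegral_tsum fun n' => (measurable_potential s _).aemeasurable
  unfold selfEnergy
  rw [e1, ← ENNReal.tsum_mul_left]
  refine ENNReal.tsum_le_of_sum_range_le fun K => ?_
  simp_rw [← ENNReal.tsum_mul_left]
  rw [← Summable.tsum_finsetSum fun _ _ => ENNReal.summable]
  refine ENNReal.tsum_le_of_sum_range_le fun K' => ?_
  -- The rectangle K × K' sits in a square, and all terms are nonnegative.
  refine le_trans ?_ (h (max K K'))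
  unfold selfEnergy
  rw [mutualEnergy_finset_sum_left, Finset.mul_sum, Finset.sum_comm]
  simp_rw [mutualEnergy_finset_sum_right s _ _ _ hμ, Finset.mul_sum]
  calc _ ≤ ∑ n ∈ Finset.range K, ∑ n' ∈ Finset.range (max K K'),
        2⁻¹ * mutualEnergy s (μ n) (μ n') := by
        gcongr; exact le_max_right _ _
    _ ≤ _ := by
        gcongr; exact le_max_left _ _

/-! ### Large cubes: number of tiles and direct energy -/

theorem eventually_pow_le_card {R : ℝ} {m : ℕ} {M : ℕ → ℕ}
    (h : ∀ L : ℕ, ENNReal.ofReal (L - 2 * R) ^ d ≤ M L * (m : ℝ≥0∞)) {θ : ℝ} (hθ : 0 < θ) :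
    ∀ᶠ L : ℕ in atTop, (L : ℝ) ^ d ≤ (1 + θ) * (m * M L) := by
  have h1 : Tendsto (fun L : ℕ => (1 + θ) * (1 - 2 * R / L) ^ d) atTop (𝓝 ((1 + θ) * (1 - 0) ^ d)) :=
    ((tendsto_const_nhds.sub (tendsto_const_div_atTop_nhds_zero_nat (2 * R))).pow d).const_mul _
  have h2 : (1 : ℝ) < (1 + θ) * (1 - 0) ^ d := by simp [hθ]
  filter_upwards [h1.eventually_const_lt h2, eventually_gt_atTop 0,
    (tendsto_natCast_atTop_atTop (R := ℝ)).eventually_ge_atTop (2 * R)] with L hL1 hL2 hL3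
  have hL0 : (0 : ℝ) < L := by exact_mod_cast hL2
  have h3 : ((L : ℝ) - 2 * R) ^ d ≤ m * M L := by
    have := ENNReal.toReal_mono (by finiteness) (h L)
    rw [ENNReal.toReal_pow, ENNReal.toReal_ofReal (by linarith)] at this
    simp only [ENNReal.toReal_mul, ENNReal.toReal_natCast] at this
    linarith
  calc (L : ℝ) ^ d = 1 * (L : ℝ) ^ d := (one_mul _).symm
    _ ≤ (1 + θ) * (1 - 2 * R / L) ^ d * (L : ℝ) ^ d := by gcongr
    _ = (1 + θ) * ((L : ℝ) - 2 * R) ^ d := by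
      rw [mul_assoc, ← mul_pow]; congr 2; field_simp
    _ ≤ _ := by gcongr

theorem tendsto_card {R : ℝ} {m : ℕ} (hd : 0 < d) {M : ℕ → ℕ}
    (h : ∀ L : ℕ, ENNReal.ofReal (L - 2 * R) ^ d ≤ M L * (m : ℝ≥0∞)) : Tendsto M atTop atTop := by
  have h1 : Tendsto (fun L : ℕ => (2 * m : ℝ) * M L) atTop atTop := by
    refine tendsto_atTop_mono' _ ?_ (tendsto_natCast_atTop_atTop (R := ℝ))
    filter_upwards [eventually_pow_le_card h one_pos, eventually_ge_atTop 1] with L hL hL1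
    have h2 : (1 : ℝ) ≤ L := by exact_mod_cast hL1
    have h3 : (L : ℝ) ≤ (L : ℝ) ^ d := le_self_pow₀ h2 hd.ne'
    linarith
  refine (tendsto_natCast_atTop_iff (R := ℝ)).mp ?_
  refine tendsto_atTop.mpr fun b => ?_
  filter_upwards [h1.eventually_ge_atTop (2 * m * b), h1.eventually_gt_atTop 0] with L hL hL0
  have hm0 : (0 : ℝ) < 2 * m := by
    rcases Nat.eq_zero_or_pos m with rfl | hm
    · simp at hL0
    · positivity
  exact le_of_mul_le_mul_left hL hm0

/-- The direct energy of the cube is o(L^{2d}), while the number of tiles is of order L^d. The form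
θ(M - 1)M is chosen because it will be divided by k = M - 1 and then by M. -/
theorem eventually_selfEnergy_box_le {s : ℝ} (hs : 0 < s) (hsd : s < d) {R : ℝ} {m : ℕ}
    (hm : 0 < m) {M : ℕ → ℕ}
    (h : ∀ L : ℕ, ENNReal.ofReal (L - 2 * R) ^ d ≤ M L * (m : ℝ≥0∞)) {θ : ℝ} (hθ : 0 < θ) :
    ∀ᶠ L : ℕ in atTop, selfEnergy s (volume.restrict (box 0 L : Set (ℝ^ d)))
      ≤ ENNReal.ofReal (θ * ((M L - 1) * M L)) := by
  have hd : 0 < d := by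
    rcases Nat.eq_zero_or_pos d with rfl | h
    · simp at hsd; linarith
    · exact h
  have hm' : (0 : ℝ) < m := by exact_mod_cast hm
  -- With L^d ≤ 2mM the quadratic term becomes θM²/4. The linear term is made at most as large, and
  -- θM²/2 ≤ θ(M - 1)M for M ≥ 2.
  have hε : 0 < θ / (16 * (m : ℝ) ^ 2) := by positivity
  obtain ⟨C, hC, hCle⟩ := selfEnergy_le (d := d) hs hsd
    (ε := ENNReal.ofReal (θ / (16 * (m : ℝ) ^ 2))) (by simpa using hε)
  filter_upwards [eventually_pow_le_card h one_pos, (tendsto_card hd h).eventually_ge_atTop 2,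
    ((tendsto_natCast_atTop_atTop (R := ℝ)).comp (tendsto_card hd h)).eventually_ge_atTop
      (8 * m * C.toReal / θ)] with L hL hM2 hMC
  have h1 := hCle (volume.restrict (box 0 L : Set (ℝ^ d))) inferInstance Measure.restrict_le_self
  rw [Measure.restrict_apply_univ, volume_box_nat] at h1
  refine h1.trans ?_
  have e : ENNReal.ofReal (θ / (16 * (m : ℝ) ^ 2)) * ((L ^ d : ℕ) : ℝ≥0∞) ^ 2
      + C * ((L ^ d : ℕ) : ℝ≥0∞) = ENNReal.ofReal (θ / (16 * (m : ℝ) ^ 2) * ((L : ℝ) ^ d) ^ 2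
      + C.toReal * (L : ℝ) ^ d) := by
    have hx : ENNReal.ofReal ((L : ℝ) ^ d) = ((L ^ d : ℕ) : ℝ≥0∞) := by
      rw [← Nat.cast_pow, ENNReal.ofReal_natCast]
    rw [ENNReal.ofReal_add (by positivity) (by positivity), ENNReal.ofReal_mul hε.le,
      ENNReal.ofReal_mul ENNReal.toReal_nonneg, ENNReal.ofReal_toReal hC,
      ENNReal.ofReal_pow (by positivity), hx]
  rw [e]
  refine ENNReal.ofReal_le_ofReal ?_
  have hM2' : (2 : ℝ) ≤ M L := by exact_mod_cast hM2
  have hMC' : 8 * m * C.toReal ≤ θ * M L := by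
    rw [Function.comp_apply, div_le_iff₀ hθ] at hMC
    linarith
  have hX : (L : ℝ) ^ d ≤ 2 * m * M L := by linarith
  have hM0 : (0 : ℝ) ≤ M L := by positivity
  calc θ / (16 * (m : ℝ) ^ 2) * ((L : ℝ) ^ d) ^ 2 + C.toReal * (L : ℝ) ^ d
      ≤ θ / (16 * (m : ℝ) ^ 2) * (2 * m * M L) ^ 2 + C.toReal * (2 * m * M L) := by gcongr
    _ = θ * (M L * M L) / 4 + (8 * m * C.toReal) * M L / 4 := by field_simp; ring
    _ ≤ θ * (M L * M L) / 4 + (θ * M L) * M L / 4 := by gcongr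
    _ = θ * (M L / 2 * M L) := by ring
    _ ≤ _ := by gcongr; linarith

/-- Rounding loses at most one unit, which is below θwM once M is large; w = 0 is trivial. -/
theorem eventually_le_floor_div (w : ℝ≥0∞) (hw : w ≠ ⊤) {θ : ℝ} (hθ : 0 < θ) :
    ∀ᶠ M : ℕ in atTop, ENNReal.ofReal (1 - θ) * w
      ≤ (M : ℝ≥0∞)⁻¹ * (⌊M * w.toReal⌋₊ : ℝ≥0∞) := by
  rcases eq_or_ne w 0 with rfl | hw0
  · simp
  have hwpos : 0 < w.toReal := ENNReal.toReal_pos hw0 hw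
  filter_upwards [(tendsto_natCast_atTop_atTop (R := ℝ)).eventually_ge_atTop (1 / (θ * w.toReal)),
    eventually_gt_atTop 0] with M hM hM0
  have hM0' : (0 : ℝ) < M := by exact_mod_cast hM0
  rw [div_le_iff₀ (by positivity)] at hM
  rw [mul_comm (M : ℝ≥0∞)⁻¹, ← div_eq_mul_inv, ENNReal.le_div_iff_mul_le
    (Or.inl (by exact_mod_cast hM0.ne')) (Or.inl (ENNReal.natCast_ne_top M))]
  nth_rewrite 1 [← ENNReal.ofReal_toReal hw]
  rw [← ENNReal.ofReal_mul' hwpos.le, ← ENNReal.ofReal_natCast M, ← ENNReal.ofReal_mul' hM0'.le,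
    ← ENNReal.ofReal_natCast]
  refine ENNReal.ofReal_le_ofReal ?_
  have := (Nat.lt_floor_add_one (M * w.toReal)).le
  nlinarith

theorem sum_sum_elim_sigma {A : Type*} [AddCommMonoid A] (f : ℕ → A) (m : ℕ → ℕ) (K r : ℕ) :
    ∑ u : (Σ n : Fin K, Fin (m n)) ⊕ Fin r, Sum.elim (fun p => f p.1) (fun _ => 0) u
      = ∑ n ∈ Finset.range K, m n • f n := by
  simp [Fintype.sum_sum_type, Fintype.sum_sigma, Fin.sum_univ_eq_sum_range (fun n => m n • f n) K]

/-! ### Lower bound on grand-canonical energies of tiles -/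

namespace GrandCanonicalState

theorem hasState (P : GrandCanonicalState d) (s : ℝ) (n : ℕ) :
    HasState s n (particleDensity (P.component n)) (interactionEnergy s (P.component n)) :=
  ⟨P.component n, P.isProbability n, rfl, le_rfl⟩

theorem sum_smul_le_density (P : GrandCanonicalState d) (K : ℕ) :
    ∑ n ∈ Finset.range K, P.weight n • particleDensity (P.component n) ≤ P.density := by
  refine Measure.le_iff.mpr fun A hA => ?_
  rw [density, Measure.sum_apply _ hA, Measure.finsetSum_apply]
  exact ENNReal.sum_le_tsum _

theorem sum_floor_le (P : GrandCanonicalState d) (K M : ℕ) :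
    ∑ n ∈ Finset.range K, ⌊M * (P.weight n).toReal⌋₊ ≤ M := by
  have h1 : ∑ n ∈ Finset.range K, (P.weight n).toReal ≤ 1 := by
    rw [← ENNReal.toReal_sum fun n _ => P.weight.apply_ne_top n]
    refine ENNReal.toReal_le_of_le_ofReal zero_le_one ?_
    rw [ENNReal.ofReal_one, ← P.weight.tsum_coe]
    exact ENNReal.sum_le_tsum _
  have h2 : ((∑ n ∈ Finset.range K, ⌊M * (P.weight n).toReal⌋₊ : ℕ) : ℝ) ≤ M := by
    push_cast
    calc _ ≤ ∑ n ∈ Finset.range K, (M : ℝ) * (P.weight n).toReal := by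
          refine Finset.sum_le_sum fun n _ => Nat.floor_le (by positivity)
      _ = M * ∑ n ∈ Finset.range K, (P.weight n).toReal := (Finset.mul_sum _ _ _).symm
      _ ≤ M * 1 := by gcongr
      _ = M := mul_one _
  exact_mod_cast h2

theorem natCast_floor_le (P : GrandCanonicalState d) (M n : ℕ) :
    (⌊M * (P.weight n).toReal⌋₊ : ℝ≥0∞) ≤ M * P.weight n := by
  rw [← ENNReal.ofReal_natCast]
  refine (ENNReal.ofReal_le_ofReal (Nat.floor_le (by positivity))).trans (le_of_eq ?_)
  rw [ENNReal.ofReal_mul (by positivity), ENNReal.ofReal_natCast,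
    ENNReal.ofReal_toReal (P.weight.apply_ne_top n)]

/-- The bound from a finite family of `k + 1` tiles contained in a cube, of which the fraction
given by (a rounding of) the weight of `n` is occupied by `n` particles. -/
theorem mul_selfEnergy_le (P : GrandCanonicalState d) {s : ℝ} (hs : 0 < s) (hsd : s < d)
    {Ω : Set (ℝ^ d)} (hΩ : MeasurableSet Ω) (hP : P.density = volume.restrict Ω)
    {T : Finset ((ℝ^ d) ≃ᵃⁱ[ℝ] (ℝ^ d))} {k L : ℕ} (hk : k ≠ 0) (hL : 0 < L)
    (hT : T.card = k + 1)
    (hdisj : (T : Set ((ℝ^ d) ≃ᵃⁱ[ℝ] (ℝ^ d))).PairwiseDisjoint fun g => g '' Ω)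
    (hTL : ∀ g ∈ T, g '' Ω ⊆ box 0 L) (K : ℕ) :
    ((k + 1 : ℕ) : ℝ≥0∞) * selfEnergy s (((k + 1 : ℕ) : ℝ≥0∞)⁻¹ • ∑ n ∈ Finset.range K,
        (⌊((k + 1 : ℕ) : ℝ) * (P.weight n).toReal⌋₊ : ℝ≥0∞) • particleDensity (P.component n))
      ≤ ((k + 1 : ℕ) : ℝ≥0∞) * P.energy s + kappa d s * ((L ^ d : ℕ) : ℝ≥0∞)
        + (k : ℝ≥0∞)⁻¹ * selfEnergy s (volume.restrict (box 0 L : Set (ℝ^ d))) := by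
  classical
  set M := k + 1 with hM
  set m : ℕ → ℕ := fun n => ⌊(M : ℝ) * (P.weight n).toReal⌋₊ with hm
  have hM0 : (M : ℝ≥0∞) ≠ 0 := by exact_mod_cast k.succ_ne_zero
  have hM1 : (M : ℝ≥0∞) ≠ ⊤ := ENNReal.natCast_ne_top _
  -- The tiles left over by rounding and by the truncation at `K` stay empty.
  set r := M - ∑ n ∈ Finset.range K, m n with hr
  let U := (Σ n : Fin K, Fin (m n)) ⊕ Fin r
  have hU : Fintype.card U = M := by
    have := P.sum_floor_le K M
    simp only [U, Fintype.card_sum, Fintype.card_sigma, Fintype.card_fin]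
    rw [Fin.sum_univ_eq_sum_range m K, hr]
    exact Nat.add_sub_cancel' this
  -- Any bijection of labels with tiles will do, since the labels are permuted at random.
  have e : U ≃ T := Fintype.equivOfCardEq (by rw [hU, Fintype.card_coe, hT])
  let n : U → ℕ := Sum.elim (fun p => p.1) fun _ => 0
  let μ : U → Measure (ℝ^ d) := Sum.elim (fun p => particleDensity (P.component p.1)) fun _ => 0
  let c : U → ℝ≥0∞ := Sum.elim (fun p => interactionEnergy s (P.component p.1)) fun _ => 0
  have hst : ∀ u, HasState s (n u) (μ u) (c u) := by
    rintro (p | p)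
    · exact P.hasState s p.1
    · exact HasState.zero
  have hsumμ : ∑ u, μ u = ∑ n ∈ Finset.range K, (m n : ℝ≥0∞) • particleDensity (P.component n) := by
    refine (sum_sum_elim_sigma (fun n => particleDensity (P.component n)) m K r).trans ?_
    exact Finset.sum_congr rfl fun n _ => (Nat.cast_smul_eq_nsmul ℝ≥0∞ _ _).symm
  have hsumc : ∑ u, c u ≤ M * P.energy s := by
    refine (sum_sum_elim_sigma (fun n => interactionEnergy s (P.component n)) m K r).trans_le ?_
    calc _ ≤ ∑ n ∈ Finset.range K, M * (P.weight n * interactionEnergy s (P.component n)) := by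
          refine Finset.sum_le_sum fun n _ => ?_
          rw [nsmul_eq_mul, ← mul_assoc]
          gcongr
          exact P.natCast_floor_le M n
      _ ≤ _ := by
          rw [← Finset.mul_sum]
          gcongr
          exact ENNReal.sum_le_tsum _
  have hle : (M : ℝ≥0∞)⁻¹ • ∑ u, μ u ≤ volume.restrict Ω := by
    rw [← hP, hsumμ]
    refine le_trans ?_ (P.sum_smul_le_density K)
    refine Measure.le_iff.mpr fun A hA => ?_
    simp only [Measure.smul_apply, Measure.finsetSum_apply, smul_eq_mul]
    rw [ENNReal.inv_mul_le_iff hM0 hM1, Finset.mul_sum]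
    refine Finset.sum_le_sum fun n _ => ?_
    rw [← mul_assoc]
    gcongr
    exact P.natCast_floor_le M n
  have hmain := mul_selfEnergy_le_of_tiles hs hsd hΩ hk hL hU
    (g := fun u => (e u : (ℝ^ d) ≃ᵃⁱ[ℝ] (ℝ^ d)))
    (fun u u' huu => hdisj (e u).2 (e u').2 fun h => huu (e.injective (Subtype.ext h)))
    (fun u => hTL _ (e u).2) hst hle
  rw [hsumμ] at hmain
  refine hmain.trans ?_
  gcongr

/-- The finite-tile bound per tile, with L tending to infinity at fixed truncation and fixed
tolerance θ, then θ → 0, and all truncations combined by `selfEnergy_sum_le`. -/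
theorem selfEnergy_le_energy (P : GrandCanonicalState d) {s : ℝ} (hs : 0 < s) (hsd : s < d)
    {Ω : Set (ℝ^ d)} (hΩ : IsConvexPolyhedron Ω) (ht : TilesSpace Ω) {m : ℕ}
    (hm : volume Ω = m) (hP : P.density = volume.restrict Ω) :
    selfEnergy s (volume.restrict Ω) ≤ P.energy s + kappa d s * volume Ω := by
  have hd : 0 < d := by
    rcases Nat.eq_zero_or_pos d with rfl | h
    · simp at hsd; linarith
    · exact h
  have hm0 : 0 < m := by
    have := hΩ.isOpen.measure_pos volume hΩ.1
    rw [hm] at this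
    exact_mod_cast this
  have hκ := kappa_ne_top (d := d) hs hsd
  obtain ⟨R, hR⟩ := exists_finset_tiles hΩ ht
  choose T hTd hTL hTc using hR
  rw [hm] at hTc
  rw [← hP, density]
  refine selfEnergy_sum_le (fun n => ?_) fun K => ?_
  · have := (P.hasState s n).isFiniteMeasure
    exact inferInstance
  set ρK := ∑ n ∈ Finset.range K, P.weight n • particleDensity (P.component n) with hρK
  have hρKf : SFinite ρK := by
    have : IsFiniteMeasure ρK := by
      refine ⟨((P.sum_smul_le_density K) univ).trans_lt ?_⟩
      rw [hP, Measure.restrict_apply_univ, hm]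
      exact ENNReal.natCast_lt_top m
    exact inferInstance
  -- Rounding keeps at least the fraction 1 - θ of the truncated density, and the direct energy is
  -- quadratic, hence the square.
  have key : ∀ θ : ℝ, 0 < θ → ENNReal.ofReal (1 - θ) ^ 2 * selfEnergy s ρK
      ≤ P.energy s + kappa d s * (ENNReal.ofReal (1 + θ) * m) + ENNReal.ofReal θ := by
    intro θ hθ
    have hMt := tendsto_card hd hTc
    obtain ⟨L, hL1, hL2, hL3, hL4, hL5⟩ := ((eventually_pow_le_card hTc hθ).and
      ((eventually_selfEnergy_box_le hs hsd hm0 hTc hθ).and ((hMt.eventually_ge_atTop 2).and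
      ((eventually_gt_atTop 0).and (hMt.eventually ((Finset.eventually_all (Finset.range K)).mpr
        fun n _ => eventually_le_floor_div (P.weight n) (P.weight.apply_ne_top n) hθ)))))).exists
    obtain ⟨k, hk⟩ : ∃ k, (T L).card = k + 1 := ⟨(T L).card - 1, by omega⟩
    have hk0 : k ≠ 0 := by omega
    have hmain := P.mul_selfEnergy_le hs hsd hΩ.isOpen.measurableSet hP hk0 hL4 hk (hTd L) (hTL L) K
    rw [hk] at hL1 hL2 hL5
    have hM0 : ((k + 1 : ℕ) : ℝ≥0∞) ≠ 0 := by exact_mod_cast k.succ_ne_zero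
    have hM1 : ((k + 1 : ℕ) : ℝ≥0∞) ≠ ⊤ := ENNReal.natCast_ne_top _
    have hkc0 : (k : ℝ≥0∞) ≠ 0 := by exact_mod_cast hk0
    have hkc1 : (k : ℝ≥0∞) ≠ ⊤ := ENNReal.natCast_ne_top _
    have hρ : ENNReal.ofReal (1 - θ) • ρK ≤ ((k + 1 : ℕ) : ℝ≥0∞)⁻¹ • ∑ n ∈ Finset.range K,
        (⌊((k + 1 : ℕ) : ℝ) * (P.weight n).toReal⌋₊ : ℝ≥0∞) •
          particleDensity (P.component n) := by
      refine Measure.le_iff.mpr fun A hA => ?_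
      simp only [hρK, Measure.smul_apply, Measure.finsetSum_apply, smul_eq_mul, Finset.mul_sum]
      refine Finset.sum_le_sum fun n hn => ?_
      rw [← mul_assoc, ← mul_assoc]
      exact mul_le_mul_left (hL5 n hn) _
    have hLd : ((L ^ d : ℕ) : ℝ≥0∞) ≤ ENNReal.ofReal (1 + θ) * m * ((k + 1 : ℕ) : ℝ≥0∞) := by
      rw [← ENNReal.ofReal_natCast, ← ENNReal.ofReal_natCast m,
        ← ENNReal.ofReal_natCast (k + 1), ← ENNReal.ofReal_mul (by positivity),
        ← ENNReal.ofReal_mul (by positivity)]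
      refine ENNReal.ofReal_le_ofReal ?_
      push_cast at hL1 ⊢
      linarith
    have hQ : (k : ℝ≥0∞)⁻¹ * selfEnergy s (volume.restrict (box 0 L : Set (ℝ^ d)))
        ≤ ENNReal.ofReal θ * ((k + 1 : ℕ) : ℝ≥0∞) := by
      rw [ENNReal.inv_mul_le_iff hkc0 hkc1]
      refine hL2.trans (le_of_eq ?_)
      rw [← ENNReal.ofReal_natCast k, ← ENNReal.ofReal_natCast (k + 1),
        ← ENNReal.ofReal_mul hθ.le, ← ENNReal.ofReal_mul (by positivity)]
      congr 1
      push_cast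
      ring
    refine (ENNReal.mul_le_mul_iff_right hM0 hM1).mp ?_
    calc ((k + 1 : ℕ) : ℝ≥0∞) * (ENNReal.ofReal (1 - θ) ^ 2 * selfEnergy s ρK)
        ≤ _ := by
          rw [← selfEnergy_smul]
          exact mul_le_mul_right (selfEnergy_mono s hρ) _
      _ ≤ _ := hmain
      _ ≤ ((k + 1 : ℕ) : ℝ≥0∞) * P.energy s
          + kappa d s * (ENNReal.ofReal (1 + θ) * m * ((k + 1 : ℕ) : ℝ≥0∞))
          + ENNReal.ofReal θ * ((k + 1 : ℕ) : ℝ≥0∞) := by gcongr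
      _ = _ := by ring
  have hlim1 : Tendsto (fun θ : ℝ => ENNReal.ofReal (1 - θ) ^ 2 * selfEnergy s ρK) (𝓝[>] 0)
      (𝓝 (ENNReal.ofReal (1 - 0) ^ 2 * selfEnergy s ρK)) := by
    refine ENNReal.Tendsto.mul_const ?_ (Or.inl (by simp))
    have : Continuous fun θ : ℝ => ENNReal.ofReal (1 - θ) ^ 2 :=
      (ENNReal.continuous_pow 2).comp
        (ENNReal.continuous_ofReal.comp (continuous_const.sub continuous_id))
    exact (this.tendsto 0).mono_left nhdsWithin_le_nhds
  have hlim2 : Tendsto (fun θ : ℝ => P.energy s + kappa d s * (ENNReal.ofReal (1 + θ) * m)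
      + ENNReal.ofReal θ) (𝓝[>] 0) (𝓝 (P.energy s + kappa d s * (ENNReal.ofReal (1 + 0) * m)
      + ENNReal.ofReal 0)) := by
    have h1 : Tendsto (fun θ : ℝ => ENNReal.ofReal (1 + θ)) (𝓝 0) (𝓝 (ENNReal.ofReal (1 + 0))) :=
      (ENNReal.continuous_ofReal.comp (continuous_const.add continuous_id)).tendsto 0
    have h2 : Tendsto (fun θ : ℝ => ENNReal.ofReal θ) (𝓝 0) (𝓝 (ENNReal.ofReal 0)) :=
      ENNReal.continuous_ofReal.tendsto 0
    refine Tendsto.mono_left ?_ nhdsWithin_le_nhds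
    exact (tendsto_const_nhds.add (ENNReal.Tendsto.const_mul (ENNReal.Tendsto.mul_const h1
      (Or.inr (ENNReal.natCast_ne_top m))) (Or.inr hκ))).add h2
  have := le_of_tendsto_of_tendsto hlim1 hlim2
    (eventually_nhdsWithin_of_forall fun θ hθ => key θ hθ)
  simpa [hm] using this

end GrandCanonicalState

theorem neg_kappa_le_grandCanonicalEnergy {s : ℝ} (hs : 0 < s) (hsd : s < d) {Ω : Set (ℝ^ d)}
    (hΩ : IsConvexPolyhedron Ω) (ht : TilesSpace Ω) {m : ℕ} (hm : volume Ω = m) :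
    ((-(kappa d s).toReal : ℝ) : EReal)
      ≤ grandCanonicalEnergy s (Ω.indicator fun _ => 1) / (volume Ω : EReal) := by
  have hκ := kappa_ne_top (d := d) hs hsd
  have hm0 : 0 < m := by
    have := hΩ.isOpen.measure_pos volume hΩ.1
    rw [hm] at this
    exact_mod_cast this
  have hρ : (volume : Measure (ℝ^ d)).withDensity (Ω.indicator fun _ => 1)
      = volume.restrict Ω := by
    rw [withDensity_indicator_const hΩ.isOpen.measurableSet 1, one_smul]
  have hD : selfEnergy s (volume.restrict Ω) ≠ ⊤ :=
    selfEnergy_restrict_ne_top hs hsd (by rw [hm]; exact ENNReal.natCast_ne_top m)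
  have hsf : SFinite ((volume : Measure (ℝ^ d)).withDensity (Ω.indicator fun _ => 1)) := by
    rw [hρ]; infer_instance
  rw [grandCanonicalEnergy,
    directEnergy_eq s (measurable_const.indicator hΩ.isOpen.measurableSet), hρ]
  set D := selfEnergy s (volume.restrict Ω) with hDdef
  set I := ⨅ (P : GrandCanonicalState d) (_ : P.density = volume.restrict Ω), P.energy s with hI
  have hle : D ≤ I + kappa d s * m := by
    rw [← tsub_le_iff_right]
    refine le_iInf₂ fun P hP => ?_
    rw [tsub_le_iff_right, ← hm]
    exact P.selfEnergy_le_energy hs hsd hΩ ht hm hP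
  have hm1 : ((m : ℝ≥0∞) : EReal) = ((m : ℝ) : EReal) := by
    rw [← EReal.coe_ennreal_toReal (ENNReal.natCast_ne_top m), ENNReal.toReal_natCast]
  rw [hm, hm1, EReal.le_div_iff_mul_le (by exact_mod_cast hm0) (EReal.coe_ne_top _),
    ← EReal.coe_ennreal_toReal hD]
  rcases eq_or_ne I ⊤ with h | h
  · rw [h, EReal.coe_ennreal_top, EReal.top_sub_coe]
    exact le_top
  · have h2 := ENNReal.toReal_mono (by finiteness) hle
    rw [ENNReal.toReal_add h (by finiteness), ENNReal.toReal_mul, ENNReal.toReal_natCast] at h2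
    rw [← EReal.coe_ennreal_toReal h, ← EReal.coe_mul, ← EReal.coe_sub, EReal.coe_le_coe_iff]
    linarith

end UEG

/-! ### The main theorem, with e_UEG identified as -κ. -/

theorem corollary3p3 (d : ℕ) (s : ℝ) (hs : 0 < s) (hsd : s < d) :
    (∃! e : ℝ, UEG.IsUEGEnergy d s e) ∧
      ∀ e : ℝ, UEG.IsUEGEnergy d s e →
        ∀ Ω : Set (EuclideanSpace ℝ (Fin d)),
          UEG.IsConvexPolyhedron Ω → UEG.TilesSpace Ω → (∃ m : ℕ, volume Ω = m) →
            (e : EReal) ≤ UEG.grandCanonicalEnergy s (Ω.indicator fun _ => 1)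
              / (volume Ω : EReal) := by
  have hd : 0 < d := by
    rcases Nat.eq_zero_or_pos d with rfl | h
    · simp at hsd; linarith
    · exact h
  have hκ := UEG.isUEGEnergy_neg_kappa (d := d) hs hsd
  refine ⟨⟨_, hκ, fun e he => he.unique hd hκ⟩, fun e he Ω hΩ ht hm => ?_⟩
  obtain ⟨m, hm⟩ := hm
  rw [he.unique hd hκ]
  exact UEG.neg_kappa_le_grandCanonicalEnergy hs hsd hΩ ht hm
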